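/- Let $k$ be a commutative ring and let $\mathcal H$ be a quasitriangular Hopf algebra over $k$ with coproduct $\Delta(x)=x_{(1)}\otimes x_{(2)}$, counit $\varepsilon$, antipode $\gamma$ and universal R-matrix $\mathcal R=\mathcal R_1\otimes\mathcal R_2\in\mathcal H\otimes\mathcal H$; that is, $\mathcal R$ is invertible and $$(\Delta\otimes\mathrm{id})(\mathcal R)=\mathcal R_{13}\mathcal R_{23},\qquad(\mathrm{id}\otimes\Delta)(\mathcal R)=\mathcal R_{13}\mathcal R_{12},\qquad\mathcal R\,\Delta(x)=\Delta^{op}(x)\,\mathcal R .$$ Let $\mathcal H^*$ be a Hopf dual of $\mathcal H$: a Hopf algebra over $k$ with a Hopf pairing $\langle\cdot,\cdot\rangle\colon\mathcal H^*\otimes\mathcal H\to k$ such that $\langle a,x\rangle=0$ for all $x\in\mathcal H$ implies $a=0$. *Reflection equation dual.* Put $x\triangleright a=a_{(1)}\langle a_{(2)},x\rangle$ and $a\triangleleft x=\langle a_{(1)},x\rangle a_{(2)}$. Then $\mathcal H^*$ is a module algebra over $\mathcal H^{op}\otimes\mathcal H$ (where $\mathcal H^{op}$ is $\mathcal H$ with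 the opposite coproduct) by $(x\otimes y)\blacktriangleright a=y\triangleright a\triangleleft\gamma(x)$. The algebra $\tilde{\mathcal H}^*$ is the module $\mathcal H^*$ with the multiplication $a\circ b=m\bigl(\mathcal F\blacktriangleright(a\otimes b)\bigr)$ twisted by the cocycle $\mathcal F=\mathcal R_{13}\mathcal R_{23}\in(\mathcal H^{op}\otimes\mathcal H)^{\otimes2}$. It is an $\mathcal H$-module algebra, where $x$ acts by $\Delta(x)\,\blacktriangleright$. *Twisted tensor powers.* For $\mathcal H$-module algebras $A$, $B$, the twisted tensor product $A\tilde\otimes B$ is the module $A\otimes B$ with the multiplication $$(a\otimes b)(a'\otimes b')=a(\mathcal R_2\blacktriangleright a')\otimes(\mathcal R_1\blacktriangleright b)b' ,$$ on which $\mathcal H$ acts through $\Delta$. Set $(\tilde{\mathcal H}^*)^{\tilde\otimes0}=k$ and $(\tilde{\mathcal H}^*)^{\tilde\otimes(n+1)}=(\tilde{\mathcal H}^*)^{\tilde\otimes n}\,\tilde\otimes\,\tilde{\mathcal H}^*$. For $1\le l\le n$ let $\iota_l\colon\tilde{\mathcal H}^*\to(\tilde{\mathcal H}^*)^{\tilde\otimes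 n}$ be the embedding as the $l$-th tensor factor, with $1$ in the other factors. *K-matrices.* Let $\mathcal A=(\tilde{\mathcal H}^*)^{\tilde\otimes n}$ and let $\mathcal K^{\{l\}}=(\mathrm{id}\otimes\iota_l)(\mathcal K)$ be the image of the canonical element $\mathcal K\in\mathcal H\,\hat\otimes\,\mathcal H^*$. The completed tensor product $\mathcal H\,\hat\otimes\,\mathcal H\,\hat\otimes\,\mathcal A$ is understood as the algebra of linear maps $\mathcal H^*\otimes\mathcal H^*\to\mathcal A$ with the convolution product, where an element $X$ is the map $f\otimes g\mapsto(f\otimes g\otimes\mathrm{id})(X)$. In it, $\mathcal K^{\{l\}}_1$ is $f\otimes g\mapsto\varepsilon(g)\,\iota_l(f)$, $\mathcal K^{\{l\}}_2$ is $f\otimes g\mapsto\varepsilon(f)\,\iota_l(g)$, and $u\in\mathcal H\otimes\mathcal H$ is $f\otimes g\mapsto\langle f\otimes g,u\rangle 1$. **Proposition.** For every $n$, the following relations hold in $\mathcal H\,\hat\otimes\,\mathcal H\,\hat\otimes\,(\tilde{\mathcal H}^*)^{\tilde\otimes n}$: $$\mathcal R_{21}\,\mathcal K^{\{k\}}_1\,\mathcal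 R_{12}\,\mathcal K^{\{k\}}_2=\mathcal K^{\{k\}}_2\,\mathcal R_{21}\,\mathcal K^{\{k\}}_1\,\mathcal R_{12},\qquad k=1,\dots,n,$$ $$\mathcal R_{12}^{-1}\,\mathcal K^{\{k\}}_1\,\mathcal R_{12}\,\mathcal K^{\{l\}}_2=\mathcal K^{\{l\}}_2\,\mathcal R_{12}^{-1}\,\mathcal K^{\{k\}}_1\,\mathcal R_{12},\qquad l,k=1,\dots,n,\ l<k.$$ Moreover, if $\mathcal H$ has a finite basis $(e_i)$ with a dual family $(e^i)$ in $\mathcal H^*$, $\langle e^i,e_j\rangle=\delta_{ij}$, then the same relations hold in the algebraic tensor product $\mathcal H\otimes\mathcal H\otimes(\tilde{\mathcal H}^*)^{\tilde\otimes n}$ for $\mathcal K^{\{l\}}=\sum_i e_i\otimes\iota_l(e^i)$, with $\mathcal K^{\{l\}}_1=\sum_i e_i\otimes1\otimes\iota_l(e^i)$ and $\mathcal K^{\{l\}}_2=\sum_i1\otimes e_i\otimes\iota_l(e^i)$. -/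

import Mathlib

open TensorProduct Coalgebra

universe u v w

namespace ReflEq

section Twist

variable {k : Type u} {E : Type v} {A : Type w} [CommRing k] [Ring E] [Algebra k E]
  [Ring A] [Algebra k A]

/-- For an action `ρ` of an algebra `E` on an algebra `A`, the bilinear map
`a ⊗ b ↦ m (F ▸ (a ⊗ b)) = (F₁ ▸ a) (F₂ ▸ b)`, for `F = F₁ ⊗ F₂ ∈ E ⊗ E`. -/
noncomputable def mulVia (ρ : E →ₐ[k] Module.End k A) :
    E ⊗[k] E →ₗ[k] A →ₗ[k] A →ₗ[k] A :=
  TensorProduct.lift (LinearMap.mk₂ k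
    (fun x y => (LinearMap.mul k A).compl₁₂ (ρ x) (ρ y))
    (by intros; ext; simp) (by intros; ext; simp)
    (by intros; ext; simp [mul_add]) (by intros; ext; simp))

@[simp] theorem mulVia_tmul (ρ : E →ₐ[k] Module.End k A) (x y : E) (a b : A) :
    mulVia ρ (x ⊗ₜ[k] y) a b = ρ x a * ρ y b := by
  simp [mulVia]

/-- `A` is a module algebra, through `ρ`, over the algebra `E` with coproduct `δ` and counit
`ε`: `x ▸ (a b) = (x₁ ▸ a) (x₂ ▸ b)` and `x ▸ 1 = ε(x) 1`. -/
structure IsModuleAlgebra (δ : E →ₐ[k] E ⊗[k] E) (ε : E →ₐ[k] k)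
    (ρ : E →ₐ[k] Module.End k A) : Prop where
  act_mul : ∀ (x : E) (a b : A), ρ x (a * b) = mulVia ρ (δ x) a b
  act_one : ∀ x : E, ρ x 1 = ε x • (1 : A)

/-- The cocycle equation `(δ ⊗ id)(F) F₁₂ = (id ⊗ δ)(F) F₂₃` together with the normalization
`(ε ⊗ id)(F) = 1 = (id ⊗ ε)(F)`. -/
structure IsCocycle (δ : E →ₐ[k] E ⊗[k] E) (ε : E →ₐ[k] k) (F : E ⊗[k] E) : Prop where
  cocycle : Algebra.TensorProduct.map δ (AlgHom.id k E) F * (F ⊗ₜ[k] (1 : E)) =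
    (Algebra.TensorProduct.assoc k k k E E E).symm
      (Algebra.TensorProduct.map (AlgHom.id k E) δ F * ((1 : E) ⊗ₜ[k] F))
  counit_left : Algebra.TensorProduct.lid k E
    (Algebra.TensorProduct.map ε (AlgHom.id k E) F) = 1
  counit_right : Algebra.TensorProduct.rid k k E
    (Algebra.TensorProduct.map (AlgHom.id k E) ε F) = 1

theorem mulVia_mul_tmul (ρ : E →ₐ[k] Module.End k A) (P : E ⊗[k] E) (x y : E) (a b : A) :
    mulVia ρ (P * (x ⊗ₜ[k] y)) a b = mulVia ρ P (ρ x a) (ρ y b) := by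
  induction P with
  | zero => simp
  | tmul p q => simp
  | add p q hp hq => simp [add_mul, hp, hq]

variable {δ : E →ₐ[k] E ⊗[k] E} {ε : E →ₐ[k] k} {ρ : E →ₐ[k] Module.End k A}

theorem IsModuleAlgebra.act_mulVia (h : IsModuleAlgebra δ ε ρ) (x : E) (Q : E ⊗[k] E)
    (a b : A) : ρ x (mulVia ρ Q a b) = mulVia ρ (δ x * Q) a b := by
  induction Q with
  | zero => simp
  | tmul p q => rw [mulVia_tmul, h.act_mul, mulVia_mul_tmul]
  | add p q hp hq => simp [mul_add, hp, hq]

/-- `(x ⊗ y) ⊗ z ↦ (x ▸ a) (y ▸ b) (z ▸ c)`. -/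
noncomputable def mulVia₃ (ρ : E →ₐ[k] Module.End k A) (a b c : A) :
    (E ⊗[k] E) ⊗[k] E →ₗ[k] A :=
  LinearMap.mul' k A ∘ₗ TensorProduct.map (((mulVia ρ).flip a).flip b)
    (ρ.toLinearMap.flip c)

@[simp] theorem mulVia₃_tmul (ρ : E →ₐ[k] Module.End k A) (a b c : A) (P : E ⊗[k] E)
    (z : E) : mulVia₃ ρ a b c (P ⊗ₜ[k] z) = mulVia ρ P a b * ρ z c := by
  simp [mulVia₃]

theorem mulVia₃_assoc_symm (ρ : E →ₐ[k] Module.End k A) (a b c : A) (x : E) (Q : E ⊗[k] E) :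
    mulVia₃ ρ a b c ((Algebra.TensorProduct.assoc k k k E E E).symm (x ⊗ₜ[k] Q)) =
      ρ x a * mulVia ρ Q b c := by
  induction Q with
  | zero => simp
  | tmul p q => simp [mul_assoc]
  | add p q hp hq => simp only [tmul_add, map_add, hp, hq, LinearMap.add_apply, mul_add]

theorem IsModuleAlgebra.left_assoc (h : IsModuleAlgebra δ ε ρ) (P Q : E ⊗[k] E) (a b c : A) :
    mulVia ρ P (mulVia ρ Q a b) c =
      mulVia₃ ρ a b c (Algebra.TensorProduct.map δ (AlgHom.id k E) P * (Q ⊗ₜ[k] (1 : E))) := by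
  induction P with
  | zero => simp
  | tmul p q => simp [h.act_mulVia]
  | add p q hp hq => simp [add_mul, hp, hq]

theorem IsModuleAlgebra.right_assoc (h : IsModuleAlgebra δ ε ρ) (P Q : E ⊗[k] E) (a b c : A) :
    mulVia ρ P a (mulVia ρ Q b c) =
      mulVia₃ ρ a b c ((Algebra.TensorProduct.assoc k k k E E E).symm
        (Algebra.TensorProduct.map (AlgHom.id k E) δ P * ((1 : E) ⊗ₜ[k] Q))) := by
  induction P with
  | zero => simp
  | tmul p q =>
    rw [Algebra.TensorProduct.map_tmul, Algebra.TensorProduct.tmul_mul_tmul,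
      mulVia₃_assoc_symm, mulVia_tmul, h.act_mulVia]
    simp
  | add p q hp hq => simp only [add_mul, map_add, hp, hq, LinearMap.add_apply]

theorem IsModuleAlgebra.mulVia_one_left (h : IsModuleAlgebra δ ε ρ) (P : E ⊗[k] E) (b : A) :
    mulVia ρ P 1 b = ρ (Algebra.TensorProduct.lid k E
      (Algebra.TensorProduct.map ε (AlgHom.id k E) P)) b := by
  induction P with
  | zero => simp
  | tmul p q => simp [h.act_one]
  | add p q hp hq => simp [hp, hq]

theorem IsModuleAlgebra.mulVia_one_right (h : IsModuleAlgebra δ ε ρ) (P : E ⊗[k] E) (b : A) :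
    mulVia ρ P b 1 = ρ (Algebra.TensorProduct.rid k k E
      (Algebra.TensorProduct.map (AlgHom.id k E) ε P)) b := by
  induction P with
  | zero => simp
  | tmul p q => simp [h.act_one]
  | add p q hp hq => simp [hp, hq]

theorem IsModuleAlgebra.twist_assoc (h : IsModuleAlgebra δ ε ρ) {F : E ⊗[k] E}
    (hF : IsCocycle δ ε F) (a b c : A) :
    mulVia ρ F (mulVia ρ F a b) c = mulVia ρ F a (mulVia ρ F b c) := by
  rw [h.left_assoc, h.right_assoc, hF.cocycle]

theorem IsModuleAlgebra.twist_one_mul (h : IsModuleAlgebra δ ε ρ) {F : E ⊗[k] E}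
    (hF : IsCocycle δ ε F) (a : A) : mulVia ρ F 1 a = a := by
  rw [h.mulVia_one_left, hF.counit_left]; simp

theorem IsModuleAlgebra.twist_mul_one (h : IsModuleAlgebra δ ε ρ) {F : E ⊗[k] E}
    (hF : IsCocycle δ ε F) (a : A) : mulVia ρ F a 1 = a := by
  rw [h.mulVia_one_right, hF.counit_right]; simp

/-- The underlying module of the twist of a module algebra `A` by a cocycle `F`. -/
def Twisted {F : E ⊗[k] E} (_ : IsModuleAlgebra δ ε ρ) (_ : IsCocycle δ ε F) : Type w := A

namespace Twisted

variable {F : E ⊗[k] E} (h : IsModuleAlgebra δ ε ρ) (hF : IsCocycle δ ε F)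

instance : AddCommGroup (Twisted h hF) := inferInstanceAs (AddCommGroup A)

instance : Module k (Twisted h hF) := inferInstanceAs (Module k A)

/-- The identity map from a module algebra to its twist. -/
def equiv : A ≃ₗ[k] Twisted h hF := LinearEquiv.refl k A

/-- The twisted multiplication `a ∘ b = (F₁ ▸ a) (F₂ ▸ b)`. -/
noncomputable def mul : Twisted h hF →ₗ[k] Twisted h hF →ₗ[k] Twisted h hF := mulVia ρ F

noncomputable instance : Ring (Twisted h hF) where
  __ := (inferInstance : AddCommGroup (Twisted h hF))
  mul a b := Twisted.mul h hF a b
  one := equiv h hF 1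
  left_distrib a b c := map_add (Twisted.mul h hF a) b c
  right_distrib a b c := LinearMap.map_add₂ (Twisted.mul h hF) a b c
  zero_mul a := LinearMap.map_zero₂ (Twisted.mul h hF) a
  mul_zero a := map_zero (Twisted.mul h hF a)
  mul_assoc := h.twist_assoc hF
  one_mul := h.twist_one_mul hF
  mul_one := h.twist_mul_one hF

noncomputable instance : Algebra k (Twisted h hF) :=
  Algebra.ofModule (fun r a b => LinearMap.map_smul₂ (Twisted.mul h hF) r a b)
    (fun r a b => map_smul (Twisted.mul h hF a) r b)

theorem equiv_mul (a b : A) :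
    equiv h hF a * equiv h hF b = equiv h hF (mulVia ρ F a b) := rfl

theorem equiv_one : equiv h hF 1 = 1 := rfl

/-- The action of `E` on the twist is that on `A`, restricted here along a map `φ : E' → E`. -/
def act {E' : Type*} [Ring E'] [Algebra k E'] (φ : E' →ₐ[k] E) :
    E' →ₐ[k] Module.End k (Twisted h hF) := ρ.comp φ

theorem act_apply {E' : Type*} [Ring E'] [Algebra k E'] (φ : E' →ₐ[k] E) (x : E') (a : A) :
    act h hF φ x (equiv h hF a) = equiv h hF (ρ (φ x) a) := rfl

theorem mulVia_act {E' : Type*} [Ring E'] [Algebra k E'] (φ : E' →ₐ[k] E)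
    (P : E' ⊗[k] E') (a b : A) :
    mulVia (act h hF φ) P (equiv h hF a) (equiv h hF b) =
      equiv h hF (mulVia ρ (F * Algebra.TensorProduct.map φ φ P) a b) := by
  induction P with
  | zero => simp
  | tmul x y =>
    rw [mulVia_tmul, act_apply, act_apply, equiv_mul, Algebra.TensorProduct.map_tmul,
      mulVia_mul_tmul]
  | add p q hp hq => simp only [map_add, mul_add, LinearMap.add_apply, hp, hq]

theorem isModuleAlgebra {E' : Type*} [Ring E'] [Algebra k E'] (φ : E' →ₐ[k] E)
    (δ' : E' →ₐ[k] E' ⊗[k] E') (ε' : E' →ₐ[k] k)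
    (hδ : ∀ x, F * Algebra.TensorProduct.map φ φ (δ' x) = δ (φ x) * F)
    (hε : ∀ x, ε (φ x) = ε' x) : IsModuleAlgebra δ' ε' (act h hF φ) where
  act_mul x a b := by
    have := h.act_mulVia (φ x) F ((equiv h hF).symm a) ((equiv h hF).symm b)
    rw [← hδ] at this
    rw [← (equiv h hF).apply_symm_apply a, ← (equiv h hF).apply_symm_apply b, mulVia_act,
      equiv_mul, act_apply, this]
  act_one x := by
    rw [← equiv_one, act_apply, h.act_one, hε, map_smul]

end Twisted

end Twist

section Quasitriangular

variable (k : Type u) (H : Type v) [CommRing k] [Ring H] [HopfAlgebra k H]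

/-- `P ↦ P₁₂`, from `H ⊗ H` to `H ⊗ H ⊗ H`. -/
noncomputable def leg₁₂ : H ⊗[k] H →ₐ[k] (H ⊗[k] H) ⊗[k] H :=
  Algebra.TensorProduct.includeLeft

/-- `P ↦ P₁₃`, from `H ⊗ H` to `H ⊗ H ⊗ H`. -/
noncomputable def leg₁₃ : H ⊗[k] H →ₐ[k] (H ⊗[k] H) ⊗[k] H :=
  Algebra.TensorProduct.map Algebra.TensorProduct.includeLeft (AlgHom.id k H)

/-- `P ↦ P₂₃`, from `H ⊗ H` to `H ⊗ H ⊗ H`. -/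
noncomputable def leg₂₃ : H ⊗[k] H →ₐ[k] (H ⊗[k] H) ⊗[k] H :=
  Algebra.TensorProduct.map Algebra.TensorProduct.includeRight (AlgHom.id k H)

/-- The flip `x ⊗ y ↦ y ⊗ x` of `H ⊗ H`; it sends `P` to `P₂₁`. -/
noncomputable def flip₂₁ : H ⊗[k] H →ₐ[k] H ⊗[k] H :=
  (Algebra.TensorProduct.comm k H H).toAlgHom

/-- The coopposite coproduct `Δᵒᵖ(x) = x₂ ⊗ x₁`. -/
noncomputable def comulOp : H →ₐ[k] H ⊗[k] H :=
  (flip₂₁ k H).comp (Bialgebra.comulAlgHom k H)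

/-- A universal R-matrix of a Hopf algebra `H`. With it, `H` is a quasitriangular Hopf algebra. -/
structure UniversalR where
  /-- the invertible element `R ∈ H ⊗ H` -/
  R : (H ⊗[k] H)ˣ
  comul_left : Algebra.TensorProduct.map (Bialgebra.comulAlgHom k H) (AlgHom.id k H) R =
    leg₁₃ k H R * leg₂₃ k H R
  comul_right : (Algebra.TensorProduct.assoc k k k H H H).symm
    (Algebra.TensorProduct.map (AlgHom.id k H) (Bialgebra.comulAlgHom k H) R) =
    leg₁₃ k H R * leg₁₂ k H R
  flip_comul : ∀ x : H, R * Bialgebra.comulAlgHom k H x = comulOp k H x * R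

end Quasitriangular

section Legs

open WithConv

variable {k : Type u} {H : Type v} {B : Type w} [CommRing k] [Ring H] [HopfAlgebra k H]
  [Ring B] [Algebra k B]

/-- Three algebra maps with commuting images give an algebra map on the tensor cube. -/
noncomputable def lift₃ (f g h : H →ₐ[k] B) (hfg : ∀ x y, Commute (f x) (g y))
    (hfh : ∀ x y, Commute (f x) (h y)) (hgh : ∀ x y, Commute (g x) (h y)) :
    (H ⊗[k] H) ⊗[k] H →ₐ[k] B :=
  Algebra.TensorProduct.lift (Algebra.TensorProduct.lift f g hfg) h (fun P y => by
    induction P with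
    | zero => simp
    | tmul a b => simpa using (hfh a y).mul_left (hgh b y)
    | add p q hp hq => simpa using hp.add_left hq)

theorem commute_lift {f : H →ₐ[k] B} {g : H →ₐ[k] B} (hfg : ∀ x y, Commute (f x) (g y))
    {b : B} (h₁ : ∀ x, Commute (f x) b) (h₂ : ∀ x, Commute (g x) b) (P : H ⊗[k] H) :
    Commute (Algebra.TensorProduct.lift f g hfg P) b := by
  induction P with
  | zero => simp
  | tmul x y => simpa using (h₁ x).mul_left (h₂ y)
  | add p q hp hq => simpa using hp.add_left hq

theorem commute_lift_lift {f g f' g' : H →ₐ[k] B} (hfg : ∀ x y, Commute (f x) (g y))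
    (hfg' : ∀ x y, Commute (f' x) (g' y)) (h₁ : ∀ x y, Commute (f x) (f' y))
    (h₂ : ∀ x y, Commute (f x) (g' y)) (h₃ : ∀ x y, Commute (g x) (f' y))
    (h₄ : ∀ x y, Commute (g x) (g' y)) (P Q : H ⊗[k] H) :
    Commute (Algebra.TensorProduct.lift f g hfg P) (Algebra.TensorProduct.lift f' g' hfg' Q) :=
  commute_lift hfg
    (fun x => (commute_lift hfg' (fun y => (h₁ x y).symm) (fun y => (h₂ x y).symm) Q).symm)
    (fun x => (commute_lift hfg' (fun y => (h₃ x y).symm) (fun y => (h₄ x y).symm) Q).symm) P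

variable (𝓡 : UniversalR k H)

theorem UniversalR.lift_comul_left (f g h : H →ₐ[k] B) (hfg : ∀ x y, Commute (f x) (g y))
    (hfh : ∀ x y, Commute (f x) (h y)) (hgh : ∀ x y, Commute (g x) (h y))
    (φ : H ⊗[k] H →ₐ[k] B)
    (hφ : ∀ x y, φ (x ⊗ₜ[k] y) = Algebra.TensorProduct.lift f g hfg (comul x) * h y) :
    φ 𝓡.R = Algebra.TensorProduct.lift f h hfh 𝓡.R * Algebra.TensorProduct.lift g h hgh 𝓡.R := by
  have h1 : φ = (lift₃ f g h hfg hfh hgh).comp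
      (Algebra.TensorProduct.map (Bialgebra.comulAlgHom k H) (AlgHom.id k H)) := by
    refine AlgHom.toLinearMap_injective (TensorProduct.ext' fun x y => ?_)
    simp [hφ, lift₃]
  have h2 : Algebra.TensorProduct.lift f h hfh = (lift₃ f g h hfg hfh hgh).comp (leg₁₃ k H) := by
    refine AlgHom.toLinearMap_injective (TensorProduct.ext' fun x y => ?_)
    simp [lift₃, leg₁₃]
  have h3 : Algebra.TensorProduct.lift g h hgh = (lift₃ f g h hfg hfh hgh).comp (leg₂₃ k H) := by
    refine AlgHom.toLinearMap_injective (TensorProduct.ext' fun x y => ?_)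
    simp [lift₃, leg₂₃]
  rw [h1, h2, h3, AlgHom.comp_apply, 𝓡.comul_left, map_mul]
  rfl

theorem UniversalR.lift_comul_right (f g h : H →ₐ[k] B) (hfg : ∀ x y, Commute (f x) (g y))
    (hfh : ∀ x y, Commute (f x) (h y)) (hgh : ∀ x y, Commute (g x) (h y))
    (φ : H ⊗[k] H →ₐ[k] B)
    (hφ : ∀ x y, φ (x ⊗ₜ[k] y) = f x * Algebra.TensorProduct.lift g h hgh (comul y)) :
    φ 𝓡.R = Algebra.TensorProduct.lift f h hfh 𝓡.R * Algebra.TensorProduct.lift f g hfg 𝓡.R := by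
  have h0 : ∀ (x : H) (Q : H ⊗[k] H), lift₃ f g h hfg hfh hgh
      ((Algebra.TensorProduct.assoc k k k H H H).symm (x ⊗ₜ[k] Q)) =
      f x * Algebra.TensorProduct.lift g h hgh Q := by
    intro x Q
    induction Q with
    | zero => simp
    | tmul p q => simp [lift₃, mul_assoc]
    | add p q hp hq => simp only [tmul_add, map_add, hp, hq, mul_add]
  have h1 : φ = ((lift₃ f g h hfg hfh hgh).comp
      (Algebra.TensorProduct.assoc k k k H H H).symm.toAlgHom).comp
      (Algebra.TensorProduct.map (AlgHom.id k H) (Bialgebra.comulAlgHom k H)) := by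
    refine AlgHom.toLinearMap_injective (TensorProduct.ext' fun x y => ?_)
    simp only [AlgHom.toLinearMap_apply, AlgHom.comp_apply, Algebra.TensorProduct.map_tmul, hφ]
    exact (h0 x (comul y)).symm
  have h2 : Algebra.TensorProduct.lift f h hfh = (lift₃ f g h hfg hfh hgh).comp (leg₁₃ k H) := by
    refine AlgHom.toLinearMap_injective (TensorProduct.ext' fun x y => ?_)
    simp [lift₃, leg₁₃]
  have h3 : Algebra.TensorProduct.lift f g hfg = (lift₃ f g h hfg hfh hgh).comp (leg₁₂ k H) := by
    refine AlgHom.toLinearMap_injective (TensorProduct.ext' fun x y => ?_)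
    simp [lift₃, leg₁₂]
  rw [h1, h2, h3]
  have := congrArg (lift₃ f g h hfg hfh hgh) 𝓡.comul_right
  rw [map_mul] at this
  exact this

/-- The Yang-Baxter equation. -/
theorem UniversalR.yangBaxter (f g h : H →ₐ[k] B) (hfg : ∀ x y, Commute (f x) (g y))
    (hfh : ∀ x y, Commute (f x) (h y)) (hgh : ∀ x y, Commute (g x) (h y)) :
    Algebra.TensorProduct.lift f g hfg 𝓡.R * Algebra.TensorProduct.lift f h hfh 𝓡.R *
      Algebra.TensorProduct.lift g h hgh 𝓡.R =
    Algebra.TensorProduct.lift g h hgh 𝓡.R * Algebra.TensorProduct.lift f h hfh 𝓡.R *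
      Algebra.TensorProduct.lift f g hfg 𝓡.R := by
  have key : ∀ P : H ⊗[k] H, Algebra.TensorProduct.lift f g hfg 𝓡.R *
      lift₃ f g h hfg hfh hgh
        (Algebra.TensorProduct.map (Bialgebra.comulAlgHom k H) (AlgHom.id k H) P) =
      lift₃ g f h (fun x y => (hfg y x).symm) hgh hfh
        (Algebra.TensorProduct.map (Bialgebra.comulAlgHom k H) (AlgHom.id k H) P) *
      Algebra.TensorProduct.lift f g hfg 𝓡.R := by
    intro P
    induction P with
    | zero => simp
    | tmul x y =>
      have h1 : ∀ Q : H ⊗[k] H, Algebra.TensorProduct.lift g f (fun x y => (hfg y x).symm) Q =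
          Algebra.TensorProduct.lift f g hfg (flip₂₁ k H Q) := by
        intro Q
        induction Q with
        | zero => simp
        | tmul p q => simpa [flip₂₁] using (hfg q p).symm.eq
        | add p q hp hq => simp only [map_add, hp, hq]
      have h2 := congrArg (Algebra.TensorProduct.lift f g hfg) (𝓡.flip_comul x)
      simp only [map_mul] at h2
      have h3 : Commute (Algebra.TensorProduct.lift f g hfg 𝓡.R) (h y) :=
        commute_lift hfg (fun x => hfh x y) (fun x => hgh x y) _
      simp only [Algebra.TensorProduct.map_tmul, lift₃, Algebra.TensorProduct.lift_tmul, h1,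
        AlgHom.id_apply]
      rw [← mul_assoc, h2, mul_assoc, mul_assoc, h3.eq]
      rfl
    | add p q hp hq => simp only [map_add, mul_add, add_mul, hp, hq]
  have h1 := 𝓡.lift_comul_left f g h hfg hfh hgh ((lift₃ f g h hfg hfh hgh).comp
      (Algebra.TensorProduct.map (Bialgebra.comulAlgHom k H) (AlgHom.id k H)))
      (by intros; simp [lift₃])
  have h2 := 𝓡.lift_comul_left g f h (fun x y => (hfg y x).symm) hgh hfh
      ((lift₃ g f h (fun x y => (hfg y x).symm) hgh hfh).comp
      (Algebra.TensorProduct.map (Bialgebra.comulAlgHom k H) (AlgHom.id k H)))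
      (by intros; simp [lift₃])
  have h3 := key 𝓡.R
  rw [AlgHom.comp_apply] at h1 h2
  rw [h1, h2] at h3
  rw [mul_assoc, h3]

theorem counit_lift (x : H) {η : H →ₐ[k] H}
    (hη : η = (Algebra.ofId k H).comp (Bialgebra.counitAlgHom k H))
    (hc : ∀ x y, Commute (η x) (η y)) :
    Algebra.TensorProduct.lift η η hc (comul x) = algebraMap k H (counit x) := by
  have h0 : ∀ x, η x = algebraMap k H (counit x) := fun x => by rw [hη]; rfl
  have : ∀ Q : H ⊗[k] H, Algebra.TensorProduct.lift η η hc Q = algebraMap k H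
      (counit (TensorProduct.rid k H (counit.lTensor H Q))) := by
    intro Q
    induction Q with
    | zero => simp
    | tmul p q => simp [h0, mul_comm]
    | add p q hp hq => simp only [map_add, hp, hq]
  rw [this, Coalgebra.lTensor_counit_comul]
  simp

theorem UniversalR.counit_left : Algebra.TensorProduct.lid k H
    (Algebra.TensorProduct.map (Bialgebra.counitAlgHom k H) (AlgHom.id k H) (𝓡.R : H ⊗[k] H))
      = 1 := by
  obtain ⟨η, hη⟩ : ∃ η, η = (Algebra.ofId k H).comp (Bialgebra.counitAlgHom k H) := ⟨_, rfl⟩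
  have h0 : ∀ x, η x = algebraMap k H (counit x) := fun x => by rw [hη]; rfl
  have hc : ∀ x y, Commute (η x) y := fun x y => by rw [h0]; exact Algebra.commutes _ _
  have h := 𝓡.lift_comul_left η η (AlgHom.id k H) (fun x y => hc x _) (fun x y => hc x y)
    (fun x y => hc x y)
    ((Algebra.TensorProduct.lid k H).toAlgHom.comp
      (Algebra.TensorProduct.map (Bialgebra.counitAlgHom k H) (AlgHom.id k H)))
    (fun x y => by rw [counit_lift x hη]; simp [Algebra.smul_def])
  have e : Algebra.TensorProduct.lift η (AlgHom.id k H) (fun x y => hc x (AlgHom.id k H y)) =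
      ((Algebra.TensorProduct.lid k H).toAlgHom.comp
      (Algebra.TensorProduct.map (Bialgebra.counitAlgHom k H) (AlgHom.id k H))) := by
    refine AlgHom.toLinearMap_injective (TensorProduct.ext' fun x y => ?_)
    rw [AlgHom.toLinearMap_apply, Algebra.TensorProduct.lift_tmul, h0]
    simp [Algebra.smul_def]
  rw [e] at h
  have hu : IsUnit (((Algebra.TensorProduct.lid k H).toAlgHom.comp
      (Algebra.TensorProduct.map (Bialgebra.counitAlgHom k H) (AlgHom.id k H))) 𝓡.R) :=
    (𝓡.R.isUnit).map _
  exact (hu.mul_eq_left.mp h.symm)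

theorem UniversalR.counit_right : Algebra.TensorProduct.rid k k H
    (Algebra.TensorProduct.map (AlgHom.id k H) (Bialgebra.counitAlgHom k H) (𝓡.R : H ⊗[k] H))
      = 1 := by
  obtain ⟨η, hη⟩ : ∃ η, η = (Algebra.ofId k H).comp (Bialgebra.counitAlgHom k H) := ⟨_, rfl⟩
  have h0 : ∀ x, η x = algebraMap k H (counit x) := fun x => by rw [hη]; rfl
  have hc : ∀ x y, Commute y (η x) := fun x y => by
    rw [h0]; exact (Algebra.commutes _ _).symm
  have h := 𝓡.lift_comul_right (AlgHom.id k H) η η (fun x y => hc y x) (fun x y => hc y x)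
    (fun x y => hc y _)
    ((Algebra.TensorProduct.rid k k H).toAlgHom.comp
      (Algebra.TensorProduct.map (AlgHom.id k H) (Bialgebra.counitAlgHom k H)))
    (fun x y => by
      rw [counit_lift y hη]; simp [Algebra.smul_def, Algebra.commutes])
  have e : Algebra.TensorProduct.lift (AlgHom.id k H) η (fun x y => hc y (AlgHom.id k H x)) =
      ((Algebra.TensorProduct.rid k k H).toAlgHom.comp
      (Algebra.TensorProduct.map (AlgHom.id k H) (Bialgebra.counitAlgHom k H))) := by
    refine AlgHom.toLinearMap_injective (TensorProduct.ext' fun x y => ?_)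
    rw [AlgHom.toLinearMap_apply, Algebra.TensorProduct.lift_tmul, h0]
    simp [Algebra.smul_def, Algebra.commutes]
  rw [e] at h
  have hu : IsUnit (((Algebra.TensorProduct.rid k k H).toAlgHom.comp
      (Algebra.TensorProduct.map (AlgHom.id k H) (Bialgebra.counitAlgHom k H))) 𝓡.R) :=
    (𝓡.R.isUnit).map _
  exact (hu.mul_eq_left.mp h.symm)

theorem conv_lift (f g : H →ₐ[k] B) (hfg : ∀ x y, Commute (f x) (g y)) (x : H) :
    (toConv f.toLinearMap * toConv g.toLinearMap : WithConv (H →ₗ[k] B)).ofConv x =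
      Algebra.TensorProduct.lift f g hfg (comul x) := by
  change LinearMap.mul' k B (TensorProduct.map f.toLinearMap g.toLinearMap (comul x)) = _
  generalize comul (R := k) x = P
  induction P with
  | zero => simp
  | tmul p q => simp
  | add p q hp hq => simp only [map_add, hp, hq]

theorem conv_comm {f g : H →ₐ[k] B} (hfg : ∀ x y, Commute (f x) (g y)) (P : H ⊗[k] H) :
    Algebra.TensorProduct.lift f g hfg P = Algebra.TensorProduct.lift g f
      (fun x y => (hfg y x).symm) (flip₂₁ k H P) := by
  induction P with
  | zero => simp
  | tmul p q => simpa [flip₂₁] using (hfg p q).eq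
  | add p q hp hq => simp only [map_add, hp, hq]

variable (H) in
/-- The map `x ↦ ε(x) b`. -/
noncomputable def cst (b : B) : WithConv (H →ₗ[k] B) :=
  toConv ((LinearMap.toSpanSingleton k B b) ∘ₗ counit)

theorem cst_mul (b : B) (G : WithConv (H →ₗ[k] B)) (x : H) : (cst H b * G).ofConv x = b * G.ofConv x := by
  have h2 := congrArg (TensorProduct.lid k H) (Coalgebra.rTensor_counit_comul (R := k) x)
  have : ∀ P : H ⊗[k] H, LinearMap.mul' k B (TensorProduct.map (cst H b).ofConv G.ofConv P) =
      b * G.ofConv (TensorProduct.lid k H (counit.rTensor H P)) := by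
    intro P
    induction P with
    | zero => simp
    | tmul p q => simp [cst]
    | add p q hp hq => simp only [map_add, hp, hq, mul_add]
  rw [LinearMap.convMul_def]
  exact (this _).trans (by rw [h2]; simp)

theorem mul_cst (b : B) (G : WithConv (H →ₗ[k] B)) (x : H) : (G * cst H b).ofConv x = G.ofConv x * b := by
  have h2 := congrArg (TensorProduct.rid k H) (Coalgebra.lTensor_counit_comul (R := k) x)
  have : ∀ P : H ⊗[k] H, LinearMap.mul' k B (TensorProduct.map G.ofConv (cst H b).ofConv P) =
      G.ofConv (TensorProduct.rid k H (counit.lTensor H P)) * b := by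
    intro P
    induction P with
    | zero => simp
    | tmul p q => simp [cst]
    | add p q hp hq => simp only [map_add, hp, hq, add_mul]
  rw [LinearMap.convMul_def]
  exact (this _).trans (by rw [h2]; simp)

theorem cst_commute {b : B} {f : H →ₐ[k] B} (h : ∀ x, Commute (f x) b) :
    cst H b * toConv f.toLinearMap = toConv f.toLinearMap * cst H b := by
  refine WithConv.ext (LinearMap.ext fun x => ?_)
  have h1 := cst_mul b (toConv f.toLinearMap) x
  have h2 := mul_cst b (toConv f.toLinearMap) x
  exact h1.trans ((h x).eq.symm.trans h2.symm)

theorem conv_swap {f g : H →ₐ[k] B} (hfg : ∀ x y, Commute (f x) (g y)) :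
    cst H (Algebra.TensorProduct.lift f g hfg (𝓡.R : H ⊗[k] H)) *
      (toConv f.toLinearMap * toConv g.toLinearMap) =
    toConv g.toLinearMap * toConv f.toLinearMap *
      cst H (Algebra.TensorProduct.lift f g hfg (𝓡.R : H ⊗[k] H)) := by
  refine WithConv.ext (LinearMap.ext fun x => ?_)
  have h1 := cst_mul (Algebra.TensorProduct.lift f g hfg (𝓡.R : H ⊗[k] H))
    (toConv f.toLinearMap * toConv g.toLinearMap) x
  have h2 := mul_cst (Algebra.TensorProduct.lift f g hfg (𝓡.R : H ⊗[k] H))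
    (toConv g.toLinearMap * toConv f.toLinearMap) x
  rw [conv_lift f g hfg] at h1
  rw [conv_lift g f (fun x y => (hfg y x).symm),
    conv_comm (fun x y => (hfg y x).symm) (comul x)] at h2
  have h3 := congrArg (Algebra.TensorProduct.lift f g hfg) (𝓡.flip_comul x)
  simp only [map_mul] at h3
  exact h1.trans (h3.trans h2.symm)

end Legs

section Cocycles

open WithConv

variable {k : Type u} {H : Type v} {B : Type w} [CommRing k] [Ring H] [HopfAlgebra k H]
  [Ring B] [Algebra k B] (𝓡 : UniversalR k H)

theorem map_lift {B' : Type*} [Ring B'] [Algebra k B'] (ψ : B →ₐ[k] B') {f g : H →ₐ[k] B}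
    (hfg : ∀ x y, Commute (f x) (g y)) {f' g' : H →ₐ[k] B'}
    (hfg' : ∀ x y, Commute (f' x) (g' y)) (hf : ∀ x, ψ (f x) = f' x)
    (hg : ∀ x, ψ (g x) = g' x) (P : H ⊗[k] H) :
    ψ (Algebra.TensorProduct.lift f g hfg P) = Algebra.TensorProduct.lift f' g' hfg' P := by
  induction P with
  | zero => simp
  | tmul x y => simp [hf, hg]
  | add p q hp hq => simp only [map_add, hp, hq]

/-- The factor `R_{ij}` for commuting images of `H` in an algebra. -/
noncomputable def UniversalR.at {n : ℕ} {p : Fin n → (H →ₐ[k] B)}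
    (hp : ∀ i j, i ≠ j → ∀ x y, Commute (p i x) (p j y)) (i j : Fin n) (hij : i ≠ j) : B :=
  Algebra.TensorProduct.lift (p i) (p j) (hp i j hij) (𝓡.R : H ⊗[k] H)

theorem UniversalR.at_commute {n : ℕ} {p : Fin n → (H →ₐ[k] B)}
    (hp : ∀ i j, i ≠ j → ∀ x y, Commute (p i x) (p j y)) {i j l m : Fin n} (hij : i ≠ j)
    (hlm : l ≠ m) (h₁ : i ≠ l) (h₂ : i ≠ m) (h₃ : j ≠ l) (h₄ : j ≠ m) :
    Commute (𝓡.at hp i j hij) (𝓡.at hp l m hlm) :=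
  commute_lift_lift (hp i j hij) (hp l m hlm) (hp i l h₁) (hp i m h₂) (hp j l h₃) (hp j m h₄) _ _

theorem UniversalR.at_yangBaxter {n : ℕ} {p : Fin n → (H →ₐ[k] B)}
    (hp : ∀ i j, i ≠ j → ∀ x y, Commute (p i x) (p j y)) {i j l : Fin n} (hij : i ≠ j)
    (hil : i ≠ l) (hjl : j ≠ l) :
    𝓡.at hp i j hij * 𝓡.at hp i l hil * 𝓡.at hp j l hjl =
      𝓡.at hp j l hjl * 𝓡.at hp i l hil * 𝓡.at hp i j hij :=
  𝓡.yangBaxter (p i) (p j) (p l) (hp i j hij) (hp i l hil) (hp j l hjl)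

theorem UniversalR.cocycle_identity {p : Fin 5 → (H →ₐ[k] B)}
    (hp : ∀ i j, i ≠ j → ∀ x y, Commute (p i x) (p j y)) :
    (𝓡.at hp 2 4 (by decide) * 𝓡.at hp 0 4 (by decide)) *
      (𝓡.at hp 1 4 (by decide) * 𝓡.at hp 3 4 (by decide)) *
      (𝓡.at hp 0 2 (by decide) * 𝓡.at hp 1 2 (by decide)) =
    (𝓡.at hp 0 2 (by decide) * 𝓡.at hp 0 4 (by decide)) *
      (𝓡.at hp 1 2 (by decide) * 𝓡.at hp 1 4 (by decide)) *
      (𝓡.at hp 2 4 (by decide) * 𝓡.at hp 3 4 (by decide)) := by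
  have y1 := 𝓡.at_yangBaxter hp (i := 0) (j := 2) (l := 4) (by decide) (by decide) (by decide)
  have y2 := 𝓡.at_yangBaxter hp (i := 1) (j := 2) (l := 4) (by decide) (by decide) (by decide)
  have c1 : Commute (𝓡.at hp 3 4 (by decide)) (𝓡.at hp 0 2 (by decide)) :=
    𝓡.at_commute hp _ _ (by decide) (by decide) (by decide) (by decide)
  have c2 : Commute (𝓡.at hp 3 4 (by decide)) (𝓡.at hp 1 2 (by decide)) :=
    𝓡.at_commute hp _ _ (by decide) (by decide) (by decide) (by decide)
  have c3 : Commute (𝓡.at hp 1 4 (by decide)) (𝓡.at hp 0 2 (by decide)) :=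
    𝓡.at_commute hp _ _ (by decide) (by decide) (by decide) (by decide)
  generalize 𝓡.at hp 0 2 (by decide) = a at *
  generalize 𝓡.at hp 0 4 (by decide) = b at *
  generalize 𝓡.at hp 2 4 (by decide) = c at *
  generalize 𝓡.at hp 1 2 (by decide) = d at *
  generalize 𝓡.at hp 1 4 (by decide) = e at *
  generalize 𝓡.at hp 3 4 (by decide) = f at *
  calc c * b * (e * f) * (a * d) = c * b * e * (f * a) * d := by simp only [mul_assoc]
    _ = c * b * (e * a) * (f * d) := by rw [c1.eq]; simp only [mul_assoc]
    _ = (c * b * a) * (e * d * f) := by rw [c2.eq, c3.eq]; simp only [mul_assoc]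
    _ = a * b * (c * e * d) * f := by rw [← y1]; simp only [mul_assoc]
    _ = _ := by rw [← y2]; simp only [mul_assoc]

theorem UniversalR.cst_at_swap {n : ℕ} {p : Fin n → (H →ₐ[k] B)}
    (hp : ∀ i j, i ≠ j → ∀ x y, Commute (p i x) (p j y)) {i j : Fin n} (hij : i ≠ j) :
    cst H (𝓡.at hp i j hij) * (toConv (p i).toLinearMap * toConv (p j).toLinearMap) =
      toConv (p j).toLinearMap * toConv (p i).toLinearMap * cst H (𝓡.at hp i j hij) :=
  conv_swap 𝓡 (hp i j hij)

theorem UniversalR.cst_at_comm {n : ℕ} {p : Fin n → (H →ₐ[k] B)}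
    (hp : ∀ i j, i ≠ j → ∀ x y, Commute (p i x) (p j y)) {i j l : Fin n} (hij : i ≠ j)
    (hil : i ≠ l) (hjl : j ≠ l) :
    cst H (𝓡.at hp i j hij) * toConv (p l).toLinearMap =
      toConv (p l).toLinearMap * cst H (𝓡.at hp i j hij) :=
  cst_commute (fun x => (commute_lift (hp i j hij) (fun y => hp i l hil y x)
    (fun y => hp j l hjl y x) _).symm)

theorem cst_mul_cst (b b' : B) :
    cst (k := k) H (b * b') = cst (k := k) H b * cst (k := k) H b' := by
  refine WithConv.ext (LinearMap.ext fun x => ?_)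
  rw [cst_mul]
  simp [cst]

theorem UniversalR.swap_one {p : Fin 4 → (H →ₐ[k] B)}
    (hp : ∀ i j, i ≠ j → ∀ x y, Commute (p i x) (p j y)) (x : H) :
    𝓡.at hp 1 2 (by decide) * ((toConv (p 0).toLinearMap * toConv (p 1).toLinearMap) *
      (toConv (p 2).toLinearMap * toConv (p 3).toLinearMap)).ofConv x =
    ((toConv (p 0).toLinearMap * toConv (p 2).toLinearMap) *
      (toConv (p 1).toLinearMap * toConv (p 3).toLinearMap)).ofConv x *
      𝓡.at hp 1 2 (by decide) := by
  have s := 𝓡.cst_at_swap hp (i := 1) (j := 2) (by decide)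
  have c0 := 𝓡.cst_at_comm hp (i := 1) (j := 2) (l := 0) (by decide) (by decide) (by decide)
  have c3 := 𝓡.cst_at_comm hp (i := 1) (j := 2) (l := 3) (by decide) (by decide) (by decide)
  rw [← cst_mul (k := k), ← mul_cst (k := k)]
  congr 2
  generalize cst (k := k) H (𝓡.at hp 1 2 (by decide)) = c at *
  generalize toConv (p 0).toLinearMap = f0 at *
  generalize toConv (p 1).toLinearMap = f1 at *
  generalize toConv (p 2).toLinearMap = f2 at *
  generalize toConv (p 3).toLinearMap = f3 at *
  calc c * (f0 * f1 * (f2 * f3)) = (c * f0) * (f1 * f2) * f3 := by simp only [mul_assoc]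
    _ = f0 * (c * (f1 * f2)) * f3 := by rw [c0]; simp only [mul_assoc]
    _ = f0 * f2 * f1 * (c * f3) := by rw [s]; simp only [mul_assoc]
    _ = _ := by rw [c3]; simp only [mul_assoc]

theorem UniversalR.swap_two {p : Fin 4 → (H →ₐ[k] B)}
    (hp : ∀ i j, i ≠ j → ∀ x y, Commute (p i x) (p j y)) (x : H) :
    (𝓡.at hp 0 2 (by decide) * 𝓡.at hp 1 2 (by decide)) *
      ((toConv (p 0).toLinearMap * toConv (p 1).toLinearMap) *
      (toConv (p 2).toLinearMap * toConv (p 3).toLinearMap)).ofConv x =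
    ((toConv (p 2).toLinearMap * toConv (p 0).toLinearMap) *
      (toConv (p 1).toLinearMap * toConv (p 3).toLinearMap)).ofConv x *
      (𝓡.at hp 0 2 (by decide) * 𝓡.at hp 1 2 (by decide)) := by
  have s := 𝓡.cst_at_swap hp (i := 1) (j := 2) (by decide)
  have s' := 𝓡.cst_at_swap hp (i := 0) (j := 2) (by decide)
  have c0 := 𝓡.cst_at_comm hp (i := 1) (j := 2) (l := 0) (by decide) (by decide) (by decide)
  have c3 := 𝓡.cst_at_comm hp (i := 1) (j := 2) (l := 3) (by decide) (by decide) (by decide)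
  have c1' := 𝓡.cst_at_comm hp (i := 0) (j := 2) (l := 1) (by decide) (by decide) (by decide)
  have c3' := 𝓡.cst_at_comm hp (i := 0) (j := 2) (l := 3) (by decide) (by decide) (by decide)
  rw [← cst_mul (k := k), ← mul_cst (k := k), cst_mul_cst]
  congr 2
  generalize cst (k := k) H (𝓡.at hp 1 2 (by decide)) = c at *
  generalize cst (k := k) H (𝓡.at hp 0 2 (by decide)) = d at *
  generalize toConv (p 0).toLinearMap = f0 at *
  generalize toConv (p 1).toLinearMap = f1 at *
  generalize toConv (p 2).toLinearMap = f2 at *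
  generalize toConv (p 3).toLinearMap = f3 at *
  calc d * c * (f0 * f1 * (f2 * f3)) = d * (c * f0) * (f1 * f2) * f3 := by simp only [mul_assoc]
    _ = d * f0 * (c * (f1 * f2)) * f3 := by rw [c0]; simp only [mul_assoc]
    _ = (d * (f0 * f2)) * f1 * (c * f3) := by rw [s]; simp only [mul_assoc]
    _ = f2 * f0 * (d * f1) * f3 * c := by rw [s', c3]; simp only [mul_assoc]
    _ = f2 * f0 * f1 * (d * f3) * c := by rw [c1']; simp only [mul_assoc]
    _ = _ := by rw [c3']; simp only [mul_assoc]

end Cocycles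

section TwistCocycles

variable {k : Type u} {H : Type v} {E : Type w} [CommRing k] [Ring H] [HopfAlgebra k H]
  [Ring E] [Algebra k E] (𝓡 : UniversalR k H)

/-- The four maps `H → E ⊗ E` given by two maps `H → E`. -/
noncomputable def pos₄ (e₁ e₂ : H →ₐ[k] E) : Fin 4 → (H →ₐ[k] E ⊗[k] E) :=
  ![(Algebra.TensorProduct.includeLeft : E →ₐ[k] E ⊗[k] E).comp e₁,
    (Algebra.TensorProduct.includeLeft : E →ₐ[k] E ⊗[k] E).comp e₂,
    (Algebra.TensorProduct.includeRight : E →ₐ[k] E ⊗[k] E).comp e₁,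
    (Algebra.TensorProduct.includeRight : E →ₐ[k] E ⊗[k] E).comp e₂]

/-- Five of the six maps `H → E ⊗ E ⊗ E` given by two maps `H → E`. -/
noncomputable def pos₅ (e₁ e₂ : H →ₐ[k] E) : Fin 5 → (H →ₐ[k] (E ⊗[k] E) ⊗[k] E) :=
  ![(Algebra.TensorProduct.includeLeft : E ⊗[k] E →ₐ[k] (E ⊗[k] E) ⊗[k] E).comp (pos₄ e₁ e₂ 0),
    (Algebra.TensorProduct.includeLeft : E ⊗[k] E →ₐ[k] (E ⊗[k] E) ⊗[k] E).comp (pos₄ e₁ e₂ 1),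
    (Algebra.TensorProduct.includeLeft : E ⊗[k] E →ₐ[k] (E ⊗[k] E) ⊗[k] E).comp (pos₄ e₁ e₂ 2),
    (Algebra.TensorProduct.includeLeft : E ⊗[k] E →ₐ[k] (E ⊗[k] E) ⊗[k] E).comp (pos₄ e₁ e₂ 3),
    (Algebra.TensorProduct.includeRight : E →ₐ[k] (E ⊗[k] E) ⊗[k] E).comp e₁]

variable {e₁ e₂ : H →ₐ[k] E}

theorem pos₄_commute (he : ∀ x y, Commute (e₁ x) (e₂ y)) (i j : Fin 4) (hij : i ≠ j) (x y : H) :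
    Commute (pos₄ e₁ e₂ i x) (pos₄ e₁ e₂ j y) := by
  have h1 := (he x y).eq
  have h2 := (he y x).eq
  fin_cases i <;> fin_cases j <;>
    first | exact absurd rfl hij | simp [pos₄, Commute, SemiconjBy, h1, h2]

theorem pos₅_commute (he : ∀ x y, Commute (e₁ x) (e₂ y)) (i j : Fin 5) (hij : i ≠ j) (x y : H) :
    Commute (pos₅ e₁ e₂ i x) (pos₅ e₁ e₂ j y) := by
  have h1 := (he x y).eq
  have h2 := (he y x).eq
  fin_cases i <;> fin_cases j <;>
    first | exact absurd rfl hij | simp [pos₅, pos₄, Commute, SemiconjBy, h1, h2]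

variable {δ : E →ₐ[k] E ⊗[k] E} {ε : E →ₐ[k] k}

theorem UniversalR.at_pos₄ (he : ∀ x y, Commute (e₁ x) (e₂ y)) :
    𝓡.at (pos₄_commute he) 1 2 (by decide) = Algebra.TensorProduct.map e₂ e₁ 𝓡.R ∧
    𝓡.at (pos₄_commute he) 0 2 (by decide) = Algebra.TensorProduct.map e₁ e₁ 𝓡.R := by
  have h : ∀ (i : Fin 4) (hi : i ≠ 2) (e : H →ₐ[k] E)
      (_ : ∀ x, pos₄ e₁ e₂ i x = e x ⊗ₜ[k] 1) (P : H ⊗[k] H),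
      Algebra.TensorProduct.lift (pos₄ e₁ e₂ i) (pos₄ e₁ e₂ 2) (pos₄_commute he i 2 hi) P =
        Algebra.TensorProduct.map e e₁ P := by
    intro i hi e h P
    induction P with
    | zero => simp
    | tmul x y => rw [Algebra.TensorProduct.lift_tmul, h]; simp [pos₄]
    | add p q hp hq => simp only [map_add, hp, hq]
  exact ⟨h 1 (by decide) e₂ (fun x => rfl) _, h 0 (by decide) e₁ (fun x => rfl) _⟩

/-- `F₁₂` for `F = (e ⊗ e₁)(R)`. -/
theorem UniversalR.tmul_one (he : ∀ x y, Commute (e₁ x) (e₂ y)) :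
    Algebra.TensorProduct.map e₂ e₁ 𝓡.R ⊗ₜ[k] (1 : E) =
      𝓡.at (pos₅_commute he) 1 2 (by decide) ∧
    Algebra.TensorProduct.map e₁ e₁ 𝓡.R ⊗ₜ[k] (1 : E) =
      𝓡.at (pos₅_commute he) 0 2 (by decide) := by
  rw [← (𝓡.at_pos₄ he).1, ← (𝓡.at_pos₄ he).2]
  exact ⟨map_lift (Algebra.TensorProduct.includeLeft : E ⊗[k] E →ₐ[k] (E ⊗[k] E) ⊗[k] E)
    _ _ (fun _ => rfl) (fun _ => rfl) _,
    map_lift (Algebra.TensorProduct.includeLeft : E ⊗[k] E →ₐ[k] (E ⊗[k] E) ⊗[k] E)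
    _ _ (fun _ => rfl) (fun _ => rfl) _⟩

theorem UniversalR.one_tmul (he : ∀ x y, Commute (e₁ x) (e₂ y)) :
    (Algebra.TensorProduct.assoc k k k E E E).symm
      ((1 : E) ⊗ₜ[k] Algebra.TensorProduct.map e₂ e₁ 𝓡.R) =
      𝓡.at (pos₅_commute he) 3 4 (by decide) ∧
    (Algebra.TensorProduct.assoc k k k E E E).symm
      ((1 : E) ⊗ₜ[k] Algebra.TensorProduct.map e₁ e₁ 𝓡.R) =
      𝓡.at (pos₅_commute he) 2 4 (by decide) := by
  have h : ∀ (i : Fin 5) (hi : i ≠ 4) (e : H →ₐ[k] E)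
      (_ : ∀ x, pos₅ e₁ e₂ i x = (1 ⊗ₜ[k] e x) ⊗ₜ[k] 1) (P : H ⊗[k] H),
      (Algebra.TensorProduct.assoc k k k E E E).symm
      ((1 : E) ⊗ₜ[k] Algebra.TensorProduct.map e e₁ P) =
      Algebra.TensorProduct.lift (pos₅ e₁ e₂ i) (pos₅ e₁ e₂ 4) (pos₅_commute he i 4 hi) P := by
    intro i hi e h P
    induction P with
    | zero => simp
    | tmul x y =>
      rw [Algebra.TensorProduct.lift_tmul, h]
      simp [pos₅, Algebra.TensorProduct.one_def]
    | add p q hp hq => simp only [map_add, tmul_add, hp, hq]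
  exact ⟨h 3 (by decide) e₂ (fun x => rfl) _, h 2 (by decide) e₁ (fun x => rfl) _⟩

/-- `(δ ⊗ id)((e ⊗ e₁)(R))` when `δ ∘ e` is the coproduct of `H` in the positions `a, b`. -/
theorem UniversalR.comul_map_left (he : ∀ x y, Commute (e₁ x) (e₂ y)) (e : H →ₐ[k] E)
    (a b : Fin 4) (hab : a ≠ b)
    (hδ : ∀ x, δ (e x) = Algebra.TensorProduct.lift (pos₄ e₁ e₂ a) (pos₄ e₁ e₂ b)
      (pos₄_commute he a b hab) (comul x)) :
    Algebra.TensorProduct.map δ (AlgHom.id k E) (Algebra.TensorProduct.map e e₁ 𝓡.R) =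
      𝓡.at (pos₅_commute he) (Fin.castSucc a) (Fin.last 4) (Fin.castSucc_ne_last a) *
      𝓡.at (pos₅_commute he) (Fin.castSucc b) (Fin.last 4) (Fin.castSucc_ne_last b) := by
  have hp : ∀ (a : Fin 4) (x : H), pos₅ e₁ e₂ (Fin.castSucc a) x = pos₄ e₁ e₂ a x ⊗ₜ[k] 1 := by
    intro a x
    fin_cases a <;> rfl
  refine 𝓡.lift_comul_left (pos₅ e₁ e₂ (Fin.castSucc a)) (pos₅ e₁ e₂ (Fin.castSucc b))
    (pos₅ e₁ e₂ (Fin.last 4)) (pos₅_commute he _ _ (by simpa using hab))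
    (pos₅_commute he _ _ (Fin.castSucc_ne_last a)) (pos₅_commute he _ _ (Fin.castSucc_ne_last b))
    ((Algebra.TensorProduct.map δ (AlgHom.id k E)).comp (Algebra.TensorProduct.map e e₁)) ?_
  intro x y
  rw [AlgHom.comp_apply, Algebra.TensorProduct.map_tmul, Algebra.TensorProduct.map_tmul, hδ,
    ← map_lift (Algebra.TensorProduct.includeLeft : E ⊗[k] E →ₐ[k] (E ⊗[k] E) ⊗[k] E)
    (pos₄_commute he a b hab) _ (fun x => (hp a x).symm) (fun x => (hp b x).symm)]
  change _ = (_ ⊗ₜ[k] 1) * (1 ⊗ₜ[k] e₁ y)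
  simp

/-- `(id ⊗ δ)((e ⊗ e₁)(R))` when `δ ∘ e₁` is the opposite coproduct of `H`. -/
theorem UniversalR.comul_map_right (he : ∀ x y, Commute (e₁ x) (e₂ y)) (e : H →ₐ[k] E)
    (i : Fin 5) (hi : i ≠ 2) (hi' : i ≠ 4) (hie : ∀ x, pos₅ e₁ e₂ i x = (e x ⊗ₜ[k] 1) ⊗ₜ[k] 1)
    (hδ : ∀ x, δ (e₁ x) = Algebra.TensorProduct.lift (pos₄ e₁ e₂ 2) (pos₄ e₁ e₂ 0)
      (pos₄_commute he 2 0 (by decide)) (comul x)) :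
    (Algebra.TensorProduct.assoc k k k E E E).symm
      (Algebra.TensorProduct.map (AlgHom.id k E) δ (Algebra.TensorProduct.map e e₁ 𝓡.R)) =
      𝓡.at (pos₅_commute he) i 2 hi * 𝓡.at (pos₅_commute he) i 4 hi' := by
  refine 𝓡.lift_comul_right (pos₅ e₁ e₂ i) (pos₅ e₁ e₂ 4) (pos₅ e₁ e₂ 2)
    (pos₅_commute he _ _ hi') (pos₅_commute he _ _ hi) (pos₅_commute he _ _ (by decide))
    ((Algebra.TensorProduct.assoc k k k E E E).symm.toAlgHom.comp
      ((Algebra.TensorProduct.map (AlgHom.id k E) δ).comp (Algebra.TensorProduct.map e e₁))) ?_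
  intro x y
  have h : ∀ P : H ⊗[k] H, (Algebra.TensorProduct.assoc k k k E E E).symm
      (e x ⊗ₜ[k] Algebra.TensorProduct.lift (pos₄ e₁ e₂ 2) (pos₄ e₁ e₂ 0)
      (pos₄_commute he 2 0 (by decide)) P) = pos₅ e₁ e₂ i x * Algebra.TensorProduct.lift
        (pos₅ e₁ e₂ 4) (pos₅ e₁ e₂ 2) (pos₅_commute he _ _ (by decide)) P := by
    intro P
    rw [hie]
    induction P with
    | zero => simp
    | tmul x y => simp [pos₅, pos₄]
    | add p q hp hq => simp only [map_add, tmul_add, hp, hq, mul_add]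
  rw [← h, ← hδ]
  rfl

/-- `(id ⊗ δ)((e ⊗ e₁)(R))` when `δ ∘ e₁` is the coproduct of `H`. -/
theorem UniversalR.comul_map_right' (he : ∀ x y, Commute (e₁ x) (e₂ y)) (e : H →ₐ[k] E)
    (i : Fin 5) (hi : i ≠ 2) (hi' : i ≠ 4) (hie : ∀ x, pos₅ e₁ e₂ i x = (e x ⊗ₜ[k] 1) ⊗ₜ[k] 1)
    (hδ : ∀ x, δ (e₁ x) = Algebra.TensorProduct.lift (pos₄ e₁ e₂ 0) (pos₄ e₁ e₂ 2)
      (pos₄_commute he 0 2 (by decide)) (comul x)) :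
    (Algebra.TensorProduct.assoc k k k E E E).symm
      (Algebra.TensorProduct.map (AlgHom.id k E) δ (Algebra.TensorProduct.map e e₁ 𝓡.R)) =
      𝓡.at (pos₅_commute he) i 4 hi' * 𝓡.at (pos₅_commute he) i 2 hi := by
  refine 𝓡.lift_comul_right (pos₅ e₁ e₂ i) (pos₅ e₁ e₂ 2) (pos₅ e₁ e₂ 4)
    (pos₅_commute he _ _ hi) (pos₅_commute he _ _ hi') (pos₅_commute he _ _ (by decide))
    ((Algebra.TensorProduct.assoc k k k E E E).symm.toAlgHom.comp
      ((Algebra.TensorProduct.map (AlgHom.id k E) δ).comp (Algebra.TensorProduct.map e e₁))) ?_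
  intro x y
  have h : ∀ P : H ⊗[k] H, (Algebra.TensorProduct.assoc k k k E E E).symm
      (e x ⊗ₜ[k] Algebra.TensorProduct.lift (pos₄ e₁ e₂ 0) (pos₄ e₁ e₂ 2)
      (pos₄_commute he 0 2 (by decide)) P) = pos₅ e₁ e₂ i x * Algebra.TensorProduct.lift
        (pos₅ e₁ e₂ 2) (pos₅ e₁ e₂ 4) (pos₅_commute he _ _ (by decide)) P := by
    intro P
    rw [hie]
    induction P with
    | zero => simp
    | tmul x y => simp [pos₅, pos₄]
    | add p q hp hq => simp only [map_add, tmul_add, hp, hq, mul_add]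
  rw [← h, ← hδ]
  rfl

theorem UniversalR.counit_map_left (e e' : H →ₐ[k] E) (hε : ∀ x, ε (e x) = counit x) :
    Algebra.TensorProduct.lid k E (Algebra.TensorProduct.map ε (AlgHom.id k E)
      (Algebra.TensorProduct.map e e' 𝓡.R)) = 1 := by
  rw [← map_one e', ← 𝓡.counit_left]
  have : ∀ P : H ⊗[k] H, Algebra.TensorProduct.lid k E (Algebra.TensorProduct.map ε
      (AlgHom.id k E) (Algebra.TensorProduct.map e e' P)) = e' (Algebra.TensorProduct.lid k H
    (Algebra.TensorProduct.map (Bialgebra.counitAlgHom k H) (AlgHom.id k H) P)) := by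
    intro P
    induction P with
    | zero => simp
    | tmul x y => simp [hε]
    | add p q hp hq => simp only [map_add, hp, hq]
  exact this _

theorem UniversalR.counit_map_right (e e' : H →ₐ[k] E) (hε : ∀ x, ε (e' x) = counit x) :
    Algebra.TensorProduct.rid k k E (Algebra.TensorProduct.map (AlgHom.id k E) ε
      (Algebra.TensorProduct.map e e' 𝓡.R)) = 1 := by
  rw [← map_one e, ← 𝓡.counit_right]
  have : ∀ P : H ⊗[k] H, Algebra.TensorProduct.rid k k E (Algebra.TensorProduct.map
      (AlgHom.id k E) ε (Algebra.TensorProduct.map e e' P)) = e (Algebra.TensorProduct.rid k k H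
    (Algebra.TensorProduct.map (AlgHom.id k H) (Bialgebra.counitAlgHom k H) P)) := by
    intro P
    induction P with
    | zero => simp
    | tmul x y => simp [hε]
    | add p q hp hq => simp only [map_add, hp, hq]
  exact this _

/-- `R₂₃` is a cocycle for the tensor product coproduct. -/
theorem UniversalR.isCocycle_one (he : ∀ x y, Commute (e₁ x) (e₂ y))
    (h₁ : ∀ x, δ (e₁ x) = Algebra.TensorProduct.lift (pos₄ e₁ e₂ 0) (pos₄ e₁ e₂ 2)
      (pos₄_commute he 0 2 (by decide)) (comul x))
    (h₂ : ∀ x, δ (e₂ x) = Algebra.TensorProduct.lift (pos₄ e₁ e₂ 1) (pos₄ e₁ e₂ 3)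
      (pos₄_commute he 1 3 (by decide)) (comul x))
    (hε₁ : ∀ x, ε (e₁ x) = counit x) (hε₂ : ∀ x, ε (e₂ x) = counit x) :
    IsCocycle δ ε (Algebra.TensorProduct.map e₂ e₁ (𝓡.R : H ⊗[k] H)) where
  cocycle := by
    rw [𝓡.comul_map_left he e₂ 1 3 (by decide) h₂, map_mul,
      𝓡.comul_map_right' he e₂ 1 (by decide) (by decide) (fun _ => rfl) h₁,
      (𝓡.tmul_one he).1, (𝓡.one_tmul he).1]
    have c : Commute (𝓡.at (pos₅_commute he) 3 4 (by decide))
        (𝓡.at (pos₅_commute he) 1 2 (by decide)) :=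
      𝓡.at_commute (pos₅_commute he) _ _ (by decide) (by decide) (by decide) (by decide)
    exact (mul_assoc _ _ _).trans ((congrArg _ c.eq).trans (mul_assoc _ _ _).symm)
  counit_left := 𝓡.counit_map_left e₂ e₁ hε₂
  counit_right := 𝓡.counit_map_right e₂ e₁ hε₁

/-- `R₁₃ R₂₃` is a cocycle for the tensor product coproduct with the opposite coproduct in the
first factor. -/
theorem UniversalR.isCocycle_two (he : ∀ x y, Commute (e₁ x) (e₂ y))
    (h₁ : ∀ x, δ (e₁ x) = Algebra.TensorProduct.lift (pos₄ e₁ e₂ 2) (pos₄ e₁ e₂ 0)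
      (pos₄_commute he 2 0 (by decide)) (comul x))
    (h₂ : ∀ x, δ (e₂ x) = Algebra.TensorProduct.lift (pos₄ e₁ e₂ 1) (pos₄ e₁ e₂ 3)
      (pos₄_commute he 1 3 (by decide)) (comul x))
    (hε₁ : ∀ x, ε (e₁ x) = counit x) (hε₂ : ∀ x, ε (e₂ x) = counit x) :
    IsCocycle δ ε (Algebra.TensorProduct.map e₁ e₁ (𝓡.R : H ⊗[k] H) *
      Algebra.TensorProduct.map e₂ e₁ (𝓡.R : H ⊗[k] H)) where
  cocycle := by
    have t : ∀ P Q : E ⊗[k] E, (P * Q) ⊗ₜ[k] (1 : E) = (P ⊗ₜ[k] 1) * (Q ⊗ₜ[k] 1) := by simp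
    have t' : ∀ P Q : E ⊗[k] E, (1 : E) ⊗ₜ[k] (P * Q) = (1 ⊗ₜ[k] P) * (1 ⊗ₜ[k] Q) := by simp
    rw [map_mul, map_mul, map_mul, t, t', map_mul, map_mul,
      𝓡.comul_map_left he e₂ 1 3 (by decide) h₂,
      𝓡.comul_map_left he e₁ 2 0 (by decide) h₁,
      𝓡.comul_map_right he e₂ 1 (by decide) (by decide) (fun _ => rfl) h₁,
      𝓡.comul_map_right he e₁ 0 (by decide) (by decide) (fun _ => rfl) h₁,
      (𝓡.tmul_one he).1, (𝓡.one_tmul he).1, (𝓡.tmul_one he).2, (𝓡.one_tmul he).2]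
    exact 𝓡.cocycle_identity (pos₅_commute he)
  counit_left := by
    rw [map_mul, map_mul, 𝓡.counit_map_left e₂ e₁ hε₂, 𝓡.counit_map_left e₁ e₁ hε₁, mul_one]
  counit_right := by
    rw [map_mul, map_mul, 𝓡.counit_map_right e₂ e₁ hε₁, 𝓡.counit_map_right e₁ e₁ hε₁, mul_one]

open WithConv in
theorem map_lift_comul (he : ∀ x y, Commute (e₁ x) (e₂ y)) (x : H) :
    Algebra.TensorProduct.map
      ((Algebra.TensorProduct.lift e₁ e₂ he).comp (Bialgebra.comulAlgHom k H))
      ((Algebra.TensorProduct.lift e₁ e₂ he).comp (Bialgebra.comulAlgHom k H)) (comul x) =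
    ((toConv (pos₄ e₁ e₂ 0).toLinearMap * toConv (pos₄ e₁ e₂ 1).toLinearMap) *
      (toConv (pos₄ e₁ e₂ 2).toLinearMap * toConv (pos₄ e₁ e₂ 3).toLinearMap)).ofConv x := by
  rw [LinearMap.convMul_def]
  change _ = LinearMap.mul' k _ (TensorProduct.map
    (toConv (pos₄ e₁ e₂ 0).toLinearMap * toConv (pos₄ e₁ e₂ 1).toLinearMap).ofConv
    (toConv (pos₄ e₁ e₂ 2).toLinearMap * toConv (pos₄ e₁ e₂ 3).toLinearMap).ofConv (comul x))
  generalize comul (R := k) x = P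
  induction P with
  | zero => simp
  | tmul y z =>
    rw [TensorProduct.map_tmul, LinearMap.mul'_apply,
      conv_lift _ _ (pos₄_commute he 0 1 (by decide)),
      conv_lift _ _ (pos₄_commute he 2 3 (by decide)),
      ← map_lift (Algebra.TensorProduct.includeLeft : E →ₐ[k] E ⊗[k] E) he
        (pos₄_commute he 0 1 (by decide)) (fun _ => rfl) (fun _ => rfl),
      ← map_lift (Algebra.TensorProduct.includeRight : E →ₐ[k] E ⊗[k] E) he
        (pos₄_commute he 2 3 (by decide)) (fun _ => rfl) (fun _ => rfl)]
    simp
  | add p q hp hq => simp only [map_add, hp, hq]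

open WithConv in
theorem comul_lift_comul (he : ∀ x y, Commute (e₁ x) (e₂ y)) {a b : Fin 4} (hab : a ≠ b)
    (h₁ : ∀ x, δ (e₁ x) = Algebra.TensorProduct.lift (pos₄ e₁ e₂ a) (pos₄ e₁ e₂ b)
      (pos₄_commute he a b hab) (comul x))
    (h₂ : ∀ x, δ (e₂ x) = Algebra.TensorProduct.lift (pos₄ e₁ e₂ 1) (pos₄ e₁ e₂ 3)
      (pos₄_commute he 1 3 (by decide)) (comul x)) (x : H) :
    δ (Algebra.TensorProduct.lift e₁ e₂ he (comul x)) =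
    ((toConv (pos₄ e₁ e₂ a).toLinearMap * toConv (pos₄ e₁ e₂ b).toLinearMap) *
      (toConv (pos₄ e₁ e₂ 1).toLinearMap * toConv (pos₄ e₁ e₂ 3).toLinearMap)).ofConv x := by
  rw [LinearMap.convMul_def]
  change _ = LinearMap.mul' k _ (TensorProduct.map
    (toConv (pos₄ e₁ e₂ a).toLinearMap * toConv (pos₄ e₁ e₂ b).toLinearMap).ofConv
    (toConv (pos₄ e₁ e₂ 1).toLinearMap * toConv (pos₄ e₁ e₂ 3).toLinearMap).ofConv (comul x))
  generalize comul (R := k) x = P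
  induction P with
  | zero => simp
  | tmul y z =>
    rw [TensorProduct.map_tmul, LinearMap.mul'_apply,
      conv_lift _ _ (pos₄_commute he a b hab),
      conv_lift _ _ (pos₄_commute he 1 3 (by decide)), ← h₁, ← h₂]
    simp
  | add p q hp hq => simp only [map_add, hp, hq]

theorem UniversalR.intertwine_one (he : ∀ x y, Commute (e₁ x) (e₂ y))
    (h₁ : ∀ x, δ (e₁ x) = Algebra.TensorProduct.lift (pos₄ e₁ e₂ 0) (pos₄ e₁ e₂ 2)
      (pos₄_commute he 0 2 (by decide)) (comul x))
    (h₂ : ∀ x, δ (e₂ x) = Algebra.TensorProduct.lift (pos₄ e₁ e₂ 1) (pos₄ e₁ e₂ 3)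
      (pos₄_commute he 1 3 (by decide)) (comul x)) (x : H) :
    Algebra.TensorProduct.map e₂ e₁ (𝓡.R : H ⊗[k] H) * Algebra.TensorProduct.map
      ((Algebra.TensorProduct.lift e₁ e₂ he).comp (Bialgebra.comulAlgHom k H))
      ((Algebra.TensorProduct.lift e₁ e₂ he).comp (Bialgebra.comulAlgHom k H)) (comul x) =
    δ (Algebra.TensorProduct.lift e₁ e₂ he (comul x)) *
      Algebra.TensorProduct.map e₂ e₁ (𝓡.R : H ⊗[k] H) := by
  rw [map_lift_comul, comul_lift_comul he (by decide) h₁ h₂, ← (𝓡.at_pos₄ he).1]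
  exact 𝓡.swap_one (pos₄_commute he) x

theorem UniversalR.intertwine_two (he : ∀ x y, Commute (e₁ x) (e₂ y))
    (h₁ : ∀ x, δ (e₁ x) = Algebra.TensorProduct.lift (pos₄ e₁ e₂ 2) (pos₄ e₁ e₂ 0)
      (pos₄_commute he 2 0 (by decide)) (comul x))
    (h₂ : ∀ x, δ (e₂ x) = Algebra.TensorProduct.lift (pos₄ e₁ e₂ 1) (pos₄ e₁ e₂ 3)
      (pos₄_commute he 1 3 (by decide)) (comul x)) (x : H) :
    Algebra.TensorProduct.map e₁ e₁ (𝓡.R : H ⊗[k] H) *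
      Algebra.TensorProduct.map e₂ e₁ (𝓡.R : H ⊗[k] H) * Algebra.TensorProduct.map
      ((Algebra.TensorProduct.lift e₁ e₂ he).comp (Bialgebra.comulAlgHom k H))
      ((Algebra.TensorProduct.lift e₁ e₂ he).comp (Bialgebra.comulAlgHom k H)) (comul x) =
    δ (Algebra.TensorProduct.lift e₁ e₂ he (comul x)) *
      (Algebra.TensorProduct.map e₁ e₁ (𝓡.R : H ⊗[k] H) *
      Algebra.TensorProduct.map e₂ e₁ (𝓡.R : H ⊗[k] H)) := by
  rw [map_lift_comul, comul_lift_comul he (by decide) h₁ h₂, ← (𝓡.at_pos₄ he).1, ← (𝓡.at_pos₄ he).2]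
  exact 𝓡.swap_two (pos₄_commute he) x

end TwistCocycles

section ModuleAlgebras

variable {k : Type u} {H : Type v} [CommRing k] [Ring H] [HopfAlgebra k H]

/-- The embedding `x ↦ x ⊗ 1`. -/
noncomputable def incl₁ (k : Type u) (H : Type v) [CommRing k] [Ring H] [HopfAlgebra k H] :
    H →ₐ[k] H ⊗[k] H := Algebra.TensorProduct.includeLeft

/-- The embedding `x ↦ 1 ⊗ x`. -/
noncomputable def incl₂ (k : Type u) (H : Type v) [CommRing k] [Ring H] [HopfAlgebra k H] :
    H →ₐ[k] H ⊗[k] H := Algebra.TensorProduct.includeRight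

@[simp] theorem incl₁_apply (x : H) : incl₁ k H x = x ⊗ₜ[k] 1 := rfl

@[simp] theorem incl₂_apply (x : H) : incl₂ k H x = 1 ⊗ₜ[k] x := rfl

theorem incl_commute (x y : H) : Commute (incl₁ k H x) (incl₂ k H y) := by
  simp [Commute, SemiconjBy]

/-- The coproduct of the tensor product algebra `H ⊗ H`, where the first factor carries the
coproduct `δ` and the second one the coproduct `δ'`: `x ⊗ y ↦ (x₁ ⊗ y₁) ⊗ (x₂ ⊗ y₂)`. -/
noncomputable def tensorComul (δ δ' : H →ₐ[k] H ⊗[k] H) :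
    H ⊗[k] H →ₐ[k] (H ⊗[k] H) ⊗[k] (H ⊗[k] H) :=
  (Algebra.TensorProduct.tensorTensorTensorComm k k k k H H H H).toAlgHom.comp
    (Algebra.TensorProduct.map δ δ')

/-- The counit `ε ⊗ ε` of `H ⊗ H`. -/
noncomputable def tensorCounit (k : Type u) (H : Type v) [CommRing k] [Ring H]
    [HopfAlgebra k H] : H ⊗[k] H →ₐ[k] k :=
  (Algebra.TensorProduct.lid k k).toAlgHom.comp
    (Algebra.TensorProduct.map (Bialgebra.counitAlgHom k H) (Bialgebra.counitAlgHom k H))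

/-- `R₂₃ ∈ (H ⊗ H) ⊗ (H ⊗ H)`, that is, `(1 ⊗ R₁) ⊗ (R₂ ⊗ 1)`. -/
noncomputable def UniversalR.R₂₃ (𝓡 : UniversalR k H) : (H ⊗[k] H) ⊗[k] (H ⊗[k] H) :=
  Algebra.TensorProduct.map (incl₂ k H) (incl₁ k H) (𝓡.R : H ⊗[k] H)

/-- `R₁₃ ∈ (H ⊗ H) ⊗ (H ⊗ H)`, that is, `(R₁ ⊗ 1) ⊗ (R₂ ⊗ 1)`. -/
noncomputable def UniversalR.R₁₃ (𝓡 : UniversalR k H) : (H ⊗[k] H) ⊗[k] (H ⊗[k] H) :=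
  Algebra.TensorProduct.map (incl₁ k H) (incl₁ k H) (𝓡.R : H ⊗[k] H)

theorem tensorComul_incl₁ (δ δ' : H →ₐ[k] H ⊗[k] H) (x : H) :
    tensorComul δ δ' (incl₁ k H x) = Algebra.TensorProduct.lift (pos₄ (incl₁ k H) (incl₂ k H) 0)
      (pos₄ (incl₁ k H) (incl₂ k H) 2) (pos₄_commute incl_commute 0 2 (by decide)) (δ x) := by
  have : ∀ P : H ⊗[k] H, Algebra.TensorProduct.tensorTensorTensorComm k k k k H H H H
      (P ⊗ₜ[k] 1) = Algebra.TensorProduct.lift (pos₄ (incl₁ k H) (incl₂ k H) 0)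
      (pos₄ (incl₁ k H) (incl₂ k H) 2) (pos₄_commute incl_commute 0 2 (by decide)) P := by
    intro P
    induction P with
    | zero => simp
    | tmul p q => simp [pos₄, Algebra.TensorProduct.one_def]
    | add p q hp hq => simp only [add_tmul, map_add, hp, hq]
  simpa [tensorComul] using this (δ x)

theorem tensorComul_incl₂ (δ δ' : H →ₐ[k] H ⊗[k] H) (x : H) :
    tensorComul δ δ' (incl₂ k H x) = Algebra.TensorProduct.lift (pos₄ (incl₁ k H) (incl₂ k H) 1)
      (pos₄ (incl₁ k H) (incl₂ k H) 3) (pos₄_commute incl_commute 1 3 (by decide)) (δ' x) := by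
  have : ∀ P : H ⊗[k] H, Algebra.TensorProduct.tensorTensorTensorComm k k k k H H H H
      (1 ⊗ₜ[k] P) = Algebra.TensorProduct.lift (pos₄ (incl₁ k H) (incl₂ k H) 1)
      (pos₄ (incl₁ k H) (incl₂ k H) 3) (pos₄_commute incl_commute 1 3 (by decide)) P := by
    intro P
    induction P with
    | zero => simp
    | tmul p q => simp [pos₄, Algebra.TensorProduct.one_def]
    | add p q hp hq => simp only [tmul_add, map_add, hp, hq]
  simpa [tensorComul] using this (δ' x)

theorem tensorComulOp_incl₁ (δ' : H →ₐ[k] H ⊗[k] H) (x : H) :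
    tensorComul (comulOp k H) δ' (incl₁ k H x) =
      Algebra.TensorProduct.lift (pos₄ (incl₁ k H) (incl₂ k H) 2)
      (pos₄ (incl₁ k H) (incl₂ k H) 0) (pos₄_commute incl_commute 2 0 (by decide)) (comul x) := by
  rw [tensorComul_incl₁, conv_comm (pos₄_commute incl_commute 2 0 (by decide)) (comul x)]
  rfl

theorem lift_incl : Algebra.TensorProduct.lift (incl₁ k H) (incl₂ k H) incl_commute =
    AlgHom.id k (H ⊗[k] H) := by
  refine AlgHom.toLinearMap_injective (TensorProduct.ext' fun x y => ?_)
  simp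

theorem UniversalR.isCocycle_R₂₃ (𝓡 : UniversalR k H) :
    IsCocycle (tensorComul (Bialgebra.comulAlgHom k H) (Bialgebra.comulAlgHom k H))
      (tensorCounit k H) 𝓡.R₂₃ :=
  𝓡.isCocycle_one incl_commute (tensorComul_incl₁ _ _) (tensorComul_incl₂ _ _)
    (fun x => by simp [tensorCounit]) (fun x => by simp [tensorCounit])

theorem UniversalR.isCocycle_R₁₃_mul_R₂₃ (𝓡 : UniversalR k H) :
    IsCocycle (tensorComul (comulOp k H) (Bialgebra.comulAlgHom k H))
      (tensorCounit k H) (𝓡.R₁₃ * 𝓡.R₂₃) :=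
  𝓡.isCocycle_two incl_commute (tensorComulOp_incl₁ _) (tensorComul_incl₂ _ _)
    (fun x => by simp [tensorCounit]) (fun x => by simp [tensorCounit])

theorem UniversalR.R₂₃_mul (𝓡 : UniversalR k H) (x : H) :
    𝓡.R₂₃ * Algebra.TensorProduct.map (Bialgebra.comulAlgHom k H) (Bialgebra.comulAlgHom k H)
      (Bialgebra.comulAlgHom k H x) =
    tensorComul (Bialgebra.comulAlgHom k H) (Bialgebra.comulAlgHom k H)
      (Bialgebra.comulAlgHom k H x) * 𝓡.R₂₃ := by
  have := 𝓡.intertwine_one incl_commute (tensorComul_incl₁ (Bialgebra.comulAlgHom k H)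
    (Bialgebra.comulAlgHom k H)) (tensorComul_incl₂ _ _) x
  rw [lift_incl] at this
  exact this

theorem UniversalR.R₁₃_mul_R₂₃_mul (𝓡 : UniversalR k H) (x : H) :
    𝓡.R₁₃ * 𝓡.R₂₃ * Algebra.TensorProduct.map (Bialgebra.comulAlgHom k H)
      (Bialgebra.comulAlgHom k H) (Bialgebra.comulAlgHom k H x) =
    tensorComul (comulOp k H) (Bialgebra.comulAlgHom k H)
      (Bialgebra.comulAlgHom k H x) * (𝓡.R₁₃ * 𝓡.R₂₃) := by
  have := 𝓡.intertwine_two incl_commute (tensorComulOp_incl₁ (Bialgebra.comulAlgHom k H))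
    (tensorComul_incl₂ _ _) x
  rw [lift_incl] at this
  exact this

theorem tensorCounit_comul (x : H) :
    tensorCounit k H (Bialgebra.comulAlgHom k H x) = Bialgebra.counitAlgHom k H x := by
  have : ∀ P : H ⊗[k] H, tensorCounit k H P =
      counit (R := k) (TensorProduct.rid k H (counit.lTensor H P)) := by
    intro P
    induction P with
    | zero => simp
    | tmul p q => simp [tensorCounit, mul_comm]
    | add p q hp hq => simp only [map_add, hp, hq]
  rw [this, Bialgebra.comulAlgHom_apply, Coalgebra.lTensor_counit_comul]
  simp

/-- A left `H`-module algebra. -/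
structure ModAlg (k : Type u) (H : Type v) [CommRing k] [Ring H] [HopfAlgebra k H] where
  /-- the underlying algebra -/
  carrier : Type w
  [ring : Ring carrier]
  [algebra : Algebra k carrier]
  /-- the action `x ↦ (a ↦ x ▸ a)` -/
  act : H →ₐ[k] Module.End k carrier
  isModuleAlgebra : IsModuleAlgebra (Bialgebra.comulAlgHom k H) (Bialgebra.counitAlgHom k H) act

attribute [instance] ModAlg.ring ModAlg.algebra

/-- The ring of scalars as an `H`-module algebra, with `x ▸ c = ε(x) c`. -/
noncomputable def ModAlg.scalars (k : Type u) (H : Type v) [CommRing k] [Ring H]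
    [HopfAlgebra k H] : ModAlg.{u, v, u} k H where
  carrier := k
  act := (Algebra.ofId k (Module.End k k)).comp (Bialgebra.counitAlgHom k H)
  isModuleAlgebra :=
    { act_mul := fun x a b => by
        have : ∀ P : H ⊗[k] H, mulVia
            ((Algebra.ofId k (Module.End k k)).comp (Bialgebra.counitAlgHom k H)) P a b =
            tensorCounit k H P * (a * b) := by
          intro P
          induction P with
          | zero => simp
          | tmul p q => simp [tensorCounit, Algebra.ofId_apply, mul_mul_mul_comm]
          | add p q hp hq => simp only [map_add, LinearMap.add_apply, hp, hq, add_mul]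
        rw [this, tensorCounit_comul]
        simp [Algebra.ofId_apply]
      act_one := fun x => by simp [Algebra.ofId_apply] }

/-- The action of `H ⊗ H` on `A ⊗ B`. -/
noncomputable def tensorAct (A B : ModAlg k H) :
    H ⊗[k] H →ₐ[k] Module.End k (A.carrier ⊗[k] B.carrier) :=
  Module.endTensorEndAlgHom.comp (Algebra.TensorProduct.map A.act B.act)

theorem tensorAct_tmul (A B : ModAlg k H) (x y : H) (a : A.carrier) (b : B.carrier) :
    tensorAct A B (x ⊗ₜ[k] y) (a ⊗ₜ[k] b) = A.act x a ⊗ₜ[k] B.act y b := rfl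

theorem tensorAct_isModuleAlgebra (A B : ModAlg k H) :
    IsModuleAlgebra (tensorComul (Bialgebra.comulAlgHom k H) (Bialgebra.comulAlgHom k H))
      (tensorCounit k H) (tensorAct A B) where
  act_mul x a b := by
    have key : ∀ (P Q : H ⊗[k] H) (a₁ a₂ : A.carrier) (b₁ b₂ : B.carrier),
        mulVia (tensorAct A B)
          (Algebra.TensorProduct.tensorTensorTensorComm k k k k H H H H (P ⊗ₜ[k] Q))
          (a₁ ⊗ₜ[k] b₁) (a₂ ⊗ₜ[k] b₂) = mulVia A.act P a₁ a₂ ⊗ₜ[k] mulVia B.act Q b₁ b₂ := by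
      intro P Q a₁ a₂ b₁ b₂
      induction P with
      | zero => simp
      | add p q hp hq =>
        simp only [add_tmul, map_add, LinearMap.add_apply, hp, hq]
      | tmul p q =>
        induction Q with
        | zero => simp
        | add p q hp hq =>
          simp only [tmul_add, map_add, LinearMap.add_apply, hp, hq]
        | tmul r s => simp [tensorAct_tmul]
    induction a with
    | zero => simp
    | add a a' ha ha' => simp only [add_mul, map_add, LinearMap.add_apply, ha, ha']
    | tmul a₁ b₁ =>
      induction b with
      | zero => simp
      | add b b' hb hb' => simp only [mul_add, map_add, hb, hb']
      | tmul a₂ b₂ =>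
        induction x with
        | zero => simp
        | add x y hx hy => simp only [map_add, LinearMap.add_apply, hx, hy]
        | tmul x y =>
          have h1 : tensorComul (Bialgebra.comulAlgHom k H) (Bialgebra.comulAlgHom k H)
              (x ⊗ₜ[k] y) = Algebra.TensorProduct.tensorTensorTensorComm k k k k H H H H
              (Bialgebra.comulAlgHom k H x ⊗ₜ[k] Bialgebra.comulAlgHom k H y) := rfl
          rw [h1, key, ← A.isModuleAlgebra.act_mul, ← B.isModuleAlgebra.act_mul]
          simp [tensorAct_tmul]
  act_one x := by
    induction x with
    | zero => simp
    | add x y hx hy => simp only [map_add, LinearMap.add_apply, hx, hy, add_smul]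
    | tmul x y =>
      have h1 := A.isModuleAlgebra.act_one x
      have h2 := B.isModuleAlgebra.act_one y
      simp only [Bialgebra.counitAlgHom_apply] at h1 h2
      rw [Algebra.TensorProduct.one_def, tensorAct_tmul, h1, h2]
      simp [tensorCounit, TensorProduct.smul_tmul', TensorProduct.tmul_smul, smul_smul,
        mul_comm]

/-- The twisted (braided) tensor product of two `H`-module algebras: the twist of `A ⊗ B` by
`R₂₃`, so `(a ⊗ b)(a' ⊗ b') = a (R₂ ▸ a') ⊗ (R₁ ▸ b) b'`; `H` acts through its coproduct. -/
noncomputable def ModAlg.twistedTensor (𝓡 : UniversalR k H) (A B : ModAlg k H) : ModAlg k H where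
  carrier := Twisted (tensorAct_isModuleAlgebra A B) 𝓡.isCocycle_R₂₃
  act := Twisted.act _ _ (Bialgebra.comulAlgHom k H)
  isModuleAlgebra := Twisted.isModuleAlgebra _ _ _ _ _ 𝓡.R₂₃_mul tensorCounit_comul

end ModuleAlgebras

section Dual

open WithConv

variable {k : Type u} {H : Type v} {D : Type w} [CommRing k] [Ring H] [HopfAlgebra k H]
  [Ring D] [HopfAlgebra k D]

/-- A Hopf pairing between `D` and `H` that separates the elements of `D`; it makes the Hopf
algebra `D` a Hopf dual of `H`, whose elements are linear functions on `H`. -/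
structure HopfDual (k : Type u) (H : Type v) (D : Type w) [CommRing k] [Ring H]
    [HopfAlgebra k H] [Ring D] [HopfAlgebra k D] where
  /-- the pairing `⟨a, x⟩` -/
  pair : D →ₗ[k] H →ₗ[k] k
  mul_left : ∀ a b x, pair (a * b) x =
    LinearMap.mul' k k (TensorProduct.map (pair a) (pair b) (comul x))
  mul_right : ∀ a x y, pair a (x * y) =
    LinearMap.mul' k k (TensorProduct.map (pair.flip x) (pair.flip y) (comul a))
  one_left : ∀ x, pair 1 x = counit x
  one_right : ∀ a, pair a 1 = counit a
  separating : ∀ a, (∀ x, pair a x = 0) → a = 0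

theorem comul_antipode (x : H) : comul (HopfAlgebra.antipode k x) = TensorProduct.map
    (HopfAlgebra.antipode k) (HopfAlgebra.antipode k) (comulOp k H x) := by
  let i₁ : WithConv (H →ₗ[k] H ⊗[k] H) := toConv (incl₁ k H).toLinearMap
  let i₂ : WithConv (H →ₗ[k] H ⊗[k] H) := toConv (incl₂ k H).toLinearMap
  let s₁ : WithConv (H →ₗ[k] H ⊗[k] H) :=
    toConv ((incl₁ k H).toLinearMap ∘ₗ HopfAlgebra.antipode k)
  let s₂ : WithConv (H →ₗ[k] H ⊗[k] H) :=
    toConv ((incl₂ k H).toLinearMap ∘ₗ HopfAlgebra.antipode k)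
  have hs : ∀ f : H →ₐ[k] H ⊗[k] H,
      toConv (f.toLinearMap ∘ₗ HopfAlgebra.antipode k) * toConv f.toLinearMap = 1 := by
    intro f
    have h := LinearMap.algHom_comp_convMul_distrib f (toConv (HopfAlgebra.antipode k (A := H)))
      (toConv LinearMap.id)
    rw [LinearMap.antipode_mul_id] at h
    refine WithConv.ext ?_
    refine Eq.trans h.symm (LinearMap.ext fun y => ?_)
    simp
  have h1 : i₁ * i₂ = toConv comul := by
    refine WithConv.ext (LinearMap.ext fun y => ?_)
    exact (conv_lift (incl₁ k H) (incl₂ k H) incl_commute y).trans (by rw [lift_incl]; rfl)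
  have h2 : s₂ * s₁ = toConv (TensorProduct.map (HopfAlgebra.antipode k)
      (HopfAlgebra.antipode k) ∘ₗ (comulOp k H).toLinearMap) := by
    refine WithConv.ext (LinearMap.ext fun y => ?_)
    rw [LinearMap.convMul_def]
    change LinearMap.mul' k _ (TensorProduct.map
      ((incl₂ k H).toLinearMap ∘ₗ HopfAlgebra.antipode k)
      ((incl₁ k H).toLinearMap ∘ₗ HopfAlgebra.antipode k) (comul y)) = TensorProduct.map
      (HopfAlgebra.antipode k) (HopfAlgebra.antipode k) (flip₂₁ k H (comul y))
    generalize comul (R := k) y = P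
    induction P with
    | zero => simp
    | tmul p q => simp [flip₂₁]
    | add p q hp hq => simp only [map_add, hp, hq]
  have h3 : s₂ * s₁ * toConv comul = 1 := by
    rw [← h1, mul_assoc, ← mul_assoc s₁, hs (incl₁ k H), one_mul, hs (incl₂ k H)]
  have h4 := left_inv_eq_right_inv h3 LinearMap.comul_right_inv
  rw [h2] at h4
  exact (congrArg (fun f => f.ofConv x) h4).symm

namespace HopfDual

variable (P : HopfDual k H D)

theorem ext {a b : D} (h : ∀ x, P.pair a x = P.pair b x) : a = b := by
  rw [← sub_eq_zero]
  exact P.separating _ fun x => by simp [h]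

/-- The left coregular action `x ▷ a = a₁ ⟨a₂, x⟩`, as a linear map in `a`. -/
noncomputable def left (x : H) : D →ₗ[k] D :=
  (TensorProduct.rid k D).toLinearMap ∘ₗ (P.pair.flip x).lTensor D ∘ₗ comul

/-- The right coregular action `a ◁ x = ⟨a₁, x⟩ a₂`, as a linear map in `a`. -/
noncomputable def right (x : H) : D →ₗ[k] D :=
  (TensorProduct.lid k D).toLinearMap ∘ₗ (P.pair.flip x).rTensor D ∘ₗ comul

theorem pair_left (x : H) (a : D) (z : H) : P.pair (P.left x a) z = P.pair a (z * x) := by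
  rw [P.mul_right]
  simp only [left, LinearMap.comp_apply]
  generalize comul (R := k) a = Q
  induction Q with
  | zero => simp
  | tmul p q => simp [mul_comm]
  | add p q hp hq => simp only [map_add, LinearMap.add_apply, hp, hq]

theorem pair_right (x : H) (a : D) (z : H) : P.pair (P.right x a) z = P.pair a (x * z) := by
  rw [P.mul_right]
  simp only [right, LinearMap.comp_apply]
  generalize comul (R := k) a = Q
  induction Q with
  | zero => simp
  | tmul p q => simp
  | add p q hp hq => simp only [map_add, LinearMap.add_apply, hp, hq]

/-- The left action `x ↦ (a ↦ x ▷ a)` of `H` on its dual. -/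
noncomputable def leftAct : H →ₐ[k] Module.End k D :=
  AlgHom.ofLinearMap
    { toFun := P.left
      map_add' := fun x y => LinearMap.ext fun a => P.ext fun z => by
        simp [pair_left, mul_add]
      map_smul' := fun r x => LinearMap.ext fun a => P.ext fun z => by
        simp [pair_left] }
    (LinearMap.ext fun a => P.ext fun z => by simp [pair_left])
    (fun x y => LinearMap.ext fun a => P.ext fun z => by simp [pair_left, mul_assoc])

/-- The left action `x ↦ (a ↦ a ◁ γ(x))` of `H` on its dual, with the antipode `γ`. -/
noncomputable def rightAct : H →ₐ[k] Module.End k D :=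
  AlgHom.ofLinearMap
    { toFun := fun x => P.right (HopfAlgebra.antipode k x)
      map_add' := fun x y => LinearMap.ext fun a => P.ext fun z => by
        simp [pair_right, add_mul]
      map_smul' := fun r x => LinearMap.ext fun a => P.ext fun z => by
        simp [pair_right] }
    (LinearMap.ext fun a => P.ext fun z => by simp [pair_right])
    (fun x y => LinearMap.ext fun a => P.ext fun z => by
      simp [pair_right, HopfAlgebra.antipode_mul_antidistrib, mul_assoc])

theorem pair_leftAct (x : H) (a : D) (z : H) : P.pair (P.leftAct x a) z = P.pair a (z * x) :=
  P.pair_left x a z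

theorem pair_rightAct (x : H) (a : D) (z : H) :
    P.pair (P.rightAct x a) z = P.pair a (HopfAlgebra.antipode k x * z) :=
  P.pair_right _ a z

/-- The action `(x ⊗ y) ▸ a = y ▷ a ◁ γ(x)` of `Hᵒᵖ ⊗ H` on the dual of `H`, where `Hᵒᵖ` is `H`
with the opposite coproduct. -/
noncomputable def biAct : H ⊗[k] H →ₐ[k] Module.End k D :=
  Algebra.TensorProduct.lift P.rightAct P.leftAct (fun x y =>
    LinearMap.ext fun a => P.ext fun z => by
      simp [pair_leftAct, pair_rightAct, mul_assoc])

theorem biAct_tmul (x y : H) (a : D) :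
    P.biAct (x ⊗ₜ[k] y) a = P.rightAct x (P.leftAct y a) := rfl

/-- `⟨a, u⟩ ⟨b, v⟩` for `u ⊗ v ∈ H ⊗ H`. -/
noncomputable def pair₂ (a b : D) : H ⊗[k] H →ₗ[k] k :=
  LinearMap.mul' k k ∘ₗ TensorProduct.map (P.pair a) (P.pair b)

theorem pair_mul (a b : D) (x : H) : P.pair (a * b) x = P.pair₂ a b (comul x) :=
  P.mul_left a b x

theorem leftAct_isModuleAlgebra :
    IsModuleAlgebra (Bialgebra.comulAlgHom k H) (Bialgebra.counitAlgHom k H) P.leftAct where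
  act_mul x a b := P.ext fun z => by
    have key : ∀ Q : H ⊗[k] H, P.pair (mulVia P.leftAct Q a b) z =
        P.pair₂ a b (comul z * Q) := by
      intro Q
      induction Q with
      | zero => simp
      | add p q hp hq => simp only [map_add, LinearMap.add_apply, hp, hq, mul_add]
      | tmul r s =>
        rw [mulVia_tmul, pair_mul]
        generalize comul (R := k) z = T
        induction T with
        | zero => simp
        | add p q hp hq => simp only [map_add, hp, hq, add_mul]
        | tmul p q => simp [pair₂, pair_leftAct]
    rw [key, pair_leftAct, pair_mul, Bialgebra.comul_mul]
    rfl
  act_one x := P.ext fun z => by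
    rw [pair_leftAct, P.one_left]
    simp [P.one_left, mul_comm]

theorem rightAct_isModuleAlgebra :
    IsModuleAlgebra (comulOp k H) (Bialgebra.counitAlgHom k H) P.rightAct where
  act_mul x a b := P.ext fun z => by
    have key : ∀ Q : H ⊗[k] H, P.pair (mulVia P.rightAct Q a b) z =
        P.pair₂ a b (TensorProduct.map (HopfAlgebra.antipode k) (HopfAlgebra.antipode k) Q *
          comul z) := by
      intro Q
      induction Q with
      | zero => simp
      | add p q hp hq => simp only [map_add, LinearMap.add_apply, hp, hq, add_mul]
      | tmul r s =>
        rw [mulVia_tmul, pair_mul]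
        generalize comul (R := k) z = T
        induction T with
        | zero => simp
        | add p q hp hq => simp only [map_add, hp, hq, mul_add]
        | tmul p q => simp [pair₂, pair_rightAct]
    rw [key, pair_rightAct, pair_mul, Bialgebra.comul_mul, comul_antipode]
  act_one x := P.ext fun z => by
    rw [pair_rightAct, P.one_left]
    simp [P.one_left]

/-- The dual of `H` is a module algebra over `Hᵒᵖ ⊗ H`. -/
theorem biAct_isModuleAlgebra :
    IsModuleAlgebra (tensorComul (comulOp k H) (Bialgebra.comulAlgHom k H))
      (tensorCounit k H) P.biAct where
  act_mul x a b := by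
    have key : ∀ (T : H ⊗[k] H) (r s : H), mulVia P.rightAct T (P.leftAct r a) (P.leftAct s b) =
        mulVia P.biAct (Algebra.TensorProduct.tensorTensorTensorComm k k k k H H H H
          (T ⊗ₜ[k] (r ⊗ₜ[k] s))) a b := by
      intro T r s
      induction T with
      | zero => simp
      | add p q hp hq => simp only [add_tmul, map_add, LinearMap.add_apply, hp, hq]
      | tmul p q => simp [biAct_tmul]
    have key' : ∀ (y : H) (Q : H ⊗[k] H), P.rightAct y (mulVia P.leftAct Q a b) =
        mulVia P.biAct (Algebra.TensorProduct.tensorTensorTensorComm k k k k H H H H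
          (comulOp k H y ⊗ₜ[k] Q)) a b := by
      intro y Q
      induction Q with
      | zero => simp
      | add p q hp hq => simp only [tmul_add, map_add, LinearMap.add_apply, hp, hq]
      | tmul r s => rw [mulVia_tmul, P.rightAct_isModuleAlgebra.act_mul, key]
    induction x with
    | zero => simp
    | add x y hx hy => simp only [map_add, LinearMap.add_apply, hx, hy]
    | tmul x y =>
      rw [biAct_tmul, P.leftAct_isModuleAlgebra.act_mul, key']
      rfl
  act_one x := by
    induction x with
    | zero => simp
    | add x y hx hy => simp only [map_add, LinearMap.add_apply, hx, hy, add_smul]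
    | tmul x y =>
      rw [biAct_tmul, P.leftAct_isModuleAlgebra.act_one, map_smul,
        P.rightAct_isModuleAlgebra.act_one]
      simp [tensorCounit, smul_smul, mul_comm]

/-- The reflection equation dual `H̃*`: the twist of the `Hᵒᵖ ⊗ H`-module algebra `H*` by the
cocycle `R₁₃ R₂₃`, regarded as an `H`-module algebra through the coproduct of `H`. -/
noncomputable def reDual (𝓡 : UniversalR k H) (P : HopfDual k H D) : ModAlg k H where
  carrier := Twisted P.biAct_isModuleAlgebra 𝓡.isCocycle_R₁₃_mul_R₂₃
  act := Twisted.act _ _ (Bialgebra.comulAlgHom k H)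
  isModuleAlgebra := Twisted.isModuleAlgebra _ _ _ _ _ 𝓡.R₁₃_mul_R₂₃_mul tensorCounit_comul

/-- The identity map from `H*` to `H̃*`. -/
noncomputable def toReDual (𝓡 : UniversalR k H) (P : HopfDual k H D) :
    D ≃ₗ[k] (reDual 𝓡 P).carrier :=
  Twisted.equiv _ _

end HopfDual
end Dual

section Powers

variable {k : Type u} {H : Type v} [CommRing k] [Ring H] [HopfAlgebra k H]

/-- The twisted tensor powers of an `H`-module algebra: the zeroth one is `k`, and the
`(n + 1)`-st one is the twisted tensor product of the `n`-th one with `A`. -/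
noncomputable def ModAlg.power (𝓡 : UniversalR k H) (A : ModAlg.{u, v, u} k H) :
    ℕ → ModAlg.{u, v, u} k H
  | 0 => ModAlg.scalars k H
  | n + 1 => ModAlg.twistedTensor 𝓡 (ModAlg.power 𝓡 A n) A

/-- The embedding `a ↦ a ⊗ 1` into a twisted tensor product. -/
noncomputable def ModAlg.inl (𝓡 : UniversalR k H) (A B : ModAlg k H) :
    A.carrier →ₗ[k] (ModAlg.twistedTensor 𝓡 A B).carrier :=
  (Twisted.equiv (tensorAct_isModuleAlgebra A B) 𝓡.isCocycle_R₂₃).toLinearMap ∘ₗ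
     (TensorProduct.mk k A.carrier B.carrier).flip 1

/-- The embedding `b ↦ 1 ⊗ b` into a twisted tensor product. -/
noncomputable def ModAlg.inr (𝓡 : UniversalR k H) (A B : ModAlg k H) :
    B.carrier →ₗ[k] (ModAlg.twistedTensor 𝓡 A B).carrier :=
  (Twisted.equiv (tensorAct_isModuleAlgebra A B) 𝓡.isCocycle_R₂₃).toLinearMap ∘ₗ
     TensorProduct.mk k A.carrier B.carrier 1

/-- The embedding of `A` in its `n`-th twisted tensor power as the tensor factor with index
`l`. -/
noncomputable def ModAlg.embed (𝓡 : UniversalR k H) (A : ModAlg.{u, v, u} k H) :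
    (n : ℕ) → (l : Fin n) → A.carrier →ₗ[k] (ModAlg.power 𝓡 A n).carrier
  | 0, l => l.elim0
  | n + 1, l => Fin.lastCases (ModAlg.inr 𝓡 (ModAlg.power 𝓡 A n) A)
      (fun i => ModAlg.inl 𝓡 (ModAlg.power 𝓡 A n) A ∘ₗ ModAlg.embed 𝓡 A n i) l

end Powers

section Completed

open WithConv

variable {k : Type u} {H : Type v} {D : Type w} [CommRing k] [Ring H] [HopfAlgebra k H]
  [Ring D] [HopfAlgebra k D]

/-- The completed tensor product `H ⊗ H ⊗ A`, for a Hopf dual `D` of `H`: an element `X` is the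
linear map `f ⊗ g ↦ (f ⊗ g ⊗ id)(X)` from `D ⊗ D` to `A`, and the multiplication, induced by
those of `H` and `A`, is the convolution `(X Y)(f ⊗ g) = X(f₁ ⊗ g₁) Y(f₂ ⊗ g₂)`. -/
abbrev Completed (k : Type u) (D : Type w) (A : Type*) [CommRing k] [Ring D] [HopfAlgebra k D]
    [Ring A] [Algebra k A] : Type _ := WithConv (D ⊗[k] D →ₗ[k] A)

/-- The element `u ⊗ 1`, for `u ∈ H ⊗ H`: it is `f ⊗ g ↦ ⟨f ⊗ g, u⟩ 1`. -/
noncomputable def HopfDual.scalar (P : HopfDual k H D) (A : Type*) [Ring A] [Algebra k A]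
    (u : H ⊗[k] H) : Completed k D A :=
  toConv (Algebra.linearMap k A ∘ₗ (TensorProduct.dualDistrib k H H).flip u ∘ₗ
    TensorProduct.map P.pair P.pair)

/-- The element `K₁`, for the image `K = (id ⊗ φ)(∑ eᵢ ⊗ eⁱ)` of the canonical element under a
linear map `φ`, which is `f ↦ φ(f)`: it is `f ⊗ g ↦ ε(g) φ(f)`. -/
noncomputable def leg₁ {A : Type*} [Ring A] [Algebra k A] (φ : D →ₗ[k] A) : Completed k D A :=
  toConv (φ ∘ₗ (TensorProduct.rid k D).toLinearMap ∘ₗ counit.lTensor D)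

/-- The element `K₂`, for the image `K` of the canonical element under a linear map `φ`: it is
`f ⊗ g ↦ ε(f) φ(g)`. -/
noncomputable def leg₂ {A : Type*} [Ring A] [Algebra k A] (φ : D →ₗ[k] A) : Completed k D A :=
  toConv (φ ∘ₗ (TensorProduct.lid k D).toLinearMap ∘ₗ counit.rTensor D)

theorem HopfDual.scalar_tmul (P : HopfDual k H D) (A : Type*) [Ring A] [Algebra k A]
    (x y : H) (f g : D) :
    (P.scalar A (x ⊗ₜ[k] y)).ofConv (f ⊗ₜ[k] g) = algebraMap k A (P.pair f x * P.pair g y) := by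
  simp [HopfDual.scalar]

theorem leg₁_tmul {A : Type*} [Ring A] [Algebra k A] (φ : D →ₗ[k] A) (f g : D) :
    (leg₁ φ).ofConv (f ⊗ₜ[k] g) = counit (R := k) g • φ f := by
  simp [leg₁]

theorem leg₂_tmul {A : Type*} [Ring A] [Algebra k A] (φ : D →ₗ[k] A) (f g : D) :
    (leg₂ φ).ofConv (f ⊗ₜ[k] g) = counit (R := k) f • φ g := by
  simp [leg₂]

end Completed

section Matrices

variable {k : Type u} {H : Type v} {D : Type w} {A : Type*} [CommRing k] [Ring H]
  [HopfAlgebra k H] [Ring A] [Algebra k A] [Ring D] [HopfAlgebra k D]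

/-- For a linear map `φ` on the dual, the element `∑ eᵢ ⊗ φ(eⁱ)` of `H ⊗ A`. For dual bases `eᵢ`
and `eⁱ`, this is the image `(id ⊗ φ)(K)` of the canonical element `K = ∑ eᵢ ⊗ eⁱ`. -/
noncomputable def canonical {m : ℕ} (e : Fin m → H) (e' : Fin m → D) (φ : D →ₗ[k] A) :
    H ⊗[k] A :=
  ∑ i, e i ⊗ₜ[k] φ (e' i)

/-- `K ↦ K₁`, that is, `x ⊗ a ↦ x ⊗ 1 ⊗ a`. -/
noncomputable def mat₁ (K : H ⊗[k] A) : (H ⊗[k] H) ⊗[k] A :=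
  Algebra.TensorProduct.map (incl₁ k H) (AlgHom.id k A) K

/-- `K ↦ K₂`, that is, `x ⊗ a ↦ 1 ⊗ x ⊗ a`. -/
noncomputable def mat₂ (K : H ⊗[k] A) : (H ⊗[k] H) ⊗[k] A :=
  Algebra.TensorProduct.map (incl₂ k H) (AlgHom.id k A) K

/-- `u ↦ u ⊗ 1`, from `H ⊗ H` to `H ⊗ H ⊗ A`. -/
noncomputable def scalarMat (k : Type u) (H : Type v) [CommRing k] [Ring H] [HopfAlgebra k H]
    (A : Type*) [Ring A] [Algebra k A] : H ⊗[k] H →ₐ[k] (H ⊗[k] H) ⊗[k] A :=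
  Algebra.TensorProduct.includeLeft

end Matrices

section Powers

variable {k : Type u} {H : Type v} {D : Type u} [CommRing k] [Ring H] [HopfAlgebra k H]
  [Ring D] [HopfAlgebra k D]

/-- The `n`-th twisted tensor power of `H̃*`. -/
noncomputable abbrev HopfDual.Power (P : HopfDual k H D) (𝓡 : UniversalR k H) (n : ℕ) : Type u :=
  (ModAlg.power 𝓡 (HopfDual.reDual 𝓡 P) n).carrier

/-- The embedding `H* → H̃* → (H̃*)^{⊗ n}` as the tensor factor with index `l`. -/
noncomputable def HopfDual.embed (P : HopfDual k H D) (𝓡 : UniversalR k H) (n : ℕ) (l : Fin n) :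
    D →ₗ[k] P.Power 𝓡 n :=
  ModAlg.embed 𝓡 (HopfDual.reDual 𝓡 P) n l ∘ₗ (HopfDual.toReDual 𝓡 P).toLinearMap

end Powers

end ReflEq

/-! An element of the completed tensor product is a function on `D ⊗ D`, so each relation compares
two linear maps from `D ⊗ D` to the twisted tensor power. Under convolution, an element `x` of `H`
standing to the left of a K-matrix precomposes it with `f ↦ f ◁ x`, and one standing to the right
with `f ↦ x ▷ f`. Hence `u K₁ v K₂` and `K₂ u K₁ v` both take this form: an operator on `D ⊗ D` made
of coregular actions, then the two embeddings, then multiplication, after a flip in the second case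
(`scalar_leg₁_scalar_leg₂`, `leg₂_scalar_leg₁_scalar`). The products of embedded elements are
rewritten so that both sides end in the same way, and identities between operators or functionals
remain.

The antipode enters through `a ◁ γ(x)` and leaves through three consequences of the axioms of `R`:
`(γ ⊗ id)(R) = R⁻¹`, `(γ ⊗ γ)(R) = R`, and `R₁ R'₁ ⊗ R'₂ γ(R₂) = 1`. The last one is needed in the
form `evalPair_antipode_mul`, because right coregular actions reverse products.

Reflection equation. The embedding `ι_l` is multiplicative, so the claim lies in `H̃*`, whose
product is that of `H*` preceded by the operator of `R₁₃ R₂₃`. The factor `R₂₃` cancels the R-matrix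
between `K₁` and `K₂` on one side and that between `K₂` and `K₁` on the other. Paired with `x`, what
is left reads `R₂₁ R Δ(x)` on one side and `R₂₁ Δᵒᵖ(x) R` on the other, so the equation is
quasi-cocommutativity (`mul'_reflection`).

Exchange relation. For `l < j` the braiding gives `ι_j(b) ι_l(a) = ι_l(R₂ ▸ a) ι_j(R₁ ▸ b)`
(`embed_mul_embed`). Since `H` acts on `H̃*` through its coproduct, `R` acts here as `(Δ ⊗ Δ)(R) =
R₁₄ R₁₃ R₂₄ R₂₃`. Two of these four factors cancel against the R-matrices of the left side, and the
other two are the operator of the right side (`endTensor_adAct_mul`).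

Finite basis. The algebraic tensor product maps multiplicatively and injectively to the completed
one and carries K-matrices to K-matrices, so the relations pull back. -/

namespace ReflEq

/-! ### The antipode and the universal R-matrix -/

section Antipode

variable {k : Type u} {H : Type v} {B : Type w} [CommRing k] [Ring H] [HopfAlgebra k H]
  [Ring B] [Algebra k B]

/-- The linear map `x ⊗ y ↦ α(x) β(y)`. -/
noncomputable def evalPair (α β : H →ₗ[k] B) : H ⊗[k] H →ₗ[k] B :=
  LinearMap.mul' k B ∘ₗ TensorProduct.map α β

@[simp] theorem evalPair_tmul (α β : H →ₗ[k] B) (x y : H) :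
    evalPair α β (x ⊗ₜ[k] y) = α x * β y := by
  simp [evalPair]

/-- Right coregular actions reverse products, so they cannot be arguments of
`Algebra.TensorProduct.lift`. The operators below are therefore written with `evalPair`, and this
equality imports what was proved for `lift`. -/
theorem lift_eq_evalPair (f g : H →ₐ[k] B) (hfg : ∀ x y, Commute (f x) (g y)) (u : H ⊗[k] H) :
    Algebra.TensorProduct.lift f g hfg u = evalPair f.toLinearMap g.toLinearMap u := by
  induction u with
  | zero => simp
  | tmul x y => simp
  | add p q hp hq => simp only [map_add, hp, hq]

theorem evalPair_map (α β : H →ₗ[k] B) (f g : H →ₗ[k] H) (u : H ⊗[k] H) :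
    evalPair α β (TensorProduct.map f g u) = evalPair (α ∘ₗ f) (β ∘ₗ g) u := by
  induction u with
  | zero => simp
  | tmul x y => simp
  | add p q hp hq => simp only [map_add, hp, hq]

theorem evalPair_flip {α β : H →ₗ[k] B} (hαβ : ∀ x y, Commute (α x) (β y)) (u : H ⊗[k] H) :
    evalPair α β (flip₂₁ k H u) = evalPair β α u := by
  induction u with
  | zero => simp
  | tmul x y => simpa [flip₂₁] using (hαβ y x).eq
  | add p q hp hq => simp only [map_add, hp, hq]

/-- Both maps reverse products and their images commute, so together they reverse products of `H ⊗
H`. Thus the operators of `R` and `R⁻¹` under two right actions are still inverse to each other. -/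
theorem evalPair_mul_of_antihom {α β : H →ₗ[k] B} (hα : ∀ x y, α (x * y) = α y * α x)
    (hβ : ∀ x y, β (x * y) = β y * β x) (hαβ : ∀ x y, Commute (α x) (β y)) (u v : H ⊗[k] H) :
    evalPair α β (u * v) = evalPair α β v * evalPair α β u := by
  induction u with
  | zero => simp
  | add p q hp hq => simp only [add_mul, mul_add, map_add, hp, hq]
  | tmul x y =>
    induction v with
    | zero => simp
    | add p q hp hq => simp only [add_mul, mul_add, map_add, hp, hq]
    | tmul x' y' =>
      simp only [Algebra.TensorProduct.tmul_mul_tmul, evalPair_tmul, hα, hβ]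
      rw [mul_assoc, mul_assoc, ← mul_assoc (β y'), ← mul_assoc (α x), (hαβ x y').eq]

theorem evalPair_commute {α β α' β' : H →ₗ[k] B} (h₁ : ∀ x y, Commute (α x) (α' y))
    (h₂ : ∀ x y, Commute (α x) (β' y)) (h₃ : ∀ x y, Commute (β x) (α' y))
    (h₄ : ∀ x y, Commute (β x) (β' y)) (u v : H ⊗[k] H) :
    Commute (evalPair α β u) (evalPair α' β' v) := by
  induction u with
  | zero => simp
  | add p q hp hq => simpa using hp.add_left hq
  | tmul x y =>
    induction v with
    | zero => simp
    | add p q hp hq => simpa using hp.add_right hq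
    | tmul x' y' =>
      simpa using ((h₁ x x').mul_right (h₂ x y')).mul_left ((h₃ y x').mul_right (h₄ y y'))

variable (𝓡 : UniversalR k H)

/-- `(γ ⊗ id)(R) = R⁻¹`. -/
theorem UniversalR.antipode_left :
    TensorProduct.map (HopfAlgebra.antipode k) LinearMap.id (𝓡.R : H ⊗[k] H) =
      (𝓡.R⁻¹ : (H ⊗[k] H)ˣ) := by
  -- `T` multiplies the first two legs after applying `γ` to the first. On `(Δ ⊗ id)(R)` the
  -- antipode axiom leaves `1 ⊗ (ε ⊗ id)(R) = 1`; on `R₁₃ R₂₃` it gives `(γ ⊗ id)(R) R`.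
  let T : (H ⊗[k] H) ⊗[k] H →ₗ[k] H ⊗[k] H := TensorProduct.map
    (LinearMap.mul' k H ∘ₗ TensorProduct.map (HopfAlgebra.antipode k) LinearMap.id) LinearMap.id
  have h1 : ∀ u v : H ⊗[k] H, T (leg₁₃ k H u * leg₂₃ k H v) =
      TensorProduct.map (HopfAlgebra.antipode k) LinearMap.id u * v := by
    intro u v
    induction u with
    | zero => simp
    | add p q hp hq => simp only [map_add, add_mul, hp, hq]
    | tmul x y =>
      induction v with
      | zero => simp
      | add p q hp hq => simp only [map_add, mul_add, hp, hq]
      | tmul x' y' => simp [T, leg₁₃, leg₂₃]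
  have h2 : ∀ u : H ⊗[k] H,
      T (Algebra.TensorProduct.map (Bialgebra.comulAlgHom k H) (AlgHom.id k H) u) =
        1 ⊗ₜ[k] Algebra.TensorProduct.lid k H
          (Algebra.TensorProduct.map (Bialgebra.counitAlgHom k H) (AlgHom.id k H) u) := by
    intro u
    induction u with
    | zero => simp
    | add p q hp hq => simp only [map_add, tmul_add, hp, hq]
    | tmul x y =>
      have := HopfAlgebra.mul_antipode_rTensor_comul_apply (R := k) x
      simp only [LinearMap.rTensor] at this
      simp [T, this, Algebra.algebraMap_eq_smul_one, TensorProduct.smul_tmul]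
  have h := congrArg T 𝓡.comul_left
  rw [h1, h2, 𝓡.counit_left] at h
  exact (Units.inv_eq_of_mul_eq_one_left h.symm).symm

/-- `(γ ⊗ γ)(R) = R`. -/
theorem UniversalR.antipode_antipode :
    TensorProduct.map (HopfAlgebra.antipode k) (HopfAlgebra.antipode k) (𝓡.R : H ⊗[k] H) =
      𝓡.R := by
  -- `T` is `γ` on the first leg and `m(γ ⊗ id)` on the other two. It sends `(id ⊗ Δ)(R)` to `1` and
  -- `R₁₃ R₁₂` to `(γ ⊗ γ)(R) (γ ⊗ id)(R)`, in this order because `γ` reverses the product in the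
  -- first leg. The last factor is `R⁻¹`.
  let T : (H ⊗[k] H) ⊗[k] H →ₗ[k] H ⊗[k] H :=
    TensorProduct.map (HopfAlgebra.antipode k)
      (LinearMap.mul' k H ∘ₗ TensorProduct.map (HopfAlgebra.antipode k) LinearMap.id) ∘ₗ
      (TensorProduct.assoc k H H H).toLinearMap
  have h1 : ∀ u v : H ⊗[k] H, T (leg₁₃ k H u * leg₁₂ k H v) =
      TensorProduct.map (HopfAlgebra.antipode k) (HopfAlgebra.antipode k) v *
      TensorProduct.map (HopfAlgebra.antipode k) LinearMap.id u := by
    intro u v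
    induction u with
    | zero => simp
    | add p q hp hq => simp only [map_add, add_mul, mul_add, hp, hq]
    | tmul x y =>
      induction v with
      | zero => simp
      | add p q hp hq => simp only [map_add, add_mul, mul_add, hp, hq]
      | tmul x' y' => simp [T, leg₁₃, leg₁₂, HopfAlgebra.antipode_mul_antidistrib]
  have h2 : ∀ u : H ⊗[k] H, T ((Algebra.TensorProduct.assoc k k k H H H).symm
      (Algebra.TensorProduct.map (AlgHom.id k H) (Bialgebra.comulAlgHom k H) u)) =
        HopfAlgebra.antipode k (Algebra.TensorProduct.rid k k H
          (Algebra.TensorProduct.map (AlgHom.id k H) (Bialgebra.counitAlgHom k H) u)) ⊗ₜ[k] 1 := by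
    intro u
    induction u with
    | zero => simp
    | add p q hp hq => simp only [map_add, add_tmul, hp, hq]
    | tmul x y =>
      -- The associator of modules and that of algebras are the same map, so they cancel.
      have h3 : ∀ z : H ⊗[k] (H ⊗[k] H), TensorProduct.assoc k H H H
          ((Algebra.TensorProduct.assoc k k k H H H).symm z) = z :=
        (TensorProduct.assoc k H H H).apply_symm_apply
      have := HopfAlgebra.mul_antipode_rTensor_comul_apply (R := k) y
      simp only [LinearMap.rTensor] at this
      simp [T, h3, this, Algebra.algebraMap_eq_smul_one, TensorProduct.smul_tmul]
  have h := congrArg T 𝓡.comul_right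
  rw [h1, h2, 𝓡.counit_right, 𝓡.antipode_left, HopfAlgebra.antipode_one] at h
  exact (Units.mul_inv_eq_one.mp h.symm)

/-- `(R₁ R'₁) ⊗ (R'₂ γ(R₂)) = 1`, evaluated by an algebra map `α` on the first factor and an
anti-multiplicative map `ρ` on the second one. -/
theorem UniversalR.evalPair_antipode_mul (α : H →ₐ[k] B) (ρ : H →ₗ[k] B) (hρ₁ : ρ 1 = 1)
    (hρ : ∀ x y, ρ (x * y) = ρ y * ρ x) (hαρ : ∀ x y, Commute (α x) (ρ y)) :
    evalPair α.toLinearMap (ρ ∘ₗ HopfAlgebra.antipode k) (𝓡.R : H ⊗[k] H) *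
      evalPair α.toLinearMap ρ 𝓡.R = 1 := by
  -- Here `m(id ⊗ γ)` is applied to the last two legs of `(id ⊗ Δ)(R) = R₁₃ R₁₂`, with result `R₁
  -- R'₁ ⊗ R'₂ γ(R₂)`. Since `ρ` reverses the product `R'₂ γ(R₂)` and commutes with `α`, the value
  -- splits into a part with `R` and a part with `R'`.
  let T : (H ⊗[k] H) ⊗[k] H →ₗ[k] B := evalPair α.toLinearMap ρ ∘ₗ
    TensorProduct.map LinearMap.id
      (LinearMap.mul' k H ∘ₗ TensorProduct.map LinearMap.id (HopfAlgebra.antipode k)) ∘ₗ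
      (TensorProduct.assoc k H H H).toLinearMap
  have h1 : ∀ u v : H ⊗[k] H, T (leg₁₃ k H u * leg₁₂ k H v) =
      evalPair α.toLinearMap (ρ ∘ₗ HopfAlgebra.antipode k) u * evalPair α.toLinearMap ρ v := by
    intro u v
    induction u with
    | zero => simp
    | add p q hp hq => simp only [map_add, add_mul, hp, hq]
    | tmul x y =>
      induction v with
      | zero => simp
      | add p q hp hq => simp only [map_add, mul_add, hp, hq]
      | tmul x' y' =>
        have := (hαρ x' (HopfAlgebra.antipode k y)).eq
        simp only [T, leg₁₃, leg₁₂, LinearMap.comp_apply, Algebra.TensorProduct.map_tmul,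
          Algebra.TensorProduct.includeLeft_apply, Algebra.TensorProduct.tmul_mul_tmul,
          AlgHom.id_apply, mul_one, one_mul, LinearEquiv.coe_coe, TensorProduct.assoc_tmul,
          TensorProduct.map_tmul, LinearMap.id_apply, LinearMap.mul'_apply, evalPair_tmul, hρ,
          AlgHom.toLinearMap_apply, map_mul]
        rw [mul_assoc, mul_assoc, ← mul_assoc (α x'), this, mul_assoc]
  have h2 : ∀ u : H ⊗[k] H, T ((Algebra.TensorProduct.assoc k k k H H H).symm
      (Algebra.TensorProduct.map (AlgHom.id k H) (Bialgebra.comulAlgHom k H) u)) =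
        α (Algebra.TensorProduct.rid k k H
          (Algebra.TensorProduct.map (AlgHom.id k H) (Bialgebra.counitAlgHom k H) u)) := by
    intro u
    induction u with
    | zero => simp
    | add p q hp hq => simp only [map_add, hp, hq]
    | tmul x y =>
      have h3 : ∀ z : H ⊗[k] (H ⊗[k] H), TensorProduct.assoc k H H H
          ((Algebra.TensorProduct.assoc k k k H H H).symm z) = z :=
        (TensorProduct.assoc k H H H).apply_symm_apply
      have := HopfAlgebra.mul_antipode_lTensor_comul_apply (R := k) y
      simp only [LinearMap.lTensor] at this
      simp [T, h3, this, Algebra.algebraMap_eq_smul_one, hρ₁]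
  have h := congrArg T 𝓡.comul_right
  rw [h1, h2, 𝓡.counit_right, map_one] at h
  exact h.symm

end Antipode

/-! ### Embeddings in twisted tensor powers and the exchange of factors -/

section Embeddings

variable {k : Type u} {H : Type v} [CommRing k] [Ring H] [HopfAlgebra k H] (𝓡 : UniversalR k H)

/-- The first leg of `u` acts on the unit of `B`, hence by the counit. For `u = R` only `(ε ⊗ id)(R)
= 1` survives, so there is no braiding when the left factor lies in `A`. -/
theorem mulVia_tensorAct_tmul_one (A B : ModAlg k H) (u : H ⊗[k] H) (a a' : A.carrier)
    (b' : B.carrier) : mulVia (tensorAct A B) (Algebra.TensorProduct.map (incl₂ k H) (incl₁ k H) u)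
      (a ⊗ₜ[k] 1) (a' ⊗ₜ[k] b') =
    (a * A.act (Algebra.TensorProduct.lid k H
      (Algebra.TensorProduct.map (Bialgebra.counitAlgHom k H) (AlgHom.id k H) u)) a') ⊗ₜ[k] b' := by
  induction u with
  | zero => simp
  | add p q hp hq => simp only [map_add, LinearMap.add_apply, mul_add, add_tmul, hp, hq]
  | tmul x y =>
    rw [Algebra.TensorProduct.map_tmul, mulVia_tmul, incl₁_apply, incl₂_apply, tensorAct_tmul,
      tensorAct_tmul, B.isModuleAlgebra.act_one]
    simp [TensorProduct.smul_tmul']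

theorem mulVia_tensorAct_one_tmul (A B : ModAlg k H) (u : H ⊗[k] H) (a : A.carrier)
    (b b' : B.carrier) : mulVia (tensorAct A B)
      (Algebra.TensorProduct.map (incl₂ k H) (incl₁ k H) u) (a ⊗ₜ[k] b) (1 ⊗ₜ[k] b') =
    a ⊗ₜ[k] (B.act (Algebra.TensorProduct.rid k k H
      (Algebra.TensorProduct.map (AlgHom.id k H) (Bialgebra.counitAlgHom k H) u)) b * b') := by
  induction u with
  | zero => simp
  | add p q hp hq => simp only [map_add, LinearMap.add_apply, add_mul, tmul_add, hp, hq]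
  | tmul x y =>
    rw [Algebra.TensorProduct.map_tmul, mulVia_tmul, incl₁_apply, incl₂_apply, tensorAct_tmul,
      tensorAct_tmul, A.isModuleAlgebra.act_one]
    simp [TensorProduct.smul_tmul']

/-- The units make both multiplications trivial, so the product in the wrong order is the bare
action of `u`, followed by the flip because its first leg acts on `b`. -/
theorem mulVia_tensorAct_swap (A B : ModAlg k H) (u : H ⊗[k] H) (a : A.carrier)
    (b : B.carrier) : mulVia (tensorAct A B)
      (Algebra.TensorProduct.map (incl₂ k H) (incl₁ k H) u) (1 ⊗ₜ[k] b) (a ⊗ₜ[k] 1) =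
    TensorProduct.comm k B.carrier A.carrier (tensorAct B A u (b ⊗ₜ[k] a)) := by
  induction u with
  | zero => simp
  | add p q hp hq => simp only [map_add, LinearMap.add_apply, hp, hq]
  | tmul x y =>
    rw [Algebra.TensorProduct.map_tmul, mulVia_tmul, incl₁_apply, incl₂_apply, tensorAct_tmul,
      tensorAct_tmul, tensorAct_tmul]
    simp

namespace ModAlg

/-- The identity map from `A ⊗ B` to the twisted tensor product. -/
noncomputable def toTwisted (A B : ModAlg k H) :
    A.carrier ⊗[k] B.carrier ≃ₗ[k] (twistedTensor 𝓡 A B).carrier :=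
  Twisted.equiv (tensorAct_isModuleAlgebra A B) 𝓡.isCocycle_R₂₃

theorem toTwisted_mul (A B : ModAlg k H) (s t : A.carrier ⊗[k] B.carrier) :
    toTwisted 𝓡 A B s * toTwisted 𝓡 A B t =
      toTwisted 𝓡 A B (mulVia (tensorAct A B) 𝓡.R₂₃ s t) := rfl

theorem act_toTwisted (A B : ModAlg k H) (x : H) (t : A.carrier ⊗[k] B.carrier) :
    (twistedTensor 𝓡 A B).act x (toTwisted 𝓡 A B t) =
      toTwisted 𝓡 A B (tensorAct A B (comul x) t) := rfl

theorem inl_eq (A B : ModAlg k H) (a : A.carrier) :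
    inl 𝓡 A B a = toTwisted 𝓡 A B (a ⊗ₜ[k] 1) := rfl

theorem inr_eq (A B : ModAlg k H) (b : B.carrier) :
    inr 𝓡 A B b = toTwisted 𝓡 A B (1 ⊗ₜ[k] b) := rfl

theorem inl_mul_toTwisted (A B : ModAlg k H) (a a' : A.carrier) (b' : B.carrier) :
    inl 𝓡 A B a * toTwisted 𝓡 A B (a' ⊗ₜ[k] b') = toTwisted 𝓡 A B ((a * a') ⊗ₜ[k] b') := by
  rw [inl_eq, toTwisted_mul, UniversalR.R₂₃, mulVia_tensorAct_tmul_one, 𝓡.counit_left, map_one]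
  rfl

theorem toTwisted_mul_inr (A B : ModAlg k H) (a : A.carrier) (b b' : B.carrier) :
    toTwisted 𝓡 A B (a ⊗ₜ[k] b) * inr 𝓡 A B b' = toTwisted 𝓡 A B (a ⊗ₜ[k] (b * b')) := by
  rw [inr_eq, toTwisted_mul, UniversalR.R₂₃, mulVia_tensorAct_one_tmul, 𝓡.counit_right, map_one]
  rfl

theorem inl_mul (A B : ModAlg k H) (a a' : A.carrier) :
    inl 𝓡 A B (a * a') = inl 𝓡 A B a * inl 𝓡 A B a' :=
  (inl_mul_toTwisted 𝓡 A B a a' 1).symm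

theorem inr_mul (A B : ModAlg k H) (b b' : B.carrier) :
    inr 𝓡 A B (b * b') = inr 𝓡 A B b * inr 𝓡 A B b' :=
  (toTwisted_mul_inr 𝓡 A B 1 b b').symm

theorem toTwisted_tmul (A B : ModAlg k H) (a : A.carrier) (b : B.carrier) :
    toTwisted 𝓡 A B (a ⊗ₜ[k] b) = inl 𝓡 A B a * inr 𝓡 A B b := by
  rw [inl_eq, toTwisted_mul_inr, one_mul]

/-- The second leg of `Δ(x)` acts on `1` by the counit, and `x₁ ε(x₂) = x`. This equivariance lets
the action of `R` pass through nested embeddings. -/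
theorem act_inl (A B : ModAlg k H) (x : H) (a : A.carrier) :
    (twistedTensor 𝓡 A B).act x (inl 𝓡 A B a) = inl 𝓡 A B (A.act x a) := by
  have : ∀ u : H ⊗[k] H, tensorAct A B u (a ⊗ₜ[k] 1) =
      A.act (TensorProduct.rid k H (counit.lTensor H u)) a ⊗ₜ[k] 1 := by
    intro u
    induction u with
    | zero => simp
    | add p q hp hq => simp only [map_add, LinearMap.add_apply, add_tmul, hp, hq]
    | tmul x y =>
      rw [tensorAct_tmul, B.isModuleAlgebra.act_one]
      simp [TensorProduct.smul_tmul']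
  rw [inl_eq, act_toTwisted, this, Coalgebra.lTensor_counit_comul]
  simp [inl_eq]

theorem act_inr (A B : ModAlg k H) (x : H) (b : B.carrier) :
    (twistedTensor 𝓡 A B).act x (inr 𝓡 A B b) = inr 𝓡 A B (B.act x b) := by
  have : ∀ u : H ⊗[k] H, tensorAct A B u (1 ⊗ₜ[k] b) =
      1 ⊗ₜ[k] B.act (TensorProduct.lid k H (counit.rTensor H u)) b := by
    intro u
    induction u with
    | zero => simp
    | add p q hp hq => simp only [map_add, LinearMap.add_apply, tmul_add, hp, hq]
    | tmul x y =>
      rw [tensorAct_tmul, A.isModuleAlgebra.act_one]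
      simp [TensorProduct.smul_tmul']
  rw [inr_eq, act_toTwisted, this, Coalgebra.rTensor_counit_comul]
  simp [inr_eq]

theorem inr_mul_inl (A B : ModAlg k H) (a : A.carrier) (b : B.carrier) :
    inr 𝓡 A B b * inl 𝓡 A B a = toTwisted 𝓡 A B
      (TensorProduct.comm k B.carrier A.carrier (tensorAct B A 𝓡.R (b ⊗ₜ[k] a))) := by
  rw [inl_eq, inr_eq, toTwisted_mul, UniversalR.R₂₃, mulVia_tensorAct_swap]

variable (A : ModAlg.{u, v, u} k H)

/-- The embedding `a ↦ a ⊗ 1` of the `n`-th twisted tensor power in the next one. -/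
noncomputable def powerInl (n : ℕ) : (power 𝓡 A n).carrier →ₗ[k] (power 𝓡 A (n + 1)).carrier :=
  inl 𝓡 (power 𝓡 A n) A

/-- The embedding `a ↦ 1 ⊗ a` in a twisted tensor power, as the last factor. -/
noncomputable def powerInr (n : ℕ) : A.carrier →ₗ[k] (power 𝓡 A (n + 1)).carrier :=
  inr 𝓡 (power 𝓡 A n) A

/-- The next power is by definition a twisted tensor product with `A`, so the properties of `inl`
and `inr` carry over to `powerInl` and `powerInr`. -/
theorem powerInl_mul (n : ℕ) (a b : (power 𝓡 A n).carrier) :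
    powerInl 𝓡 A n (a * b) = powerInl 𝓡 A n a * powerInl 𝓡 A n b :=
  inl_mul 𝓡 (power 𝓡 A n) A a b

theorem powerInr_mul (n : ℕ) (a b : A.carrier) :
    powerInr 𝓡 A n (a * b) = powerInr 𝓡 A n a * powerInr 𝓡 A n b :=
  inr_mul 𝓡 (power 𝓡 A n) A a b

theorem act_powerInl (n : ℕ) (x : H) (a : (power 𝓡 A n).carrier) :
    (power 𝓡 A (n + 1)).act x (powerInl 𝓡 A n a) = powerInl 𝓡 A n ((power 𝓡 A n).act x a) :=
  act_inl 𝓡 (power 𝓡 A n) A x a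

theorem act_powerInr (n : ℕ) (x : H) (a : A.carrier) :
    (power 𝓡 A (n + 1)).act x (powerInr 𝓡 A n a) = powerInr 𝓡 A n (A.act x a) :=
  act_inr 𝓡 (power 𝓡 A n) A x a

/-- The product of tensor factors in ascending order. -/
noncomputable def powerMul (n : ℕ) :
    (power 𝓡 A n).carrier ⊗[k] A.carrier →ₗ[k] (power 𝓡 A (n + 1)).carrier :=
  (toTwisted 𝓡 (power 𝓡 A n) A).toLinearMap

theorem powerMul_tmul (n : ℕ) (a : (power 𝓡 A n).carrier) (b : A.carrier) :
    powerMul 𝓡 A n (a ⊗ₜ[k] b) = powerInl 𝓡 A n a * powerInr 𝓡 A n b :=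
  toTwisted_tmul 𝓡 (power 𝓡 A n) A a b

theorem powerInr_mul_powerInl (n : ℕ) (a : (power 𝓡 A n).carrier) (b : A.carrier) :
    powerInr 𝓡 A n b * powerInl 𝓡 A n a = powerMul 𝓡 A n (TensorProduct.comm k A.carrier
      (power 𝓡 A n).carrier (tensorAct A (power 𝓡 A n) 𝓡.R (b ⊗ₜ[k] a))) :=
  inr_mul_inl 𝓡 (power 𝓡 A n) A a b

theorem embed_last (n : ℕ) : embed 𝓡 A (n + 1) (Fin.last n) = powerInr 𝓡 A n := by
  rw [embed]
  exact Fin.lastCases_last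

theorem embed_castSucc (n : ℕ) (l : Fin n) :
    embed 𝓡 A (n + 1) l.castSucc = powerInl 𝓡 A n ∘ₗ embed 𝓡 A n l := by
  rw [embed]
  exact Fin.lastCases_castSucc _

theorem embed_mul (n : ℕ) (l : Fin n) (a b : A.carrier) :
    embed 𝓡 A n l (a * b) = embed 𝓡 A n l a * embed 𝓡 A n l b := by
  induction n with
  | zero => exact l.elim0
  | succ n ih =>
    induction l using Fin.lastCases with
    | last => rw [embed_last, powerInr_mul]
    | cast l => simp only [embed_castSucc, LinearMap.comp_apply, ih, powerInl_mul]

theorem act_embed (n : ℕ) (l : Fin n) (x : H) (a : A.carrier) :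
    (power 𝓡 A n).act x (embed 𝓡 A n l a) = embed 𝓡 A n l (A.act x a) := by
  induction n with
  | zero => exact l.elim0
  | succ n ih =>
    induction l using Fin.lastCases with
    | last => rw [embed_last, act_powerInr]
    | cast l => simp only [embed_castSucc, LinearMap.comp_apply, act_powerInl, ih]

/-- If `j` is the last factor, this is the braiding of the last twisted product, and the action on
the `n`-th power reaches the factor `l` by `act_embed`. Otherwise both factors lie in the `n`-th
power, which embeds multiplicatively. -/
theorem embed_mul_embed (n : ℕ) {l j : Fin n} (hlj : l < j) (t : A.carrier ⊗[k] A.carrier) :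
    LinearMap.mul' k _ (TensorProduct.map (embed 𝓡 A n j) (embed 𝓡 A n l) t) =
      LinearMap.mul' k _ (TensorProduct.map (embed 𝓡 A n l) (embed 𝓡 A n j)
        (TensorProduct.comm k _ _ (tensorAct A A 𝓡.R t))) := by
  induction n with
  | zero => exact l.elim0
  | succ n ih =>
    induction l using Fin.lastCases with
    | last => exact absurd hlj (Fin.le_last j).not_gt
    | cast l =>
      induction j using Fin.lastCases with
      | last =>
        rw [embed_last, embed_castSucc]
        clear ih
        induction t with
        | zero => simp only [map_zero]
        | add s t hs ht => simp only [map_add, hs, ht]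
        | tmul b a =>
          rw [TensorProduct.map_tmul, LinearMap.mul'_apply, LinearMap.comp_apply,
            powerInr_mul_powerInl]
          -- What remains is linear in `R`, so it may be checked on pure tensors.
          generalize (𝓡.R : H ⊗[k] H) = u
          induction u with
          | zero => simp only [map_zero, LinearMap.zero_apply]
          | add p q hp hq => simp only [map_add, LinearMap.add_apply, hp, hq]
          | tmul x y =>
            rw [tensorAct_tmul, tensorAct_tmul, act_embed, TensorProduct.comm_tmul,
              TensorProduct.comm_tmul, TensorProduct.map_tmul, LinearMap.mul'_apply,
              powerMul_tmul, LinearMap.comp_apply]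
      | cast j =>
        have h : ∀ (i i' : Fin n) (t : A.carrier ⊗[k] A.carrier),
            LinearMap.mul' k _ (TensorProduct.map (embed 𝓡 A (n + 1) i.castSucc)
              (embed 𝓡 A (n + 1) i'.castSucc) t) = powerInl 𝓡 A n
            (LinearMap.mul' k _ (TensorProduct.map (embed 𝓡 A n i) (embed 𝓡 A n i') t)) := by
          intro i i' t
          induction t with
          | zero => simp only [map_zero]
          | add s t hs ht => simp only [map_add, hs, ht]
          | tmul b a => simp only [TensorProduct.map_tmul, LinearMap.mul'_apply, embed_castSucc,
              LinearMap.comp_apply, powerInl_mul]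
        rw [h, h, ih (by simpa using hlj)]

end ModAlg

end Embeddings

/-! ### Convolution products as coregular operators on `D ⊗ D` -/

section Convolution

open WithConv

variable {k : Type u} {H : Type v} {D : Type w} {A : Type*} [CommRing k] [Ring H]
  [HopfAlgebra k H] [Ring D] [HopfAlgebra k D] [Ring A] [Algebra k A]

theorem completed_mul_tmul (X Y : Completed k D A) (f g : D) :
    (X * Y).ofConv (f ⊗ₜ[k] g) = LinearMap.mul' k A (TensorProduct.map X.ofConv Y.ofConv
      (TensorProduct.tensorTensorTensorComm k D D D D (comul f ⊗ₜ[k] comul g))) := rfl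

/-- In the second leg both factors are the counit, and `ε(g₁) ε(g₂) = ε(g)`; only the convolution in
the first leg remains. -/
theorem leg₁_mul_leg₁ (φ ψ : D →ₗ[k] A) :
    leg₁ φ * leg₁ ψ = leg₁ (toConv φ * toConv ψ : WithConv (D →ₗ[k] A)).ofConv := by
  refine WithConv.ext (TensorProduct.ext' fun f g => ?_)
  have h : ∀ S T : D ⊗[k] D, LinearMap.mul' k A (TensorProduct.map (leg₁ φ).ofConv
      (leg₁ ψ).ofConv (TensorProduct.tensorTensorTensorComm k D D D D (S ⊗ₜ[k] T))) =
      counit (R := k) (TensorProduct.rid k D (counit.lTensor D T)) •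
        LinearMap.mul' k A (TensorProduct.map φ ψ S) := by
    intro S T
    induction S with
    | zero => simp
    | add p q hp hq => simp only [add_tmul, map_add, smul_add, hp, hq]
    | tmul p q =>
      induction T with
      | zero => simp
      | add p q hp hq => simp only [tmul_add, map_add, add_smul, hp, hq]
      | tmul r s => simp [leg₁_tmul, smul_smul, mul_comm]
  rw [completed_mul_tmul, h, Coalgebra.lTensor_counit_comul, leg₁_tmul]
  simp [LinearMap.convMul_def]

theorem leg₂_mul_leg₂ (φ ψ : D →ₗ[k] A) :
    leg₂ φ * leg₂ ψ = leg₂ (toConv φ * toConv ψ : WithConv (D →ₗ[k] A)).ofConv := by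
  refine WithConv.ext (TensorProduct.ext' fun f g => ?_)
  have h : ∀ S T : D ⊗[k] D, LinearMap.mul' k A (TensorProduct.map (leg₂ φ).ofConv
      (leg₂ ψ).ofConv (TensorProduct.tensorTensorTensorComm k D D D D (S ⊗ₜ[k] T))) =
      counit (R := k) (TensorProduct.rid k D (counit.lTensor D S)) •
        LinearMap.mul' k A (TensorProduct.map φ ψ T) := by
    intro S T
    induction S with
    | zero => simp
    | add p q hp hq => simp only [add_tmul, map_add, add_smul, hp, hq]
    | tmul p q =>
      induction T with
      | zero => simp
      | add p q hp hq => simp only [tmul_add, map_add, smul_add, hp, hq]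
      | tmul r s => simp [leg₂_tmul, smul_smul, mul_comm]
  rw [completed_mul_tmul, h, Coalgebra.lTensor_counit_comul, leg₂_tmul]
  simp [LinearMap.convMul_def]

/-- The counits absorb both coproducts: `φ(f₁) ε(g₁) ε(f₂) ψ(g₂) = φ(f) ψ(g)`. -/
theorem leg₁_mul_leg₂ (φ ψ : D →ₗ[k] A) :
    leg₁ φ * leg₂ ψ = toConv (LinearMap.mul' k A ∘ₗ TensorProduct.map φ ψ) := by
  refine WithConv.ext (TensorProduct.ext' fun f g => ?_)
  have h : ∀ S T : D ⊗[k] D, LinearMap.mul' k A (TensorProduct.map (leg₁ φ).ofConv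
      (leg₂ ψ).ofConv (TensorProduct.tensorTensorTensorComm k D D D D (S ⊗ₜ[k] T))) =
      φ (TensorProduct.rid k D (counit.lTensor D S)) *
        ψ (TensorProduct.lid k D (counit.rTensor D T)) := by
    intro S T
    induction S with
    | zero => simp
    | add p q hp hq => simp only [add_tmul, map_add, add_mul, hp, hq]
    | tmul p q =>
      induction T with
      | zero => simp
      | add p q hp hq => simp only [tmul_add, map_add, mul_add, hp, hq]
      | tmul r s => simp [leg₁_tmul, leg₂_tmul, smul_smul, mul_comm]
  rw [completed_mul_tmul, h, Coalgebra.lTensor_counit_comul, Coalgebra.rTensor_counit_comul]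
  simp

/-- The values multiply in `A` in the order of the factors, not of the legs, whence the flip. It is
the only trace of the noncommutativity of `A`. -/
theorem leg₂_mul_leg₁ (φ ψ : D →ₗ[k] A) : leg₂ ψ * leg₁ φ = toConv (LinearMap.mul' k A ∘ₗ
    TensorProduct.map ψ φ ∘ₗ (TensorProduct.comm k D D).toLinearMap) := by
  refine WithConv.ext (TensorProduct.ext' fun f g => ?_)
  have h : ∀ S T : D ⊗[k] D, LinearMap.mul' k A (TensorProduct.map (leg₂ ψ).ofConv
      (leg₁ φ).ofConv (TensorProduct.tensorTensorTensorComm k D D D D (S ⊗ₜ[k] T))) =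
      ψ (TensorProduct.rid k D (counit.lTensor D T)) *
        φ (TensorProduct.lid k D (counit.rTensor D S)) := by
    intro S T
    induction S with
    | zero => simp
    | add p q hp hq => simp only [add_tmul, map_add, mul_add, hp, hq]
    | tmul p q =>
      induction T with
      | zero => simp
      | add p q hp hq => simp only [tmul_add, map_add, add_mul, hp, hq]
      | tmul r s => simp [leg₁_tmul, leg₂_tmul, smul_smul, mul_comm]
  rw [completed_mul_tmul, h, Coalgebra.lTensor_counit_comul, Coalgebra.rTensor_counit_comul]
  simp

namespace HopfDual

variable (P : HopfDual k H D)

/-- The element `x ∈ H` as the function `f ↦ ⟨f, x⟩` with values in an algebra. -/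
noncomputable def fn (A : Type*) [Ring A] [Algebra k A] (x : H) : D →ₗ[k] A :=
  Algebra.linearMap k A ∘ₗ P.pair.flip x

theorem fn_apply (x : H) (f : D) : P.fn A x f = algebraMap k A (P.pair f x) := rfl

/-- The convolution is `⟨f₁, x⟩ φ(f₂)`, and the scalar moves inside `φ`. This is how left
multiplication in `H` becomes the right coregular action, and `mul_fn` is its mirror image. -/
theorem fn_mul (φ : D →ₗ[k] A) (x : H) :
    (toConv (P.fn A x) * toConv φ : WithConv (D →ₗ[k] A)).ofConv = φ ∘ₗ P.right x := by
  refine LinearMap.ext fun f => ?_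
  rw [LinearMap.convMul_def]
  simp only [right, LinearMap.comp_apply]
  generalize comul (R := k) f = S
  induction S with
  | zero => simp
  | add p q hp hq => simp only [map_add, hp, hq]
  | tmul p q => simp [fn_apply, ← Algebra.smul_def]

theorem mul_fn (φ : D →ₗ[k] A) (x : H) :
    (toConv φ * toConv (P.fn A x) : WithConv (D →ₗ[k] A)).ofConv = φ ∘ₗ P.left x := by
  refine LinearMap.ext fun f => ?_
  rw [LinearMap.convMul_def]
  simp only [left, LinearMap.comp_apply]
  generalize comul (R := k) f = S
  induction S with
  | zero => simp
  | add p q hp hq => simp only [map_add, hp, hq]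
  | tmul p q => simp [fn_apply, ← Algebra.commutes, ← Algebra.smul_def]

/-- Different legs commute as soon as one of the two functions has scalar values. -/
theorem leg₂_fn_commute (φ : D →ₗ[k] A) (x : H) : Commute (leg₂ (P.fn A x)) (leg₁ φ) := by
  rw [Commute, SemiconjBy, leg₁_mul_leg₂, leg₂_mul_leg₁]
  refine WithConv.ext (TensorProduct.ext' fun f g => ?_)
  simp [fn_apply, Algebra.commutes]

theorem scalar_tmul_eq (x y : H) :
    P.scalar A (x ⊗ₜ[k] y) = leg₁ (P.fn A x) * leg₂ (P.fn A y) := by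
  rw [leg₁_mul_leg₂]
  refine WithConv.ext (TensorProduct.ext' fun f g => ?_)
  rw [scalar_tmul]
  simp [fn_apply]

theorem scalar_add (u v : H ⊗[k] H) : P.scalar A (u + v) = P.scalar A u + P.scalar A v := by
  refine WithConv.ext (LinearMap.ext fun t => ?_)
  simp [scalar]

theorem scalar_zero : P.scalar A (0 : H ⊗[k] H) = 0 := by
  refine WithConv.ext (LinearMap.ext fun t => ?_)
  simp [scalar]

/-- The operator `f ↦ x ▷ f` on the first factor of `D ⊗ D`. -/
noncomputable def left₁ : H →ₐ[k] Module.End k (D ⊗[k] D) :=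
  Module.endTensorEndAlgHom.comp (Algebra.TensorProduct.includeLeft.comp P.leftAct)

/-- The operator `g ↦ x ▷ g` on the second factor of `D ⊗ D`. -/
noncomputable def left₂ : H →ₐ[k] Module.End k (D ⊗[k] D) :=
  Module.endTensorEndAlgHom.comp (Algebra.TensorProduct.includeRight.comp P.leftAct)

/-- The operator `f ↦ f ◁ γ(x)` on the first factor of `D ⊗ D`. -/
noncomputable def antiRight₁ : H →ₐ[k] Module.End k (D ⊗[k] D) :=
  Module.endTensorEndAlgHom.comp (Algebra.TensorProduct.includeLeft.comp P.rightAct)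

/-- The operator `g ↦ g ◁ γ(x)` on the second factor of `D ⊗ D`. -/
noncomputable def antiRight₂ : H →ₐ[k] Module.End k (D ⊗[k] D) :=
  Module.endTensorEndAlgHom.comp (Algebra.TensorProduct.includeRight.comp P.rightAct)

/-- The right coregular action, as a linear map to the endomorphisms. -/
noncomputable def rightHom : H →ₗ[k] Module.End k D where
  toFun := P.right
  map_add' x y := LinearMap.ext fun a => P.ext fun z => by simp [pair_right, add_mul]
  map_smul' r x := LinearMap.ext fun a => P.ext fun z => by simp [pair_right]

/-- The operator `f ↦ f ◁ x` on the first factor of `D ⊗ D`. -/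
noncomputable def right₁ : H →ₗ[k] Module.End k (D ⊗[k] D) :=
  LinearMap.rTensorHom D ∘ₗ P.rightHom

/-- The operator `g ↦ g ◁ x` on the second factor of `D ⊗ D`. -/
noncomputable def right₂ : H →ₗ[k] Module.End k (D ⊗[k] D) :=
  LinearMap.lTensorHom D ∘ₗ P.rightHom

theorem left₁_tmul (x : H) (f g : D) : P.left₁ x (f ⊗ₜ[k] g) = P.left x f ⊗ₜ[k] g := rfl

theorem left₂_tmul (x : H) (f g : D) : P.left₂ x (f ⊗ₜ[k] g) = f ⊗ₜ[k] P.left x g := rfl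

theorem right₁_tmul (x : H) (f g : D) : P.right₁ x (f ⊗ₜ[k] g) = P.right x f ⊗ₜ[k] g := rfl

theorem right₂_tmul (x : H) (f g : D) : P.right₂ x (f ⊗ₜ[k] g) = f ⊗ₜ[k] P.right x g := rfl

theorem antiRight₁_toLinearMap :
    P.antiRight₁.toLinearMap = P.right₁ ∘ₗ HopfAlgebra.antipode k := by
  refine LinearMap.ext fun x => TensorProduct.ext' fun f g => rfl

theorem antiRight₂_toLinearMap :
    P.antiRight₂.toLinearMap = P.right₂ ∘ₗ HopfAlgebra.antipode k := by
  refine LinearMap.ext fun x => TensorProduct.ext' fun f g => rfl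

theorem right_mul (x y : H) (a : D) : P.right (x * y) a = P.right y (P.right x a) :=
  P.ext fun z => by simp [pair_right, mul_assoc]

theorem left_right (x y : H) (a : D) : P.left x (P.right y a) = P.right y (P.left x a) :=
  P.ext fun z => by simp [pair_left, pair_right, mul_assoc]

theorem right₁_mul (x y : H) : P.right₁ (x * y) = P.right₁ y * P.right₁ x :=
  TensorProduct.ext' fun f g => by simp [right₁_tmul, right_mul]

theorem right₂_mul (x y : H) : P.right₂ (x * y) = P.right₂ y * P.right₂ x :=
  TensorProduct.ext' fun f g => by simp [right₂_tmul, right_mul]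

theorem right₁_one : P.right₁ 1 = 1 := by
  have h : ∀ f, P.right 1 f = f := fun f => P.ext fun z => by simp [pair_right]
  exact TensorProduct.ext' fun f g => by simp [right₁_tmul, h]

theorem right₂_one : P.right₂ 1 = 1 := by
  have h : ∀ f, P.right 1 f = f := fun f => P.ext fun z => by simp [pair_right]
  exact TensorProduct.ext' fun f g => by simp [right₂_tmul, h]

theorem commute_left₁_right₁ (x y : H) : Commute (P.left₁ x) (P.right₁ y) :=
  TensorProduct.ext' fun f g => by simp [right₁_tmul, left₁_tmul, left_right]

theorem commute_left₁_right₂ (x y : H) : Commute (P.left₁ x) (P.right₂ y) :=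
  TensorProduct.ext' fun f g => by simp [right₂_tmul, left₁_tmul]

theorem commute_left₁_left₂ (x y : H) : Commute (P.left₁ x) (P.left₂ y) :=
  TensorProduct.ext' fun f g => by simp [left₂_tmul, left₁_tmul]

theorem commute_left₂_right₁ (x y : H) : Commute (P.left₂ x) (P.right₁ y) :=
  TensorProduct.ext' fun f g => by simp [right₁_tmul, left₂_tmul]

theorem commute_left₂_right₂ (x y : H) : Commute (P.left₂ x) (P.right₂ y) :=
  TensorProduct.ext' fun f g => by simp [right₂_tmul, left₂_tmul, left_right]

theorem commute_right₁_right₂ (x y : H) : Commute (P.right₁ x) (P.right₂ y) :=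
  TensorProduct.ext' fun f g => by simp [right₂_tmul, right₁_tmul]

/-- The product `u K₁ v K₂`. -/
theorem scalar_leg₁_scalar_leg₂ (φ ψ : D →ₗ[k] A) (u v : H ⊗[k] H) :
    P.scalar A u * leg₁ φ * P.scalar A v * leg₂ ψ =
      toConv (LinearMap.mul' k A ∘ₗ TensorProduct.map φ ψ ∘ₗ
        (evalPair P.left₁.toLinearMap P.right₂ v * evalPair P.right₁ P.right₂ u)) := by
  induction u with
  | zero => simp [scalar_zero]
  | add p q hp hq =>
    simp only [scalar_add, map_add, add_mul, mul_add, hp, hq, LinearMap.comp_add, toConv_add]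
  | tmul x y =>
    induction v with
    | zero => simp [scalar_zero]
    | add p q hp hq =>
      simp only [scalar_add, map_add, add_mul, mul_add, hp, hq, LinearMap.comp_add, toConv_add]
    | tmul x' y' =>
      -- The second-leg scalar `y` moves past `K₁` and `x'`, so the factors are sorted by legs, with
      -- the order within each leg kept: `x K₁ x'` in the first and `y y' K₂` in the second.
      have h : P.scalar A (x ⊗ₜ[k] y) * leg₁ φ * P.scalar A (x' ⊗ₜ[k] y') * leg₂ ψ =
          (leg₁ (P.fn A x) * leg₁ φ * leg₁ (P.fn A x')) *
            (leg₂ (P.fn A y) * (leg₂ (P.fn A y') * leg₂ ψ)) := by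
        rw [scalar_tmul_eq, scalar_tmul_eq]
        simp only [mul_assoc]
        rw [← mul_assoc (leg₂ (P.fn A y)), (P.leg₂_fn_commute φ y).eq, mul_assoc,
          ← mul_assoc (leg₂ (P.fn A y)), (P.leg₂_fn_commute (P.fn A x') y).eq, mul_assoc]
      rw [h, leg₁_mul_leg₁, fn_mul, leg₁_mul_leg₁, mul_fn, leg₂_mul_leg₂, fn_mul, leg₂_mul_leg₂,
        fn_mul, leg₁_mul_leg₂]
      congr 1
      refine TensorProduct.ext' fun f g => ?_
      simp [right₁_tmul, right₂_tmul, left₁_tmul, left_right]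

/-- The product `K₂ u K₁ v`. -/
theorem leg₂_scalar_leg₁_scalar (φ ψ : D →ₗ[k] A) (u v : H ⊗[k] H) :
    leg₂ ψ * P.scalar A u * leg₁ φ * P.scalar A v =
      toConv (LinearMap.mul' k A ∘ₗ TensorProduct.map ψ φ ∘ₗ
        (TensorProduct.comm k D D).toLinearMap ∘ₗ
        (evalPair P.right₁ P.left₂.toLinearMap u *
          evalPair P.left₁.toLinearMap P.left₂.toLinearMap v)) := by
  induction u with
  | zero => simp [scalar_zero]
  | add p q hp hq =>
    simp only [scalar_add, map_add, add_mul, mul_add, hp, hq, LinearMap.comp_add, toConv_add]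
  | tmul x y =>
    induction v with
    | zero => simp [scalar_zero]
    | add p q hp hq =>
      simp only [scalar_add, map_add, mul_add, hp, hq, LinearMap.comp_add, toConv_add]
    | tmul x' y' =>
      -- Sorted by legs, now with the second leg in front: `K₂ y y'`, then `x K₁ x'`. Both
      -- second-leg scalars stand to the right of `K₂` and therefore become left coregular actions.
      have h : leg₂ ψ * P.scalar A (x ⊗ₜ[k] y) * leg₁ φ * P.scalar A (x' ⊗ₜ[k] y') =
          (leg₂ ψ * leg₂ (P.fn A y) * leg₂ (P.fn A y')) *
            (leg₁ (P.fn A x) * leg₁ φ * leg₁ (P.fn A x')) := by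
        rw [scalar_tmul_eq, scalar_tmul_eq, ← (P.leg₂_fn_commute (P.fn A x) y).eq,
          ← (P.leg₂_fn_commute (P.fn A x') y').eq]
        simp only [mul_assoc]
        rw [← mul_assoc (leg₁ φ), ← (P.leg₂_fn_commute φ y').eq, mul_assoc,
          ← mul_assoc (leg₁ (P.fn A x)), ← (P.leg₂_fn_commute (P.fn A x) y').eq, mul_assoc]
      rw [h, leg₁_mul_leg₁, fn_mul, leg₁_mul_leg₁, mul_fn, leg₂_mul_leg₂, mul_fn, leg₂_mul_leg₂,
        mul_fn, leg₂_mul_leg₁]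
      congr 1
      refine TensorProduct.ext' fun f g => ?_
      simp [right₁_tmul, left₂_tmul, left₁_tmul]

end HopfDual

end Convolution

/-! ### Identities between the operators of `R` on `D ⊗ D` -/

section Operators

variable {k : Type u} {H : Type v} {D : Type w} [CommRing k] [Ring H]
  [HopfAlgebra k H] [Ring D] [HopfAlgebra k D] (P : HopfDual k H D) (𝓡 : UniversalR k H)

/-- The action of `End D ⊗ End D` on `D ⊗ D`. -/
noncomputable def endTensor (k : Type u) (D : Type w) [CommRing k] [Ring D] [Algebra k D] :
    Module.End k D ⊗[k] Module.End k D →ₐ[k] Module.End k (D ⊗[k] D) :=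
  Module.endTensorEndAlgHom

namespace HopfDual

theorem commute_antiRight₁_left₁ (x y : H) : Commute (P.antiRight₁ x) (P.left₁ y) :=
  (P.commute_left₁_right₁ y (HopfAlgebra.antipode k x)).symm

theorem commute_antiRight₁_left₂ (x y : H) : Commute (P.antiRight₁ x) (P.left₂ y) :=
  (P.commute_left₂_right₁ y (HopfAlgebra.antipode k x)).symm

theorem commute_antiRight₁_antiRight₂ (x y : H) : Commute (P.antiRight₁ x) (P.antiRight₂ y) :=
  P.commute_right₁_right₂ (HopfAlgebra.antipode k x) (HopfAlgebra.antipode k y)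

theorem commute_left₁_antiRight₂ (x y : H) : Commute (P.left₁ x) (P.antiRight₂ y) :=
  P.commute_left₁_right₂ x (HopfAlgebra.antipode k y)

theorem commute_antiRight₂_left₂ (x y : H) : Commute (P.antiRight₂ x) (P.left₂ y) :=
  (P.commute_left₂_right₂ y (HopfAlgebra.antipode k x)).symm

/-- `(ρ₁γ ⊗ ρ₂γ)(R) = (ρ₁ ⊗ ρ₂)(R)` for the right coregular actions `ρ₁` and `ρ₂`. -/
theorem evalPair_antiRight₁_antiRight₂ :
    evalPair P.antiRight₁.toLinearMap P.antiRight₂.toLinearMap (𝓡.R : H ⊗[k] H) =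
      evalPair P.right₁ P.right₂ 𝓡.R := by
  rw [antiRight₁_toLinearMap, antiRight₂_toLinearMap, ← evalPair_map, 𝓡.antipode_antipode]

theorem evalPair_antiRight₂_antiRight₁ :
    evalPair P.antiRight₂.toLinearMap P.antiRight₁.toLinearMap (𝓡.R : H ⊗[k] H) =
      evalPair P.right₂ P.right₁ 𝓡.R := by
  rw [antiRight₁_toLinearMap, antiRight₂_toLinearMap, ← evalPair_map, 𝓡.antipode_antipode]

/-- This cancels the R-matrix standing between `K₁` and `K₂`, both against `R₂₃` in the cocycle of
`H̃*` and against `R₂₃` in `(Δ ⊗ Δ)(R)`. -/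
theorem evalPair_left₁_antiRight₂_mul :
    evalPair P.left₁.toLinearMap P.antiRight₂.toLinearMap (𝓡.R : H ⊗[k] H) *
      evalPair P.left₁.toLinearMap P.right₂ 𝓡.R = 1 := by
  rw [antiRight₂_toLinearMap]
  exact 𝓡.evalPair_antipode_mul P.left₁ P.right₂ P.right₂_one P.right₂_mul
    P.commute_left₁_right₂

theorem evalPair_left₂_antiRight₁_mul :
    evalPair P.left₂.toLinearMap P.antiRight₁.toLinearMap (𝓡.R : H ⊗[k] H) *
      evalPair P.left₂.toLinearMap P.right₁ 𝓡.R = 1 := by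
  rw [antiRight₁_toLinearMap]
  exact 𝓡.evalPair_antipode_mul P.left₂ P.right₁ P.right₁_one P.right₁_mul
    P.commute_left₂_right₁

/-- Both antipodes disappear by `(γ ⊗ γ)(R) = R`, and the right actions reverse the product to the
operator of `R⁻¹ R = 1`. -/
theorem evalPair_antiRight_mul_inv :
    evalPair P.antiRight₁.toLinearMap P.antiRight₂.toLinearMap (𝓡.R : H ⊗[k] H) *
      evalPair P.right₁ P.right₂ (𝓡.R⁻¹ : (H ⊗[k] H)ˣ) = 1 := by
  rw [evalPair_antiRight₁_antiRight₂, ← evalPair_mul_of_antihom P.right₁_mul P.right₂_mul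
    P.commute_right₁_right₂, Units.inv_mul, Algebra.TensorProduct.one_def, evalPair_tmul,
    right₁_one, right₂_one, mul_one]

/-- The action of `H` on its reflection equation dual. -/
noncomputable def adAct : H →ₐ[k] Module.End k D :=
  P.biAct.comp (Bialgebra.comulAlgHom k H)

theorem endTensor_biAct_left (u : H ⊗[k] H) :
    endTensor k D (P.biAct u ⊗ₜ[k] (1 : Module.End k D)) =
    Algebra.TensorProduct.lift P.antiRight₁ P.left₁ P.commute_antiRight₁_left₁ u := by
  induction u with
  | zero => simp
  | add p q hp hq => simp only [map_add, add_tmul, hp, hq]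
  | tmul x y =>
    rw [Algebra.TensorProduct.lift_tmul]
    exact TensorProduct.ext' fun f g => rfl

theorem endTensor_biAct_right (u : H ⊗[k] H) :
    endTensor k D ((1 : Module.End k D) ⊗ₜ[k] P.biAct u) =
    Algebra.TensorProduct.lift P.antiRight₂ P.left₂ P.commute_antiRight₂_left₂ u := by
  induction u with
  | zero => simp
  | add p q hp hq => simp only [map_add, tmul_add, hp, hq]
  | tmul x y =>
    rw [Algebra.TensorProduct.lift_tmul]
    exact TensorProduct.ext' fun f g => rfl

/-- The action of `(Δ ⊗ Δ)(R) = R₁₄ R₁₃ R₂₄ R₂₃`. -/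
theorem endTensor_adAct :
    endTensor k D
      (Algebra.TensorProduct.map P.adAct P.adAct (𝓡.R : H ⊗[k] H)) =
    evalPair P.antiRight₁.toLinearMap P.left₂.toLinearMap 𝓡.R *
      evalPair P.antiRight₁.toLinearMap P.antiRight₂.toLinearMap 𝓡.R *
      (evalPair P.left₁.toLinearMap P.left₂.toLinearMap 𝓡.R *
      evalPair P.left₁.toLinearMap P.antiRight₂.toLinearMap 𝓡.R) := by
  -- `ad₂` keeps the second leg whole while `(Δ ⊗ id)(R) = R₁₃ R₂₃` divides the first. Then `(id ⊗
  -- Δ)(R) = R₁₃ R₁₂` divides the second leg of each factor; its reversed order puts `left₂` before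
  -- `antiRight₂`.
  let ad₂ : H →ₐ[k] Module.End k (D ⊗[k] D) :=
    (endTensor k D).comp (Algebra.TensorProduct.includeRight.comp P.adAct)
  have had₂ : ∀ x, ad₂ x = Algebra.TensorProduct.lift P.antiRight₂ P.left₂
      P.commute_antiRight₂_left₂ (comul x) := fun x => P.endTensor_biAct_right (comul x)
  have c₁ : ∀ x y, Commute (P.antiRight₁ x) (ad₂ y) := fun x y => by
    rw [had₂]
    exact (commute_lift _ (fun z => (P.commute_antiRight₁_antiRight₂ x z).symm)
      (fun z => (P.commute_antiRight₁_left₂ x z).symm) _).symm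
  have c₂ : ∀ x y, Commute (P.left₁ x) (ad₂ y) := fun x y => by
    rw [had₂]
    exact (commute_lift _ (fun z => (P.commute_left₁_antiRight₂ x z).symm)
      (fun z => (P.commute_left₁_left₂ x z).symm) _).symm
  have h := 𝓡.lift_comul_left P.antiRight₁ P.left₁ ad₂ P.commute_antiRight₁_left₁ c₁ c₂
    ((endTensor k D).comp
      (Algebra.TensorProduct.map P.adAct P.adAct)) (fun x y => by
        rw [← endTensor_biAct_left]
        exact TensorProduct.ext' fun f g => rfl)
  have h₁ := 𝓡.lift_comul_right P.antiRight₁ P.antiRight₂ P.left₂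
    P.commute_antiRight₁_antiRight₂ P.commute_antiRight₁_left₂ P.commute_antiRight₂_left₂
    (Algebra.TensorProduct.lift P.antiRight₁ ad₂ c₁)
    (fun x y => by rw [Algebra.TensorProduct.lift_tmul, had₂])
  have h₂ := 𝓡.lift_comul_right P.left₁ P.antiRight₂ P.left₂
    P.commute_left₁_antiRight₂ P.commute_left₁_left₂ P.commute_antiRight₂_left₂
    (Algebra.TensorProduct.lift P.left₁ ad₂ c₂)
    (fun x y => by rw [Algebra.TensorProduct.lift_tmul, had₂])
  rw [h₁, h₂] at h
  simp only [lift_eq_evalPair] at h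
  exact h

/-- In `R₁₄ R₁₃ R₂₄ R₂₃` the last factor cancels the R-matrix between the K-matrices. Then `R₁₃`
moves past `R₂₄`, with which it shares no leg, and cancels the operator of `R⁻¹`. In the surviving
`R₁₄ R₂₄` the antipode turns `R₁₄` into `R⁻¹`. This is the exchange relation at the level of
operators. -/
theorem endTensor_adAct_mul :
    endTensor k D
      (Algebra.TensorProduct.map P.adAct P.adAct (𝓡.R : H ⊗[k] H)) *
      (evalPair P.left₁.toLinearMap P.right₂ 𝓡.R *
        evalPair P.right₁ P.right₂ (𝓡.R⁻¹ : (H ⊗[k] H)ˣ)) =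
    evalPair P.right₁ P.left₂.toLinearMap (𝓡.R⁻¹ : (H ⊗[k] H)ˣ) *
      evalPair P.left₁.toLinearMap P.left₂.toLinearMap 𝓡.R := by
  have h₁ := P.evalPair_left₁_antiRight₂_mul 𝓡
  have h₂ := P.evalPair_antiRight_mul_inv 𝓡
  have h₃ : Commute (evalPair P.antiRight₁.toLinearMap P.antiRight₂.toLinearMap (𝓡.R : H ⊗[k] H))
      (evalPair P.left₁.toLinearMap P.left₂.toLinearMap 𝓡.R) :=
    evalPair_commute P.commute_antiRight₁_left₁ P.commute_antiRight₁_left₂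
      (fun x y => (P.commute_left₁_antiRight₂ y x).symm) P.commute_antiRight₂_left₂ _ _
  have h₄ : evalPair P.antiRight₁.toLinearMap P.left₂.toLinearMap (𝓡.R : H ⊗[k] H) =
      evalPair P.right₁ P.left₂.toLinearMap (𝓡.R⁻¹ : (H ⊗[k] H)ˣ) := by
    rw [antiRight₁_toLinearMap, ← 𝓡.antipode_left, evalPair_map, LinearMap.comp_id]
  rw [endTensor_adAct, h₄]
  generalize evalPair P.left₁.toLinearMap P.left₂.toLinearMap (𝓡.R : H ⊗[k] H) = a at *
  generalize evalPair P.antiRight₁.toLinearMap P.antiRight₂.toLinearMap (𝓡.R : H ⊗[k] H) = b at *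
  generalize evalPair P.left₁.toLinearMap P.antiRight₂.toLinearMap (𝓡.R : H ⊗[k] H) = c at *
  generalize evalPair P.left₁.toLinearMap P.right₂ (𝓡.R : H ⊗[k] H) = d at *
  rw [mul_assoc, mul_assoc, mul_assoc a, ← mul_assoc c, h₁, one_mul, ← mul_assoc b, h₃.eq,
    mul_assoc a, h₂, mul_one]

/-- For `u = v = R` the left side is the product of `H̃*`, here expressed by the ordinary product
and operators on `D ⊗ D`. In `R₁₃` both legs act by `◁ γ(·)`; in `R₂₃` the first leg acts by `▷`.
Separate `u` and `v` allow linearity in each. -/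
theorem mulVia_biAct (u v : H ⊗[k] H) (f g : D) :
    mulVia P.biAct (Algebra.TensorProduct.map (incl₁ k H) (incl₁ k H) u *
      Algebra.TensorProduct.map (incl₂ k H) (incl₁ k H) v) f g =
    LinearMap.mul' k D ((evalPair P.antiRight₁.toLinearMap P.antiRight₂.toLinearMap u *
      evalPair P.left₁.toLinearMap P.antiRight₂.toLinearMap v) (f ⊗ₜ[k] g)) := by
  induction u with
  | zero => simp
  | add p q hp hq => simp only [map_add, add_mul, LinearMap.add_apply, hp, hq]
  | tmul x y =>
    induction v with
    | zero => simp
    | add p q hp hq => simp only [map_add, mul_add, LinearMap.add_apply, hp, hq]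
    | tmul x' y' =>
      rw [Algebra.TensorProduct.map_tmul, Algebra.TensorProduct.map_tmul, mulVia_mul_tmul,
        mulVia_tmul, evalPair_tmul, evalPair_tmul]
      have h₁ : ∀ (z : H) (a : D), P.biAct (incl₁ k H z) a = P.rightAct z a := fun z a => by
        rw [incl₁_apply, biAct_tmul, map_one, Module.End.one_apply]
      have h₂ : ∀ (z : H) (a : D), P.biAct (incl₂ k H z) a = P.leftAct z a := fun z a => by
        rw [incl₂_apply, biAct_tmul, map_one, Module.End.one_apply]
      rw [h₁, h₁, h₁, h₂]
      rfl

/-- The products `g ∘ f` arise on the side where `K₂` precedes `K₁`; the operators are recorded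
before the flip so that they compose with those of that side. -/
theorem mulVia_biAct_comm (u v : H ⊗[k] H) (f g : D) :
    mulVia P.biAct (Algebra.TensorProduct.map (incl₁ k H) (incl₁ k H) u *
      Algebra.TensorProduct.map (incl₂ k H) (incl₁ k H) v) g f =
    LinearMap.mul' k D (TensorProduct.comm k D D
      ((evalPair P.antiRight₂.toLinearMap P.antiRight₁.toLinearMap u *
      evalPair P.left₂.toLinearMap P.antiRight₁.toLinearMap v) (f ⊗ₜ[k] g))) := by
  rw [mulVia_biAct]
  congr 1
  induction u with
  | zero => simp
  | add p q hp hq => simp only [map_add, add_mul, LinearMap.add_apply, hp, hq]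
  | tmul x y =>
    induction v with
    | zero => simp
    | add p q hp hq => simp only [map_add, mul_add, LinearMap.add_apply, hp, hq]
    | tmul x' y' =>
      rw [evalPair_tmul, evalPair_tmul, evalPair_tmul, evalPair_tmul]
      rfl

/-- The pairing between `D ⊗ D` and `H ⊗ H`. -/
noncomputable def pairTensor : D ⊗[k] D →ₗ[k] H ⊗[k] H →ₗ[k] k :=
  TensorProduct.dualDistrib k H H ∘ₗ TensorProduct.map P.pair P.pair

@[simp] theorem pairTensor_tmul (f g : D) (x y : H) :
    P.pairTensor (f ⊗ₜ[k] g) (x ⊗ₜ[k] y) = P.pair f x * P.pair g y := by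
  simp [pairTensor]

theorem pair_mul' (t : D ⊗[k] D) (x : H) :
    P.pair (LinearMap.mul' k D t) x = P.pairTensor t (comul x) := by
  induction t with
  | zero => simp
  | add s t hs ht => simp only [map_add, LinearMap.add_apply, hs, ht]
  | tmul f g =>
    rw [LinearMap.mul'_apply, P.mul_left]
    generalize comul (R := k) x = u
    induction u with
    | zero => simp
    | add p q hp hq => simp only [map_add, hp, hq]
    | tmul x y => simp

theorem pairTensor_comm (t : D ⊗[k] D) (z : H ⊗[k] H) :
    P.pairTensor (TensorProduct.comm k D D t) z = P.pairTensor t (flip₂₁ k H z) := by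
  induction t with
  | zero => simp
  | add s t hs ht => simp only [map_add, LinearMap.add_apply, hs, ht]
  | tmul f g =>
    induction z with
    | zero => simp
    | add p q hp hq => simp only [map_add, hp, hq]
    | tmul x y => simp [flip₂₁, mul_comm]

/-- The coregular actions are transposes of multiplications in `H`, so pairing turns operators on `D
⊗ D` back into products in `H ⊗ H`. -/
theorem pairTensor_right (u : H ⊗[k] H) (t : D ⊗[k] D) (z : H ⊗[k] H) :
    P.pairTensor (evalPair P.right₁ P.right₂ u t) z = P.pairTensor t (u * z) := by
  induction u with
  | zero => simp
  | add p q hp hq => simp only [map_add, LinearMap.add_apply, add_mul, hp, hq]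
  | tmul x y =>
    induction t with
    | zero => simp
    | add s t hs ht => simp only [map_add, LinearMap.add_apply, hs, ht]
    | tmul f g =>
      induction z with
      | zero => simp
      | add p q hp hq => simp only [map_add, mul_add, hp, hq]
      | tmul x' y' => simp [right₁_tmul, right₂_tmul, pair_right]

theorem pairTensor_left (u : H ⊗[k] H) (t : D ⊗[k] D) (z : H ⊗[k] H) :
    P.pairTensor (evalPair P.left₁.toLinearMap P.left₂.toLinearMap u t) z =
      P.pairTensor t (z * u) := by
  induction u with
  | zero => simp
  | add p q hp hq => simp only [map_add, LinearMap.add_apply, mul_add, hp, hq]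
  | tmul x y =>
    induction t with
    | zero => simp
    | add s t hs ht => simp only [map_add, LinearMap.add_apply, hs, ht]
    | tmul f g =>
      induction z with
      | zero => simp
      | add p q hp hq => simp only [map_add, add_mul, hp, hq]
      | tmul x' y' => simp [left₁_tmul, left₂_tmul, pair_left]

theorem mul_mul_mul_eq_of_mul_eq_one {M : Type*} [Monoid M] {a b c d : M} (h : b * c = 1) :
    a * b * (c * d) = a * d := by
  rw [mul_assoc, ← mul_assoc b, h, one_mul]

/-- The reflection equation in `H̃*`. -/
theorem mul'_reflection (t : D ⊗[k] D) :
    LinearMap.mul' k D ((evalPair P.antiRight₁.toLinearMap P.antiRight₂.toLinearMap 𝓡.R *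
      evalPair P.left₁.toLinearMap P.antiRight₂.toLinearMap 𝓡.R)
      ((evalPair P.left₁.toLinearMap P.right₂ 𝓡.R *
        evalPair P.right₁ P.right₂ (flip₂₁ k H 𝓡.R)) t)) =
    LinearMap.mul' k D (TensorProduct.comm k D D
      ((evalPair P.antiRight₂.toLinearMap P.antiRight₁.toLinearMap 𝓡.R *
      evalPair P.left₂.toLinearMap P.antiRight₁.toLinearMap 𝓡.R)
      ((evalPair P.right₁ P.left₂.toLinearMap (flip₂₁ k H 𝓡.R) *
          evalPair P.left₁.toLinearMap P.left₂.toLinearMap 𝓡.R) t))) := by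
  -- On each side the inner two of the four operators cancel, on the right once `R₂₁` has been
  -- rewritten as `R` with its legs interchanged. The outer operators with antipodes become plain
  -- right actions by `(γ ⊗ γ)(R) = R`.
  rw [← Module.End.mul_apply, ← Module.End.mul_apply,
    evalPair_flip (α := P.right₁) (β := P.left₂.toLinearMap)
      (fun x y => (P.commute_left₂_right₁ y x).symm),
    mul_mul_mul_eq_of_mul_eq_one (P.evalPair_left₁_antiRight₂_mul 𝓡),
    mul_mul_mul_eq_of_mul_eq_one (P.evalPair_left₂_antiRight₁_mul 𝓡),
    evalPair_antiRight₁_antiRight₂, evalPair_antiRight₂_antiRight₁,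
    ← evalPair_flip P.commute_right₁_right₂]
  refine P.ext fun x => ?_
  rw [pair_mul', pair_mul', pairTensor_comm, Module.End.mul_apply, Module.End.mul_apply,
    pairTensor_right, pairTensor_right, pairTensor_right, pairTensor_left]
  -- The two sides are now the pairings of `t` with `R₂₁ R Δ(x)` and `R₂₁ Δᵒᵖ(x) R`.
  have h := 𝓡.flip_comul x
  rw [Bialgebra.comulAlgHom_apply] at h
  rw [h, mul_assoc]
  rfl

end HopfDual

end Operators

/-! ### The two relations in the completed tensor product -/

section Relations

open WithConv

variable {k : Type u} {H : Type v} {D : Type u} [CommRing k] [Ring H]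
  [HopfAlgebra k H] [Ring D] [HopfAlgebra k D] (P : HopfDual k H D) (𝓡 : UniversalR k H)

namespace HopfDual

theorem embed_mul (n : ℕ) (l : Fin n) (f g : D) : P.embed 𝓡 n l f * P.embed 𝓡 n l g =
    P.embed 𝓡 n l (mulVia P.biAct (𝓡.R₁₃ * 𝓡.R₂₃) f g) :=
  (ModAlg.embed_mul 𝓡 (reDual 𝓡 P) n l (toReDual 𝓡 P f) (toReDual 𝓡 P g)).symm

theorem mul'_map_embed (n : ℕ) (l : Fin n) (t : D ⊗[k] D) :
    LinearMap.mul' k _ (TensorProduct.map (P.embed 𝓡 n l) (P.embed 𝓡 n l) t) =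
    P.embed 𝓡 n l (LinearMap.mul' k D
      ((evalPair P.antiRight₁.toLinearMap P.antiRight₂.toLinearMap 𝓡.R *
      evalPair P.left₁.toLinearMap P.antiRight₂.toLinearMap 𝓡.R) t)) := by
  induction t with
  | zero => simp
  | add s t hs ht => simp only [map_add, hs, ht]
  | tmul f g =>
    rw [TensorProduct.map_tmul, LinearMap.mul'_apply, embed_mul, ← mulVia_biAct]
    rfl

theorem mul'_map_embed_comm (n : ℕ) (l : Fin n) (t : D ⊗[k] D) :
    LinearMap.mul' k _ (TensorProduct.map (P.embed 𝓡 n l) (P.embed 𝓡 n l)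
      (TensorProduct.comm k D D t)) =
    P.embed 𝓡 n l (LinearMap.mul' k D (TensorProduct.comm k D D
      ((evalPair P.antiRight₂.toLinearMap P.antiRight₁.toLinearMap 𝓡.R *
      evalPair P.left₂.toLinearMap P.antiRight₁.toLinearMap 𝓡.R) t))) := by
  induction t with
  | zero => simp
  | add s t hs ht => simp only [map_add, hs, ht]
  | tmul f g =>
    rw [TensorProduct.comm_tmul, TensorProduct.map_tmul, LinearMap.mul'_apply, embed_mul,
      ← mulVia_biAct_comm]
    rfl

/-- This is `embed_mul_embed` moved from `H̃*` to the underlying module `D`, where the action of `R`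
is an operator that can be composed with the coregular ones. -/
theorem mul'_map_embed_embed (n : ℕ) {l j : Fin n} (hlj : l < j) (t : D ⊗[k] D) :
    LinearMap.mul' k _ (TensorProduct.map (P.embed 𝓡 n j) (P.embed 𝓡 n l) t) =
    LinearMap.mul' k _ (TensorProduct.map (P.embed 𝓡 n l) (P.embed 𝓡 n j)
      (TensorProduct.comm k D D (endTensor k D
        (Algebra.TensorProduct.map P.adAct P.adAct (𝓡.R : H ⊗[k] H)) t))) := by
  have h := ModAlg.embed_mul_embed 𝓡 (reDual 𝓡 P) n hlj
    (TensorProduct.map (toReDual 𝓡 P).toLinearMap (toReDual 𝓡 P).toLinearMap t)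
  have h₁ : ∀ (u : H ⊗[k] H) (t : D ⊗[k] D), TensorProduct.comm k _ _
      (tensorAct (reDual 𝓡 P) (reDual 𝓡 P) u
      (TensorProduct.map (toReDual 𝓡 P).toLinearMap (toReDual 𝓡 P).toLinearMap t)) =
      TensorProduct.map (toReDual 𝓡 P).toLinearMap (toReDual 𝓡 P).toLinearMap
        (TensorProduct.comm k D D (endTensor k D
        (Algebra.TensorProduct.map P.adAct P.adAct u) t)) := by
    intro u t
    induction u with
    | zero => simp only [map_zero, LinearMap.zero_apply]
    | add p q hp hq => simp only [map_add, LinearMap.add_apply, hp, hq]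
    | tmul x y =>
      induction t with
      | zero => simp only [map_zero]
      | add p q hp hq => simp only [map_add, hp, hq]
      | tmul f g => rfl
  rw [h₁] at h
  simp only [← LinearMap.comp_apply (TensorProduct.map _ _) (TensorProduct.map _ _),
    ← TensorProduct.map_comp] at h
  exact h

theorem reflection_completed (n : ℕ) (l : Fin n) :
    P.scalar (P.Power 𝓡 n) (flip₂₁ k H 𝓡.R) * leg₁ (P.embed 𝓡 n l) *
        P.scalar (P.Power 𝓡 n) 𝓡.R * leg₂ (P.embed 𝓡 n l) =
      leg₂ (P.embed 𝓡 n l) * P.scalar (P.Power 𝓡 n) (flip₂₁ k H 𝓡.R) *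
        leg₁ (P.embed 𝓡 n l) * P.scalar (P.Power 𝓡 n) 𝓡.R := by
  rw [scalar_leg₁_scalar_leg₂, leg₂_scalar_leg₁_scalar]
  refine WithConv.ext (LinearMap.ext fun t => ?_)
  simp only [LinearMap.comp_apply, LinearEquiv.coe_coe]
  rw [mul'_map_embed, mul'_map_embed_comm, mul'_reflection]

theorem exchange_completed (n : ℕ) {l j : Fin n} (hlj : l < j) :
    P.scalar (P.Power 𝓡 n) (𝓡.R⁻¹ : (H ⊗[k] H)ˣ) * leg₁ (P.embed 𝓡 n j) *
        P.scalar (P.Power 𝓡 n) 𝓡.R * leg₂ (P.embed 𝓡 n l) =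
      leg₂ (P.embed 𝓡 n l) * P.scalar (P.Power 𝓡 n) (𝓡.R⁻¹ : (H ⊗[k] H)ˣ) *
        leg₁ (P.embed 𝓡 n j) * P.scalar (P.Power 𝓡 n) 𝓡.R := by
  rw [scalar_leg₁_scalar_leg₂, leg₂_scalar_leg₁_scalar]
  refine WithConv.ext (LinearMap.ext fun t => ?_)
  simp only [LinearMap.comp_apply, LinearEquiv.coe_coe]
  -- The braiding brings the left side to the order `ι_l`, `ι_j` after a flip, which is the form of
  -- the right side; the operators before the flip agree by `endTensor_adAct_mul`.
  rw [mul'_map_embed_embed P 𝓡 n hlj, ← endTensor_adAct_mul]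
  rfl

end HopfDual

end Relations

/-! ### Descent to the algebraic tensor product for a finite basis -/

section FiniteBasis

open WithConv

variable {k : Type u} {H : Type v} {D : Type w} {A : Type*} [CommRing k] [Ring H]
  [HopfAlgebra k H] [Ring D] [HopfAlgebra k D] [Ring A] [Algebra k A] (P : HopfDual k H D)

namespace HopfDual

/-- The map from the tensor product to its completion, with
`x ⊗ y ⊗ a ↦ (f ⊗ g ↦ ⟨f, x⟩ ⟨g, y⟩ a)`. -/
noncomputable def complete (A : Type*) [Ring A] [Algebra k A] :
    (H ⊗[k] H) ⊗[k] A →ₗ[k] D ⊗[k] D →ₗ[k] A :=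
  TensorProduct.lift (LinearMap.smulRightₗ ∘ₗ P.pairTensor.flip)

theorem complete_tmul (z : H ⊗[k] H) (a : A) (t : D ⊗[k] D) :
    P.complete A (z ⊗ₜ[k] a) t = P.pairTensor t z • a := by
  simp [complete]

/-- A Hopf pairing turns the product of `H` into the coproduct of `D`, that is, `⟨f, x x'⟩ = ⟨f₁, x⟩
⟨f₂, x'⟩`, which is what the convolution requires in each leg. -/
theorem complete_mul (X Y : (H ⊗[k] H) ⊗[k] A) :
    toConv (P.complete A (X * Y)) = toConv (P.complete A X) * toConv (P.complete A Y) := by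
  induction X with
  | zero => simp
  | add p q hp hq => simp only [add_mul, map_add, toConv_add, hp, hq]
  | tmul z a =>
    induction Y with
    | zero => simp
    | add p q hp hq => simp only [mul_add, map_add, toConv_add, hp, hq]
    | tmul z' a' =>
      induction z with
      | zero => simp
      | add p q hp hq => simp only [add_tmul, add_mul, map_add, toConv_add, hp, hq]
      | tmul x y =>
        induction z' with
        | zero => simp
        | add p q hp hq => simp only [add_tmul, mul_add, map_add, toConv_add, hp, hq]
        | tmul x' y' =>
          refine WithConv.ext (TensorProduct.ext' fun f g => ?_)
          have h : ∀ S T : D ⊗[k] D, LinearMap.mul' k A (TensorProduct.map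
              (P.complete A ((x ⊗ₜ[k] y) ⊗ₜ[k] a)) (P.complete A ((x' ⊗ₜ[k] y') ⊗ₜ[k] a'))
              (TensorProduct.tensorTensorTensorComm k D D D D (S ⊗ₜ[k] T))) =
              (LinearMap.mul' k k (TensorProduct.map (P.pair.flip x) (P.pair.flip x') S) *
              LinearMap.mul' k k (TensorProduct.map (P.pair.flip y) (P.pair.flip y') T)) •
                (a * a') := by
            intro S T
            induction S with
            | zero => simp
            | add p q hp hq => simp only [add_tmul, map_add, add_mul, add_smul, hp, hq]
            | tmul p q =>
              induction T with
              | zero => simp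
              | add p q hp hq => simp only [tmul_add, map_add, mul_add, add_smul, hp, hq]
              | tmul r s =>
                simp [complete_tmul, smul_smul, mul_mul_mul_comm, mul_comm]
          rw [completed_mul_tmul, h, ← P.mul_right, ← P.mul_right]
          simp [complete_tmul]

theorem complete_scalarMat (u : H ⊗[k] H) :
    toConv (P.complete A (scalarMat k H A u)) = P.scalar A u := by
  refine WithConv.ext (LinearMap.ext fun t => ?_)
  change P.complete A (u ⊗ₜ[k] 1) t = _
  rw [complete_tmul]
  simp [scalar, pairTensor, Algebra.smul_def]

variable {m : ℕ} (e : Module.Basis (Fin m) k H) {e' : Fin m → D}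

theorem pair_dualBasis (he : ∀ i j, P.pair (e' i) (e j) = if i = j then 1 else 0)
    (i : Fin m) (x : H) : P.pair (e' i) x = e.repr x i := by
  have : P.pair (e' i) = e.coord i := e.ext fun j => by
    rw [he, e.coord_apply, e.repr_self, Finsupp.single_apply]
    simp [eq_comm]
  rw [this, e.coord_apply]

/-- Both sides pair equally with every basis vector, and the pairing separates the elements of `D`.
Hence the dual family spans `D`, and the canonical element represents the identity map. -/
theorem sum_dualBasis (he : ∀ i j, P.pair (e' i) (e j) = if i = j then 1 else 0)
    (f : D) : ∑ i, P.pair f (e i) • e' i = f := by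
  refine P.ext fun x => ?_
  have : P.pair (∑ i, P.pair f (e i) • e' i) = P.pair f := e.ext fun j => by
    simp [he]
  rw [this]

theorem complete_mat₁ (he : ∀ i j, P.pair (e' i) (e j) = if i = j then 1 else 0)
    (φ : D →ₗ[k] A) :
    toConv (P.complete A (mat₁ (canonical e e' φ))) = leg₁ φ := by
  refine WithConv.ext (TensorProduct.ext' fun f g => ?_)
  rw [leg₁_tmul]
  conv_rhs => rw [← P.sum_dualBasis e he f]
  simp [mat₁, canonical, complete_tmul, P.one_right, Finset.smul_sum, smul_smul, mul_comm]

theorem complete_mat₂ (he : ∀ i j, P.pair (e' i) (e j) = if i = j then 1 else 0)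
    (φ : D →ₗ[k] A) :
    toConv (P.complete A (mat₂ (canonical e e' φ))) = leg₂ φ := by
  refine WithConv.ext (TensorProduct.ext' fun f g => ?_)
  rw [leg₂_tmul]
  conv_rhs => rw [← P.sum_dualBasis e he g]
  simp [mat₂, canonical, complete_tmul, P.one_right, Finset.smul_sum, smul_smul]

/-- An element is recovered from its values on the dual family, which are its coefficients with
respect to `e i ⊗ e j`. This gives a left inverse of the completion map for every algebra `A`. -/
theorem sum_complete (he : ∀ i j, P.pair (e' i) (e j) = if i = j then 1 else 0)
    (X : (H ⊗[k] H) ⊗[k] A) :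
    ∑ i, ∑ j, (e i ⊗ₜ[k] e j) ⊗ₜ[k] P.complete A X (e' i ⊗ₜ[k] e' j) = X := by
  induction X with
  | zero => simp
  | add p q hp hq =>
    simp only [map_add, LinearMap.add_apply, tmul_add, Finset.sum_add_distrib, hp, hq]
  | tmul z a =>
    induction z with
    | zero => simp
    | add p q hp hq =>
      simp only [add_tmul, map_add, LinearMap.add_apply, tmul_add, Finset.sum_add_distrib, hp, hq]
    | tmul x y =>
      conv_rhs => rw [← e.sum_repr x, ← e.sum_repr y]
      simp only [complete_tmul, pairTensor_tmul, P.pair_dualBasis e he, sum_tmul, tmul_sum,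
        TensorProduct.tmul_smul, ← TensorProduct.smul_tmul']
      rw [Finset.sum_comm]
      simp only [Finset.smul_sum, smul_smul, mul_comm]

theorem complete_injective
    (he : ∀ i j, P.pair (e' i) (e j) = if i = j then 1 else 0) :
    Function.Injective (P.complete A) := fun X Y h => by
  rw [← P.sum_complete e he X, ← P.sum_complete e he Y, h]

end HopfDual

end FiniteBasis

end ReflEq

theorem mainTheorem6 {k : Type u} {H : Type v} {D : Type u} [CommRing k] [Ring H]
    [HopfAlgebra k H] [Ring D] [HopfAlgebra k D] (𝓡 : ReflEq.UniversalR k H)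
    (P : ReflEq.HopfDual k H D) (n : ℕ) :
    -- the relations in the completed tensor product, for every Hopf algebra
    ((∀ l : Fin n,
        P.scalar (P.Power 𝓡 n) (ReflEq.flip₂₁ k H 𝓡.R) * ReflEq.leg₁ (P.embed 𝓡 n l) *
            P.scalar (P.Power 𝓡 n) 𝓡.R * ReflEq.leg₂ (P.embed 𝓡 n l) =
          ReflEq.leg₂ (P.embed 𝓡 n l) * P.scalar (P.Power 𝓡 n) (ReflEq.flip₂₁ k H 𝓡.R) *
            ReflEq.leg₁ (P.embed 𝓡 n l) * P.scalar (P.Power 𝓡 n) 𝓡.R) ∧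
      ∀ l j : Fin n, l < j →
        P.scalar (P.Power 𝓡 n) (𝓡.R⁻¹ : (H ⊗[k] H)ˣ) * ReflEq.leg₁ (P.embed 𝓡 n j) *
            P.scalar (P.Power 𝓡 n) 𝓡.R * ReflEq.leg₂ (P.embed 𝓡 n l) =
          ReflEq.leg₂ (P.embed 𝓡 n l) * P.scalar (P.Power 𝓡 n) (𝓡.R⁻¹ : (H ⊗[k] H)ˣ) *
            ReflEq.leg₁ (P.embed 𝓡 n j) * P.scalar (P.Power 𝓡 n) 𝓡.R) ∧
    -- the relations in the tensor product, for a finite basis of `H` with a dual basis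
    ∀ (m : ℕ) (e : Module.Basis (Fin m) k H) (e' : Fin m → D),
      (∀ i j, P.pair (e' i) (e j) = if i = j then 1 else 0) →
      ∀ (𝓚 : Fin n → H ⊗[k] P.Power 𝓡 n),
        (∀ l, 𝓚 l = ReflEq.canonical e e' (P.embed 𝓡 n l)) →
        (∀ l : Fin n,
          ReflEq.scalarMat k H (P.Power 𝓡 n) (ReflEq.flip₂₁ k H 𝓡.R) * ReflEq.mat₁ (𝓚 l) *
              ReflEq.scalarMat k H (P.Power 𝓡 n) 𝓡.R * ReflEq.mat₂ (𝓚 l) =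
            ReflEq.mat₂ (𝓚 l) * ReflEq.scalarMat k H (P.Power 𝓡 n) (ReflEq.flip₂₁ k H 𝓡.R) *
              ReflEq.mat₁ (𝓚 l) * ReflEq.scalarMat k H (P.Power 𝓡 n) 𝓡.R) ∧
        ∀ l j : Fin n, l < j →
          ReflEq.scalarMat k H (P.Power 𝓡 n) (𝓡.R⁻¹ : (H ⊗[k] H)ˣ) * ReflEq.mat₁ (𝓚 j) *
              ReflEq.scalarMat k H (P.Power 𝓡 n) 𝓡.R * ReflEq.mat₂ (𝓚 l) =
            ReflEq.mat₂ (𝓚 l) * ReflEq.scalarMat k H (P.Power 𝓡 n) (𝓡.R⁻¹ : (H ⊗[k] H)ˣ) *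
              ReflEq.mat₁ (𝓚 j) * ReflEq.scalarMat k H (P.Power 𝓡 n) 𝓡.R := by
  refine ⟨⟨fun l => P.reflection_completed 𝓡 n l,
    fun l j hlj => P.exchange_completed 𝓡 n hlj⟩, ?_⟩
  intro m e e' he 𝓚 h𝓚
  have mul : ∀ X Y : (H ⊗[k] H) ⊗[k] P.Power 𝓡 n,
      WithConv.toConv (P.complete (P.Power 𝓡 n) (X * Y)) =
      WithConv.toConv (P.complete (P.Power 𝓡 n) X) *
        WithConv.toConv (P.complete (P.Power 𝓡 n) Y) := P.complete_mul
  refine ⟨fun l => ?_, fun l j hlj => ?_⟩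
  · refine P.complete_injective e he (WithConv.toConv_injective ?_)
    -- Completion carries each factor to its counterpart, so the image of the relation is the one
    -- already proved.
    simp only [mul, h𝓚, P.complete_mat₁ e he, P.complete_mat₂ e he, P.complete_scalarMat]
    exact P.reflection_completed 𝓡 n l
  · refine P.complete_injective e he (WithConv.toConv_injective ?_)
    simp only [mul, h𝓚, P.complete_mat₁ e he, P.complete_mat₂ e he, P.complete_scalarMat]
    exact P.exchange_completed 𝓡 n hlj
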